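/- **Setting.** Let $\mathbf A=(a_{ij})_{i,j\in\mathbf I}$ be an indecomposable symmetrizable generalized Cartan matrix, $(\mathfrak h,\{\alpha_i\},\{\alpha_i^\vee\})$ a realization of $\mathbf A$ over $\mathbb C$ (so $\alpha_j(\alpha_i^\vee)=a_{ij}$), and $\mathfrak g$ the associated Kac–Moody algebra. Let $d_{ij}=\frac{(\alpha_i,\alpha_j)}2$ and $d_i=d_{ii}$, where the standard invariant form $(\,,)$ is normalized so that the $d_i$ are relatively prime positive integers; thus $d_{ij}=\frac{d_ia_{ij}}2$. *Yangian.* $Y_\hbar\mathfrak g$ is the unital associative $\mathbb C[\hbar]$-algebra generated by $h\in\mathfrak h$ (included linearly) and $x_{ir}^\pm,h_{ir}$ ($i\in\mathbf I$, $r\in\mathbb N$), with relations, for $i,j\in\mathbf I$, $r,s,r_1,\dots,r_m\in\mathbb N$, $h,h'\in\mathfrak h$: $$h_{i0}=d_i\alpha_i^\vee,\quad [h_{ir},h_{js}]=[h_{ir},h]=[h,h']=0,\quad [h,x_{js}^\pm]=\pm\alpha_j(h)x_{js}^\pm,\quad [x_{ir}^+,x_{js}^-]=\delta_{ij}h_{i,r+s},$$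 $$[h_{i,r+1},x_{js}^\pm]-[h_{ir},x_{j,s+1}^\pm]=\pm\hbar d_{ij}(h_{ir}x_{js}^\pm+x_{js}^\pm h_{ir}),$$ $$[x_{i,r+1}^\pm,x_{js}^\pm]-[x_{ir}^\pm,x_{j,s+1}^\pm]=\pm\hbar d_{ij}(x_{ir}^\pm x_{js}^\pm+x_{js}^\pm x_{ir}^\pm),$$ $$\sum_{\pi\in S_m}\bigl[x_{i,r_{\pi(1)}}^\pm,\bigl[x_{i,r_{\pi(2)}}^\pm,\cdots,[x_{i,r_{\pi(m)}}^\pm,x_{js}^\pm]\cdots\bigr]\bigr]=0\qquad(i\ne j,\ m=1-a_{ij}).$$ It is $\mathbb N$-graded with $\deg\hbar=1$, $\deg\mathfrak h=0$, $\deg x_{ir}^\pm=\deg h_{ir}=r$; its $k$-th component is $Y_\hbar\mathfrak g_k$. For $c\in\mathbb C$, the shift automorphism $\tau_c$ of $Y_\hbar\mathfrak g$ is given by $$\tau_c(h)=h,\qquad \tau_c(x_{ir}^\pm)=\sum_{k=0}^r\binom rk x_{ik}^\pm c^{r-k},\qquad \tau_c(h_{ir})=\sum_{k=0}^r\binom rk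 h_{ik}c^{r-k},$$ and the formal shift homomorphism $\tau_z:Y_\hbar\mathfrak g\to Y_\hbar\mathfrak g[z]$ by the same formulas with $c$ replaced by the indeterminate $z$. *Yangian double.* The Yangian double $\mathrm DY_\hbar\mathfrak g$ is the unital associative $\mathbb C[\![\hbar]\!]$-algebra topologically generated (in the $\hbar$-adic topology) by $h\in\mathfrak h$ and $\mathcal X_{ir}^\pm,\mathcal H_{ir}$ ($i\in\mathbf I$, $r\in\mathbb Z$), subject to the relations above with $x_{ir}^\pm,h_{ir}$ replaced by $\mathcal X_{ir}^\pm,\mathcal H_{ir}$ and all indices allowed to be arbitrary integers. The $\mathbb C[\hbar]$-form $\mathbb DY_\hbar\mathfrak g$ is the $\mathbb C[\hbar]$-algebra with the same generators and relations; it is $\mathbb Z$-graded with $\deg\hbar=1$, $\deg\mathfrak h=0$, $\deg\mathcal X_{ir}^\pm=\deg\mathcal H_{ir}=r$. Let $\jmath:\mathbb DY_\hbar\mathfrak g\to\mathrm DY_\hbar\mathfrak g$ be the natural $\mathbb C[\hbar]$-algebra homomorphism and let $\iota:Y_\hbar\mathfrak g\to\mathrm DY_\hbar\mathfrak g$ be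 the $\mathbb C[\hbar]$-algebra homomorphism with $h\mapsto h$, $x_{ir}^\pm\mapsto\mathcal X_{ir}^\pm$, $h_{ir}\mapsto\mathcal H_{ir}$. Put $\mathcal X_i^\pm(u)=\sum_{r\in\mathbb Z}\mathcal X_{ir}^\pm u^{-r-1}$ and $\mathcal H_i(u)=\sum_{r\in\mathbb Z}\mathcal H_{ir}u^{-r-1}$. *Completions.* Let $\widehat{Y_\hbar\mathfrak g}=\prod_{k\in\mathbb N}Y_\hbar\mathfrak g_k$, a $\mathbb C[\![\hbar]\!]$-algebra. Put $\widehat{Y_\hbar\mathfrak g}_z=\prod_{k\in\mathbb N}Y_\hbar\mathfrak g_kz^{-k}\subset Y_\hbar\mathfrak g[\![z^{-1}]\!]$ and $$\mathbb L\widehat{Y_\hbar\mathfrak g}_z=\bigoplus_{n\in\mathbb Z}z^n\,\widehat{Y_\hbar\mathfrak g}_z\ \subset\ \bigcup_{n\in\mathbb N}z^nY_\hbar\mathfrak g[\![z^{-1}]\!],$$ a $\mathbb Z$-graded $\mathbb C[\hbar]$-algebra containing $Y_\hbar\mathfrak g[z]$, whose component of degree $n$ is $z^n\widehat{Y_\hbar\mathfrak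 g}_z$. Let $\mathrm L\widehat{Y_\hbar\mathfrak g}_z=\varprojlim_n\mathbb L\widehat{Y_\hbar\mathfrak g}_z/\hbar^n\mathbb L\widehat{Y_\hbar\mathfrak g}_z$ be its $\hbar$-adic completion. For $c\in\mathbb C^\times$, let $\mathscr{Ev}_c:\mathrm L\widehat{Y_\hbar\mathfrak g}_z\to\widehat{Y_\hbar\mathfrak g}$ be evaluation at $z=c$, i.e. the $\mathbb C[\![\hbar]\!]$-algebra homomorphism with $z^n\sum_ky_kz^{-k}\mapsto(c^{\,n-k}y_k)_{k\in\mathbb N}$ for $y_k\in Y_\hbar\mathfrak g_k$, $n\in\mathbb Z$. Finally let $\delta(z/u)=\sum_{r\in\mathbb Z}z^ru^{-r}$ and $\partial_z^{(n)}=\frac1{n!}(\partial_z)^n$. **Theorem.** 1. There is a unique homomorphism of $\mathbb C[\![\hbar]\!]$-algebras $\Phi_z:\mathrm DY_\hbar\mathfrak g\to\mathrm L\widehat{Y_\hbar\mathfrak g}_z$ with $\Phi_z\circ\iota=\tau_z$. It is given by $\Phi_z(h)=h$ for $h\in\mathfrak h$ and, for all $i\in\mathbf I$, $$u\,\Phi_z(\mathcal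 H_i(u))=\sum_{n\in\mathbb N}h_{in}\,\partial_z^{(n)}\bigl(\delta(z/u)\bigr),\qquad u\,\Phi_z(\mathcal X_i^\pm(u))=\sum_{n\in\mathbb N}x_{in}^\pm\,\partial_z^{(n)}\bigl(\delta(z/u)\bigr).$$ 2. The composition $\Phi_z\circ\jmath$ is a $\mathbb Z$-graded $\mathbb C[\hbar]$-algebra homomorphism $\mathbb DY_\hbar\mathfrak g\to\mathbb L\widehat{Y_\hbar\mathfrak g}_z$. 3. Let $c\in\mathbb C^\times$. Then $\Phi_c=\mathscr{Ev}_c\circ\Phi_z$ is the unique homomorphism of $\mathbb C[\![\hbar]\!]$-algebras $\mathrm DY_\hbar\mathfrak g\to\widehat{Y_\hbar\mathfrak g}$ with $\Phi_c\circ\iota=\tau_c$. -/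

import Mathlib

open scoped Polynomial PowerSeries DirectSum

/-- The data attached to a symmetrizable Kac--Moody algebra with indecomposable Cartan matrix `A`:
a realization `(𝔥, {α_i}, {α_i^∨})` of `A` and the integers `d_i = (α_i, α_i) / 2` coming from the
standard invariant form, normalized so that they are positive and relatively prime. -/
structure KacMoodyDatum (I 𝔥 : Type*) [Fintype I] [AddCommGroup 𝔥] [Module ℂ 𝔥] where
  A : Matrix I I ℤ
  A_diag : ∀ i, A i i = 2
  A_nonpos : ∀ i j, i ≠ j → A i j ≤ 0
  A_zero : ∀ i j, A i j = 0 → A j i = 0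
  /-- There is no partition of `I` into two non-empty blocks not linked by `A`. -/
  A_indecomposable : ∀ S : Set I, S.Nonempty → Sᶜ.Nonempty → ∃ i ∈ S, ∃ j ∈ Sᶜ, A i j ≠ 0
  d : I → ℕ
  d_pos : ∀ i, 0 < d i
  d_coprime : Finset.univ.gcd d = 1
  d_symm : ∀ i j, (d i : ℤ) * A i j = (d j : ℤ) * A j i
  finiteDimensional : FiniteDimensional ℂ 𝔥
  root : I → Module.Dual ℂ 𝔥
  coroot : I → 𝔥
  root_linearIndependent : LinearIndependent ℂ root
  coroot_linearIndependent : LinearIndependent ℂ coroot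
  root_coroot : ∀ i j, root j (coroot i) = (A i j : ℂ)
  finrank_add_rank :
    Module.finrank ℂ 𝔥 + (A.map (fun a : ℤ => (a : ℂ))).rank = 2 * Fintype.card I

/-- `d_ij = (α_i, α_j) / 2 = d_i a_ij / 2`. -/
noncomputable def KacMoodyDatum.dd {I 𝔥 : Type*} [Fintype I] [AddCommGroup 𝔥] [Module ℂ 𝔥]
    (D : KacMoodyDatum I 𝔥) (i j : I) : ℂ :=
  (D.d i : ℂ) * (D.A i j : ℂ) / 2

/-- Generator symbols: `cartan h` for `h ∈ 𝔥`, `h i r` for `h_{ir}`, and `x ε i r` for `x_{ir}^±`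
(`ε = 1` for `+` and `ε = -1` for `-`). The index `r` runs over `K = ℕ` for the Yangian and
over `K = ℤ` for the Yangian double. -/
inductive YGen (I 𝔥 K : Type*) where
  | cartan (h : 𝔥) : YGen I 𝔥 K
  | h (i : I) (r : K) : YGen I 𝔥 K
  | x (ε : ℤˣ) (i : I) (r : K) : YGen I 𝔥 K

/-- Change of the index set of the generators. -/
def YGen.map {I 𝔥 K K' : Type*} (f : K → K') : YGen I 𝔥 K → YGen I 𝔥 K'
  | .cartan a => .cartan a
  | .h i r => .h i (f r)
  | .x ε i r => .x ε i (f r)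

/-- `deg h = 0`, `deg h_{ir} = deg x_{ir}^± = r`. -/
def YGen.deg {I 𝔥 : Type*} : YGen I 𝔥 ℤ → ℤ
  | .cartan _ => 0
  | .h _ r => r
  | .x _ _ r => r

section Relations

variable {I 𝔥 : Type*} [Fintype I] [AddCommGroup 𝔥] [Module ℂ 𝔥] (D : KacMoodyDatum I 𝔥)

/-- The defining relations, for a family `g` of elements of an algebra `F` and a central `ħ ∈ F`.
For `K = ℕ` these are the relations of the Yangian. For `K = ℤ` these are the coefficients of the
relations between the generating series `∑_{r ∈ ℤ} 𝓧_{ir}^± u^{-r-1}`, `∑_{r ∈ ℤ} 𝓗_{ir} u^{-r-1}` of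
the Yangian double. The first two say that `𝔥` is included linearly. -/
inductive YRel (K : Type*) [AddMonoidWithOne K] {F : Type*} [Ring F] [Algebra ℂ F]
    (ħ : F) (g : YGen I 𝔥 K → F) : F → F → Prop
  | cartan_add (h h' : 𝔥) :
      YRel K ħ g (g (.cartan (h + h'))) (g (.cartan h) + g (.cartan h'))
  | cartan_smul (c : ℂ) (h : 𝔥) :
      YRel K ħ g (g (.cartan (c • h))) (c • g (.cartan h))
  | h_zero (i : I) :
      YRel K ħ g (g (.h i 0)) ((D.d i : ℂ) • g (.cartan (D.coroot i)))
  | h_h (i j : I) (r s : K) :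
      YRel K ħ g ⁅g (.h i r), g (.h j s)⁆ 0
  | h_cartan (i : I) (r : K) (h : 𝔥) :
      YRel K ħ g ⁅g (.h i r), g (.cartan h)⁆ 0
  | cartan_cartan (h h' : 𝔥) :
      YRel K ħ g ⁅g (.cartan h), g (.cartan h')⁆ 0
  | cartan_x (ε : ℤˣ) (j : I) (s : K) (h : 𝔥) :
      YRel K ħ g ⁅g (.cartan h), g (.x ε j s)⁆ ((((ε : ℤ) : ℂ) * D.root j h) • g (.x ε j s))
  | x_x_same (i : I) (r s : K) :
      YRel K ħ g ⁅g (.x 1 i r), g (.x (-1) i s)⁆ (g (.h i (r + s)))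
  | x_x_ne (i j : I) (hij : i ≠ j) (r s : K) :
      YRel K ħ g ⁅g (.x 1 i r), g (.x (-1) j s)⁆ 0
  | h_x (ε : ℤˣ) (i j : I) (r s : K) :
      YRel K ħ g (⁅g (.h i (r + 1)), g (.x ε j s)⁆ - ⁅g (.h i r), g (.x ε j (s + 1))⁆)
        ((((ε : ℤ) : ℂ) * D.dd i j) •
          (ħ * (g (.h i r) * g (.x ε j s) + g (.x ε j s) * g (.h i r))))
  | x_x (ε : ℤˣ) (i j : I) (r s : K) :
      YRel K ħ g (⁅g (.x ε i (r + 1)), g (.x ε j s)⁆ - ⁅g (.x ε i r), g (.x ε j (s + 1))⁆)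
        ((((ε : ℤ) : ℂ) * D.dd i j) •
          (ħ * (g (.x ε i r) * g (.x ε j s) + g (.x ε j s) * g (.x ε i r))))
  | serre (ε : ℤˣ) (i j : I) (hij : i ≠ j) (r : Fin (1 - D.A i j).toNat → K) (s : K) :
      YRel K ħ g
        (∑ π : Equiv.Perm (Fin (1 - D.A i j).toNat),
          (List.ofFn fun k => g (.x ε i (r (π k)))).foldr (fun a b => ⁅a, b⁆) (g (.x ε j s)))
        0

/-- The family `g` satisfies the defining relations. -/
def YSat (K : Type*) [AddMonoidWithOne K] {F : Type*} [Ring F] [Algebra ℂ F]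
    (ħ : F) (g : YGen I 𝔥 K → F) : Prop :=
  ∀ ⦃a b : F⦄, YRel D K ħ g a b → a = b

variable {D} {K : Type*} [AddMonoidWithOne K] {F F' : Type*} [Ring F] [Algebra ℂ F] [Ring F']
  [Algebra ℂ F'] {ħ : F} {g : YGen I 𝔥 K → F}

theorem map_foldr_bracket (f : F →ₐ[ℂ] F') (l : List F) (y : F) :
    f (l.foldr (fun a b => ⁅a, b⁆) y) = (l.map f).foldr (fun a b => ⁅a, b⁆) (f y) := by
  induction l with
  | nil => rfl
  | cons a l ih => rw [List.foldr_cons, List.map_cons, List.foldr_cons, ← ih]; simp only [Ring.lie_def, map_sub, map_mul]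

theorem YRel.map (f : F →ₐ[ℂ] F') {a b : F} (h : YRel D K ħ g a b) :
    YRel D K (f ħ) (fun x => f (g x)) (f a) (f b) := by
  cases h with
  | cartan_add h h' => simpa using YRel.cartan_add (g := fun x => f (g x)) h h'
  | cartan_smul c h => simpa using YRel.cartan_smul (g := fun x => f (g x)) c h
  | h_zero i => rw [map_smul]; exact YRel.h_zero (g := fun x => f (g x)) i
  | h_h i j r s => simpa [Ring.lie_def] using YRel.h_h (D := D) (ħ := f ħ) (g := fun x => f (g x)) i j r s
  | h_cartan i r h =>
    simpa [Ring.lie_def] using YRel.h_cartan (D := D) (ħ := f ħ) (g := fun x => f (g x)) i r h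
  | cartan_cartan h h' =>
    simpa [Ring.lie_def] using YRel.cartan_cartan (D := D) (ħ := f ħ) (g := fun x => f (g x)) h h'
  | cartan_x ε j s h =>
    rw [map_smul]
    simpa [Ring.lie_def] using YRel.cartan_x (D := D) (ħ := f ħ) (g := fun x => f (g x)) ε j s h
  | x_x_same i r s =>
    simpa [Ring.lie_def] using YRel.x_x_same (D := D) (ħ := f ħ) (g := fun x => f (g x)) i r s
  | x_x_ne i j hij r s =>
    simpa [Ring.lie_def] using YRel.x_x_ne (D := D) (ħ := f ħ) (g := fun x => f (g x)) i j hij r s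
  | h_x ε i j r s =>
    rw [map_smul]
    simpa [Ring.lie_def] using YRel.h_x (D := D) (ħ := f ħ) (g := fun x => f (g x)) ε i j r s
  | x_x ε i j r s =>
    rw [map_smul]
    simpa [Ring.lie_def] using YRel.x_x (D := D) (ħ := f ħ) (g := fun x => f (g x)) ε i j r s
  | serre ε i j hij r s =>
    have := YRel.serre (D := D) (ħ := f ħ) (g := fun x => f (g x)) ε i j hij r s
    simp only [map_sum, map_foldr_bracket, List.map_ofFn, map_zero]
    exact this

theorem YRel.exists_of_map (f : F →ₐ[ℂ] F') {a' b' : F'}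
    (h : YRel D K (f ħ) (fun x => f (g x)) a' b') :
    ∃ a b, YRel D K ħ g a b ∧ f a = a' ∧ f b = b' := by
  cases h with
  | cartan_add h h' => exact ⟨_, _, .cartan_add h h', by simp, by simp⟩
  | cartan_smul c h => exact ⟨_, _, .cartan_smul c h, by simp, by simp⟩
  | h_zero i => exact ⟨_, _, .h_zero i, by simp, map_smul _ _ _⟩
  | h_h i j r s => exact ⟨_, _, .h_h i j r s, by simp [Ring.lie_def], by simp⟩
  | h_cartan i r h => exact ⟨_, _, .h_cartan i r h, by simp [Ring.lie_def], by simp⟩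
  | cartan_cartan h h' => exact ⟨_, _, .cartan_cartan h h', by simp [Ring.lie_def], by simp⟩
  | cartan_x ε j s h => exact ⟨_, _, .cartan_x ε j s h, by simp [Ring.lie_def], map_smul _ _ _⟩
  | x_x_same i r s => exact ⟨_, _, .x_x_same i r s, by simp [Ring.lie_def], rfl⟩
  | x_x_ne i j hij r s => exact ⟨_, _, .x_x_ne i j hij r s, by simp [Ring.lie_def], by simp⟩
  | h_x ε i j r s =>
    exact ⟨_, _, .h_x ε i j r s, by simp [Ring.lie_def], by rw [map_smul]; simp⟩
  | x_x ε i j r s =>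
    exact ⟨_, _, .x_x ε i j r s, by simp [Ring.lie_def], by rw [map_smul]; simp⟩
  | serre ε i j hij r s =>
    refine ⟨_, _, .serre ε i j hij r s, ?_, by simp⟩
    simp only [map_sum, map_foldr_bracket, List.map_ofFn]
    rfl

theorem YSat.map (f : F →ₐ[ℂ] F') (h : YSat D K ħ g) : YSat D K (f ħ) (fun x => f (g x)) := by
  intro a' b' hab
  obtain ⟨a, b, hr, rfl, rfl⟩ := hab.exists_of_map f
  rw [h hr]

/-- The relations for indices in `ℤ` contain those for indices in `ℕ`. -/
theorem YSat.restrict {g : YGen I 𝔥 ℤ → F} (h : YSat D ℤ ħ g) :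
    YSat D ℕ ħ (fun x => g (x.map (fun n : ℕ => (n : ℤ)))) := by
  intro a b hab
  cases hab with
  | cartan_add a b => exact h (.cartan_add a b)
  | cartan_smul c a => exact h (.cartan_smul c a)
  | h_zero i => exact h (.h_zero i)
  | h_h i j r s => exact h (.h_h i j (r : ℤ) (s : ℤ))
  | h_cartan i r a => exact h (.h_cartan i (r : ℤ) a)
  | cartan_cartan a b => exact h (.cartan_cartan a b)
  | cartan_x ε j s a => exact h (.cartan_x ε j (s : ℤ) a)
  | x_x_same i r s => simpa [YGen.map] using h (.x_x_same i (r : ℤ) (s : ℤ))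
  | x_x_ne i j hij r s => exact h (.x_x_ne i j hij (r : ℤ) (s : ℤ))
  | h_x ε i j r s => simpa [YGen.map] using h (.h_x ε i j (r : ℤ) (s : ℤ))
  | x_x ε i j r s => simpa [YGen.map] using h (.x_x ε i j (r : ℤ) (s : ℤ))
  | serre ε i j hij r s => exact h (.serre ε i j hij (fun k => (r k : ℤ)) s)

end Relations

section Algebras

variable {I 𝔥 : Type*} [Fintype I] [AddCommGroup 𝔥] [Module ℂ 𝔥] (D : KacMoodyDatum I 𝔥)

/-- The unital associative `ℂ[ħ]`-algebra generated by the symbols with indices in `K` subject to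
the defining relations (`ħ` is the variable of `ℂ[X]`). -/
def YForm (K : Type*) [AddMonoidWithOne K] : Type _ :=
  RingQuot (YRel D K (algebraMap ℂ[X] (FreeAlgebra ℂ[X] (YGen I 𝔥 K)) Polynomial.X)
    (FreeAlgebra.ι ℂ[X]))

noncomputable instance (K : Type*) [AddMonoidWithOne K] : Ring (YForm D K) :=
  inferInstanceAs (Ring (RingQuot _))

noncomputable instance (K : Type*) [AddMonoidWithOne K] : Algebra ℂ[X] (YForm D K) :=
  inferInstanceAs (Algebra ℂ[X] (RingQuot _))

noncomputable instance (K : Type*) [AddMonoidWithOne K] : Algebra ℂ (YForm D K) :=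
  Algebra.compHom _ (Polynomial.C (R := ℂ))

instance (K : Type*) [AddMonoidWithOne K] : IsScalarTower ℂ ℂ[X] (YForm D K) :=
  IsScalarTower.of_algebraMap_eq fun _ => rfl

/-- The Yangian `Y_ħ𝔤`. -/
abbrev Yangian : Type _ := YForm D ℕ

/-- The `ℂ[ħ]`-form `𝔻Y_ħ𝔤` of the Yangian double. -/
abbrev DYangianForm : Type _ := YForm D ℤ

/-- The element `ħ`. -/
noncomputable abbrev hb (A : Type*) [Ring A] [Algebra ℂ[X] A] : A := algebraMap ℂ[X] A Polynomial.X

variable {K : Type*} [AddMonoidWithOne K]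

/-- The projection from the free algebra. -/
noncomputable def YForm.mk : FreeAlgebra ℂ[X] (YGen I 𝔥 K) →ₐ[ℂ[X]] YForm D K :=
  RingQuot.mkAlgHom ℂ[X] _

/-- The generators of `Y_ħ𝔤` and `𝔻Y_ħ𝔤`. -/
noncomputable def YForm.gen (g : YGen I 𝔥 K) : YForm D K :=
  YForm.mk D (FreeAlgebra.ι ℂ[X] g)

theorem YForm.sat : YSat D K (hb (YForm D K)) (YForm.gen D) := by
  intro a' b' h
  let f : FreeAlgebra ℂ[X] (YGen I 𝔥 K) →ₐ[ℂ[X]] YForm D K := YForm.mk D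
  have h' : YRel D K ((f.restrictScalars ℂ) (algebraMap ℂ[X] _ Polynomial.X))
      (fun x => (f.restrictScalars ℂ) (FreeAlgebra.ι ℂ[X] x)) a' b' := by
    have : (f.restrictScalars ℂ) (algebraMap ℂ[X] _ Polynomial.X) = hb (YForm D K) :=
      f.commutes _
    rw [this]
    exact h
  obtain ⟨a, b, hr, rfl, rfl⟩ := h'.exists_of_map
  exact RingQuot.mkAlgHom_rel ℂ[X] hr

/-- A family satisfying the relations in a `ℂ[ħ]`-algebra defines a homomorphism. -/
noncomputable def YForm.lift {B : Type*} [Ring B] [Algebra ℂ B] [Algebra ℂ[X] B]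
    [IsScalarTower ℂ ℂ[X] B] (g : YGen I 𝔥 K → B) (hg : YSat D K (hb B) g) :
    YForm D K →ₐ[ℂ[X]] B :=
  RingQuot.liftAlgHom ℂ[X] ⟨FreeAlgebra.lift ℂ[X] g, by
    intro a b h
    have h2 := h.map ((FreeAlgebra.lift ℂ[X] g).restrictScalars ℂ)
    refine hg ?_
    have e1 : ((FreeAlgebra.lift ℂ[X] g).restrictScalars ℂ)
        (algebraMap ℂ[X] (FreeAlgebra ℂ[X] (YGen I 𝔥 K)) Polynomial.X) = hb B :=
      (FreeAlgebra.lift ℂ[X] g).commutes _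
    rw [e1] at h2
    simpa using h2⟩

@[simp]
theorem YForm.lift_gen {B : Type*} [Ring B] [Algebra ℂ B] [Algebra ℂ[X] B]
    [IsScalarTower ℂ ℂ[X] B] (g : YGen I 𝔥 K → B) (hg : YSat D K (hb B) g) (x : YGen I 𝔥 K) :
    YForm.lift D g hg (YForm.gen D x) = g x := by
  refine (RingQuot.liftAlgHom_mkAlgHom_apply _ _ _ _).trans ?_
  rw [FreeAlgebra.lift_ι_apply]

/-- `ℂ⟨generators⟩⟦ħ⟧`, the free algebra before imposing the relations of the Yangian double. -/
abbrev DYFree (I 𝔥 : Type*) : Type _ := PowerSeries (FreeAlgebra ℂ (YGen I 𝔥 ℤ))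

/-- The two-sided ideal of `ℂ⟨generators⟩⟦ħ⟧` generated by the relations. -/
noncomputable def DYRelIdeal : TwoSidedIdeal (DYFree I 𝔥) :=
  TwoSidedIdeal.span {f | ∃ a b : DYFree I 𝔥,
    YRel D ℤ PowerSeries.X (fun x => PowerSeries.C (FreeAlgebra.ι ℂ x)) a b ∧ f = a - b}

/-- The closure of the ideal of relations in the `ħ`-adic topology. -/
noncomputable def DYClosedIdeal : Ideal (DYFree I 𝔥) where
  carrier := {f | ∀ n : ℕ, ∃ j ∈ DYRelIdeal D, ∃ f', f = j + PowerSeries.X ^ n * f'}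
  zero_mem' := fun n => ⟨0, zero_mem _, 0, by simp⟩
  add_mem' := by
    intro a b ha hb n
    obtain ⟨j, hj, f, rfl⟩ := ha n
    obtain ⟨j', hj', f', hb⟩ := hb n
    exact ⟨j + j', add_mem hj hj', f + f', by rw [hb, mul_add]; abel⟩
  smul_mem' := by
    intro c a ha n
    obtain ⟨j, hj, f, rfl⟩ := ha n
    refine ⟨c * j, TwoSidedIdeal.mul_mem_left _ _ _ hj, c * f, ?_⟩
    rw [smul_eq_mul, mul_add, ← mul_assoc, ← mul_assoc, (PowerSeries.commute_X_pow c n).eq]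

instance : (DYClosedIdeal D).IsTwoSided where
  mul_mem_of_left := by
    intro a b ha n
    obtain ⟨j, hj, f, rfl⟩ := ha n
    exact ⟨j * b, TwoSidedIdeal.mul_mem_right _ _ _ hj, f * b, by rw [add_mul, mul_assoc]⟩

/-- The Yangian double `DY_ħ𝔤`: the `ℂ⟦ħ⟧`-algebra topologically generated by the generators subject
to the relations, that is, the quotient of `ℂ⟨generators⟩⟦ħ⟧` by the closure of the two-sided ideal
generated by the relations. -/
def DYangian : Type _ := DYFree I 𝔥 ⧸ DYClosedIdeal D

noncomputable instance : Ring (DYangian D) := inferInstanceAs (Ring (DYFree I 𝔥 ⧸ DYClosedIdeal D))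

/-- The projection from `ℂ⟨generators⟩⟦ħ⟧`. -/
noncomputable def DYangian.mk : DYFree I 𝔥 →+* DYangian D := Ideal.Quotient.mk (DYClosedIdeal D)

theorem PowerSeries.map_algebraMap_commute {A : Type*} [Ring A] [Algebra ℂ A] (p : ℂ⟦X⟧)
    (f : PowerSeries A) :
    PowerSeries.map (algebraMap ℂ A) p * f = f * PowerSeries.map (algebraMap ℂ A) p := by
  ext n
  rw [PowerSeries.coeff_mul, PowerSeries.coeff_mul, ← Finset.Nat.sum_antidiagonal_swap]
  refine Finset.sum_congr rfl fun x _ => ?_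
  simp [Algebra.commutes]

noncomputable instance : Algebra ℂ⟦X⟧ (DYangian D) :=
  RingHom.toAlgebra' ((DYangian.mk D).comp (PowerSeries.map (algebraMap ℂ _))) (by
    intro c x
    obtain ⟨f, rfl⟩ := Ideal.Quotient.mk_surjective x
    change DYangian.mk D _ * DYangian.mk D f = DYangian.mk D f * DYangian.mk D _
    rw [← map_mul, ← map_mul, PowerSeries.map_algebraMap_commute])

noncomputable instance : Algebra ℂ[X] (DYangian D) :=
  Algebra.compHom _ (Polynomial.coeToPowerSeries.ringHom (R := ℂ))

noncomputable instance : Algebra ℂ (DYangian D) :=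
  Algebra.compHom _ (Polynomial.C (R := ℂ))

instance : IsScalarTower ℂ ℂ[X] (DYangian D) := IsScalarTower.of_algebraMap_eq fun _ => rfl

/-- The generators of the Yangian double. -/
noncomputable def DYangian.gen (x : YGen I 𝔥 ℤ) : DYangian D :=
  DYangian.mk D (PowerSeries.C (FreeAlgebra.ι ℂ x))

theorem DYangian.sat : YSat D ℤ (hb (DYangian D)) (DYangian.gen D) := by
  intro a' b' h
  let f : DYFree I 𝔥 →ₐ[ℂ] DYangian D :=
    { DYangian.mk D with
      commutes' := fun c => by
        change DYangian.mk D _ = DYangian.mk D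
          (PowerSeries.map (algebraMap ℂ _) ((Polynomial.C c : ℂ[X]) : ℂ⟦X⟧))
        rw [Polynomial.coe_C, PowerSeries.map_C, PowerSeries.algebraMap_apply] }
  have e : f PowerSeries.X = hb (DYangian D) := by
    change DYangian.mk D _ = DYangian.mk D
          (PowerSeries.map (algebraMap ℂ _) ((Polynomial.X : ℂ[X]) : ℂ⟦X⟧))
    rw [Polynomial.coe_X, PowerSeries.map_X]
  have h' : YRel D ℤ (f PowerSeries.X)
      (fun x => f (PowerSeries.C (FreeAlgebra.ι ℂ x))) a' b' := by
    rw [e]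
    exact h
  obtain ⟨a, b, hr, rfl, rfl⟩ := h'.exists_of_map
  refine Ideal.Quotient.eq.2 fun n => ⟨a - b, TwoSidedIdeal.subset_span ⟨a, b, hr, rfl⟩, 0, ?_⟩
  simp

/-- The natural homomorphism `ȷ : 𝔻Y_ħ𝔤 → DY_ħ𝔤`. -/
noncomputable def jMap : DYangianForm D →ₐ[ℂ[X]] DYangian D :=
  YForm.lift D (DYangian.gen D) (DYangian.sat D)

/-- The homomorphism `Y_ħ𝔤 → 𝔻Y_ħ𝔤`, `h ↦ h`, `h_{ir} ↦ 𝓗_{ir}`, `x_{ir}^± ↦ 𝓧_{ir}^±`. -/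
noncomputable def iotaForm : Yangian D →ₐ[ℂ[X]] DYangianForm D :=
  YForm.lift D (fun x => YForm.gen D (x.map (fun n : ℕ => (n : ℤ)))) (YForm.sat D).restrict

/-- The natural homomorphism `ι : Y_ħ𝔤 → DY_ħ𝔤`. -/
noncomputable def iotaMap : Yangian D →ₐ[ℂ[X]] DYangian D := (jMap D).comp (iotaForm D)

end Algebras

section Shift

variable {B : Type*} [Ring B]

/-- `∑_{k ≤ r} (r choose k) c^{r-k} a_k`. -/
def shiftSeq (c : B) (a : ℕ → B) (r : ℕ) : B :=
  ∑ k ∈ Finset.range (r + 1), (r.choose k : B) * c ^ (r - k) * a k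

theorem shiftSeq_zero (c : B) (a : ℕ → B) : shiftSeq c a 0 = a 0 := by simp [shiftSeq]

theorem shiftSeq_succ (c : B) (a : ℕ → B) (r : ℕ) :
    shiftSeq c a (r + 1) = shiftSeq c (fun k => a (k + 1)) r + c * shiftSeq c a r := by
  unfold shiftSeq
  rw [Finset.sum_range_succ' _ (r + 1), Finset.mul_sum]
  have h1 : ∀ k ∈ Finset.range (r + 1),
      ((r + 1).choose (k + 1) : B) * c ^ (r + 1 - (k + 1)) * a (k + 1) =
      (r.choose k : B) * c ^ (r - k) * a (k + 1) +
        (r.choose (k + 1) : B) * c ^ (r - k) * a (k + 1) := by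
    intro k _
    rw [Nat.choose_succ_succ, Nat.succ_sub_succ]
    push_cast
    rw [add_mul, add_mul]
  rw [Finset.sum_congr rfl h1, Finset.sum_add_distrib, add_assoc]
  congr 1
  rw [Finset.sum_range_succ, Nat.choose_eq_zero_of_lt (Nat.lt_succ_self r),
    Finset.sum_range_succ' _ r]
  simp only [Nat.cast_zero, zero_mul, add_zero, Nat.choose_zero_right, Nat.cast_one, one_mul,
    Nat.sub_zero, pow_succ' c r]
  congr 1
  · refine Finset.sum_congr rfl fun k hk => ?_
    have : r - k = (r - (k + 1)) + 1 := by have := Finset.mem_range.1 hk; omega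
    rw [this, pow_succ', ← mul_assoc, (Nat.cast_commute (r.choose (k + 1)) c).eq]
    simp only [mul_assoc]
  · rw [mul_assoc]

theorem shiftSeq_mul_shiftSeq {c : B} (hc : ∀ b, c * b = b * c) (a a' : ℕ → B) (r s : ℕ) :
    shiftSeq c a r * shiftSeq c a' s =
      ∑ k ∈ Finset.range (r + 1), ∑ l ∈ Finset.range (s + 1),
        ((r.choose k : B) * c ^ (r - k)) * ((s.choose l : B) * c ^ (s - l)) * (a k * a' l) := by
  unfold shiftSeq
  rw [Finset.sum_mul_sum]
  refine Finset.sum_congr rfl fun k _ => Finset.sum_congr rfl fun l _ => ?_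
  have : Commute (a k) ((s.choose l : B) * c ^ (s - l)) :=
    (Nat.cast_commute _ _).symm.mul_right ((show Commute (a k) c from (hc _).symm).pow_right _)
  rw [mul_assoc, ← mul_assoc (a k), this.eq]
  simp only [mul_assoc]

theorem shiftSeq_mul_shiftSeq' {c : B} (hc : ∀ b, c * b = b * c) (a a' : ℕ → B) (r s : ℕ) :
    shiftSeq c a' s * shiftSeq c a r =
      ∑ k ∈ Finset.range (r + 1), ∑ l ∈ Finset.range (s + 1),
        ((r.choose k : B) * c ^ (r - k)) * ((s.choose l : B) * c ^ (s - l)) * (a' l * a k) := by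
  rw [shiftSeq_mul_shiftSeq hc, Finset.sum_comm]
  refine Finset.sum_congr rfl fun k _ => Finset.sum_congr rfl fun l _ => ?_
  congr 1
  exact ((Nat.cast_commute _ _).mul_left
    ((show Commute c _ from hc _).pow_left _)).eq

theorem shiftSeq_lie_zero {c : B} (hc : ∀ b, c * b = b * c) {a a' : ℕ → B}
    (h : ∀ r s, ⁅a r, a' s⁆ = 0) (r s : ℕ) : ⁅shiftSeq c a r, shiftSeq c a' s⁆ = 0 := by
  rw [Ring.lie_def, shiftSeq_mul_shiftSeq hc, shiftSeq_mul_shiftSeq' hc, ← Finset.sum_sub_distrib]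
  refine Finset.sum_eq_zero fun k _ => ?_
  rw [← Finset.sum_sub_distrib]
  refine Finset.sum_eq_zero fun l _ => ?_
  rw [← mul_sub, ← Ring.lie_def, h, mul_zero]

theorem lie_shiftSeq {c : B} (hc : ∀ b, c * b = b * c) (y : B) (a : ℕ → B) (s : ℕ) :
    ⁅y, shiftSeq c a s⁆ = shiftSeq c (fun k => ⁅y, a k⁆) s := by
  unfold shiftSeq
  rw [Ring.lie_def, Finset.mul_sum, Finset.sum_mul, ← Finset.sum_sub_distrib]
  refine Finset.sum_congr rfl fun k _ => ?_
  have : Commute y ((s.choose k : B) * c ^ (s - k)) :=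
    (Nat.cast_commute _ _).symm.mul_right ((show Commute y c from (hc _).symm).pow_right _)
  simp only [Ring.lie_def]
  rw [mul_sub, ← mul_assoc, this.eq]
  simp only [mul_assoc]

theorem shiftSeq_lie_add {c : B} (hc : ∀ b, c * b = b * c) {a a' b : ℕ → B}
    (h : ∀ r s, ⁅a r, a' s⁆ = b (r + s)) (r s : ℕ) :
    ⁅shiftSeq c a r, shiftSeq c a' s⁆ = shiftSeq c b (r + s) := by
  induction r generalizing a b with
  | zero =>
    rw [shiftSeq_zero, lie_shiftSeq hc, zero_add]
    congr 1
    ext k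
    rw [h, zero_add]
  | succ r ih =>
    have e : r + 1 + s = (r + s) + 1 := by omega
    rw [e, shiftSeq_succ, shiftSeq_succ, ← ih (a := fun k => a (k + 1)) (b := fun k => b (k + 1)), ← ih h]
    · simp only [Ring.lie_def]
      rw [add_mul, mul_add, mul_sub, ← mul_assoc (shiftSeq c a' s), ← hc (shiftSeq c a' s)]
      simp only [mul_assoc]
      abel
    · intro r s
      rw [h]
      congr 1
      omega

theorem shiftSeq_exchange [Algebra ℂ B] {c ħ : B} (hc : ∀ b, c * b = b * c)
    (hħ : ∀ b, ħ * b = b * ħ) {a a' : ℕ → B} {κ : ℂ}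
    (h : ∀ r s, ⁅a (r + 1), a' s⁆ - ⁅a r, a' (s + 1)⁆ = κ • (ħ * (a r * a' s + a' s * a r)))
    (r s : ℕ) :
    ⁅shiftSeq c a (r + 1), shiftSeq c a' s⁆ - ⁅shiftSeq c a r, shiftSeq c a' (s + 1)⁆ =
      κ • (ħ * (shiftSeq c a r * shiftSeq c a' s + shiftSeq c a' s * shiftSeq c a r)) := by
  have e : ⁅shiftSeq c a (r + 1), shiftSeq c a' s⁆ - ⁅shiftSeq c a r, shiftSeq c a' (s + 1)⁆ =
      ⁅shiftSeq c (fun k => a (k + 1)) r, shiftSeq c a' s⁆ -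
        ⁅shiftSeq c a r, shiftSeq c (fun k => a' (k + 1)) s⁆ := by
    rw [shiftSeq_succ, shiftSeq_succ]
    have h1 : shiftSeq c a r * (c * shiftSeq c a' s) = c * (shiftSeq c a r * shiftSeq c a' s) := by
      rw [← mul_assoc, ← hc, mul_assoc]
    have h2 : shiftSeq c a' s * (c * shiftSeq c a r) = c * (shiftSeq c a' s * shiftSeq c a r) := by
      rw [← mul_assoc, ← hc, mul_assoc]
    simp only [Ring.lie_def, add_mul, mul_add, h1, h2, mul_assoc]
    abel
  rw [e]
  simp only [Ring.lie_def]
  simp only [shiftSeq_mul_shiftSeq hc _ _ r s, shiftSeq_mul_shiftSeq' hc _ _ r s]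
  simp only [← Finset.sum_sub_distrib, ← Finset.sum_add_distrib, Finset.mul_sum, Finset.smul_sum]
  refine Finset.sum_congr rfl fun k _ => Finset.sum_congr rfl fun l _ => ?_
  have := h k l
  simp only [Ring.lie_def] at this
  rw [← mul_sub, ← mul_sub, ← mul_sub, this, ← mul_add, mul_smul_comm, ← mul_assoc, ← hħ, mul_assoc]

end Shift

section ShiftSerre

variable {B : Type*} [Ring B]

/-- `y ↦ ∑_π [a_{π(1)}, [a_{π(2)}, ⋯, [a_{π(m)}, y] ⋯ ]]`, multilinear over the center. -/
noncomputable def serreMultilinear (B : Type*) [Ring B] (m : ℕ) :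
    MultilinearMap (Subring.center B) (fun _ : Fin m => B) (Module.End (Subring.center B) B) :=
  ∑ π : Equiv.Perm (Fin m),
    ((MultilinearMap.mkPiAlgebraFin (Subring.center B) m
      (Module.End (Subring.center B) B)).compLinearMap
        (fun _ => (LinearMap.mul (Subring.center B) B -
          (LinearMap.mul (Subring.center B) B).flip))).domDomCongr π

theorem prod_map_apply_eq_foldr (R : Type*) [CommRing R] [Algebra R B] (l : List B) (y : B) :
    (l.map (fun a => (LinearMap.mul R B - (LinearMap.mul R B).flip) a)).prod y =
      l.foldr (fun a b => ⁅a, b⁆) y := by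
  induction l with
  | nil => rfl
  | cons a l ih =>
    rw [List.map_cons, List.prod_cons, Module.End.mul_apply, ih]
    rfl

theorem serreMultilinear_apply {m : ℕ} (a : Fin m → B) (y : B) :
    serreMultilinear B m a y =
      ∑ π : Equiv.Perm (Fin m), (List.ofFn fun k => a (π k)).foldr (fun a b => ⁅a, b⁆) y := by
  simp only [serreMultilinear, _root_.sum_apply, LinearMap.sum_apply]
  refine Finset.sum_congr rfl fun π _ => ?_
  rw [MultilinearMap.domDomCongr_apply, MultilinearMap.compLinearMap_apply,
    MultilinearMap.mkPiAlgebraFin_apply, ← prod_map_apply_eq_foldr (Subring.center B), List.map_ofFn]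
  rfl

theorem shiftSeq_serre {c : B} (hc : ∀ b, c * b = b * c) {m : ℕ} {a a' : ℕ → B}
    (h : ∀ (r : Fin m → ℕ) (s : ℕ), ∑ π : Equiv.Perm (Fin m),
      (List.ofFn fun k => a (r (π k))).foldr (fun a b => ⁅a, b⁆) (a' s) = 0)
    (r : Fin m → ℕ) (s : ℕ) :
    ∑ π : Equiv.Perm (Fin m),
      (List.ofFn fun k => shiftSeq c a (r (π k))).foldr (fun a b => ⁅a, b⁆) (shiftSeq c a' s)
      = 0 := by
  let C : Subring.center B := ⟨c, Subring.mem_center_iff.2 fun b => (hc b).symm⟩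
  have e : ∀ (a : ℕ → B) (r : ℕ), shiftSeq c a r =
      ∑ k ∈ Finset.range (r + 1), ((r.choose k : Subring.center B) * C ^ (r - k)) • a k := by
    intro a r
    refine Finset.sum_congr rfl fun k _ => ?_
    rw [Subring.smul_def, smul_eq_mul]
    simp [C]
  have h' : ∀ (r : Fin m → ℕ) (s : ℕ), serreMultilinear B m (fun k => a (r k)) (a' s) = 0 :=
    fun r s => by rw [serreMultilinear_apply]; exact h r s
  rw [← serreMultilinear_apply (fun k => shiftSeq c a (r k))]
  simp only [e]
  rw [MultilinearMap.map_sum_finset, LinearMap.sum_apply]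
  refine Finset.sum_eq_zero fun t _ => ?_
  rw [MultilinearMap.map_smul_univ, map_sum]
  refine Finset.sum_eq_zero fun l _ => ?_
  rw [LinearMap.smul_apply, map_smul, h', smul_zero, smul_zero]

end ShiftSerre

section ShiftHom

variable {I 𝔥 : Type*} [Fintype I] [AddCommGroup 𝔥] [Module ℂ 𝔥] (D : KacMoodyDatum I 𝔥)

/-- `h ↦ h`, `h_{ir} ↦ ∑_k (r choose k) h_{ik} c^{r-k}`, `x_{ir}^± ↦ ∑_k (r choose k) x_{ik}^± c^{r-k}`. -/
def shiftGen {B : Type*} [Ring B] (c : B) (g : YGen I 𝔥 ℕ → B) : YGen I 𝔥 ℕ → B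
  | .cartan a => g (.cartan a)
  | .h i r => shiftSeq c (fun k => g (.h i k)) r
  | .x ε i r => shiftSeq c (fun k => g (.x ε i k)) r

variable {D} in
theorem YSat.shift {B : Type*} [Ring B] [Algebra ℂ B] {ħ c : B} (hħ : ∀ b, ħ * b = b * ħ)
    (hc : ∀ b, c * b = b * c) {g : YGen I 𝔥 ℕ → B} (hg : YSat D ℕ ħ g) :
    YSat D ℕ ħ (shiftGen c g) := by
  intro a b hab
  cases hab with
  | cartan_add a b => exact hg (.cartan_add a b)
  | cartan_smul z a => exact hg (.cartan_smul z a)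
  | h_zero i => simpa [shiftGen, shiftSeq_zero] using hg (.h_zero i)
  | h_h i j r s => exact shiftSeq_lie_zero hc (fun r s => hg (.h_h i j r s)) r s
  | h_cartan i r a =>
    have := shiftSeq_lie_zero hc (a := fun k => g (.h i k)) (a' := fun _ => g (.cartan a))
      (fun r s => hg (.h_cartan i r a)) r 0
    simpa [shiftGen, shiftSeq_zero] using this
  | cartan_cartan a b => exact hg (.cartan_cartan a b)
  | cartan_x ε j s a =>
    simp only [shiftGen]
    rw [lie_shiftSeq hc]
    simp only [shiftSeq, Finset.smul_sum]
    refine Finset.sum_congr rfl fun k _ => ?_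
    rw [hg (.cartan_x ε j k a), mul_smul_comm]
  | x_x_same i r s =>
    exact shiftSeq_lie_add hc (b := fun k => g (.h i k)) (fun r s => hg (.x_x_same i r s)) r s
  | x_x_ne i j hij r s => exact shiftSeq_lie_zero hc (fun r s => hg (.x_x_ne i j hij r s)) r s
  | h_x ε i j r s => exact shiftSeq_exchange hc hħ (fun r s => hg (.h_x ε i j r s)) r s
  | x_x ε i j r s => exact shiftSeq_exchange hc hħ (fun r s => hg (.x_x ε i j r s)) r s
  | serre ε i j hij r s => exact shiftSeq_serre hc (fun r s => hg (.serre ε i j hij r s)) r s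

/-- The shift automorphism `τ_c` of the Yangian. -/
noncomputable def tauC (c : ℂ) : Yangian D →ₐ[ℂ[X]] Yangian D :=
  YForm.lift D (shiftGen (algebraMap ℂ (Yangian D) c) (YForm.gen D))
    ((YForm.sat D).shift (Algebra.commutes _) (Algebra.commutes _))

/-- The formal shift homomorphism `τ_z : Y_ħ𝔤 → Y_ħ𝔤[z]`. -/
noncomputable def tauZ : Yangian D →ₐ[ℂ[X]] Polynomial (Yangian D) :=
  YForm.lift D (shiftGen Polynomial.X (fun x => Polynomial.C (YForm.gen D x)))
    (YSat.shift (Algebra.commutes _) (fun _ => Polynomial.X_mul)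
      ((YForm.sat D).map (Polynomial.CAlgHom (R := ℂ) (A := Yangian D))))

end ShiftHom

section Grading

variable {I 𝔥 : Type*} [Fintype I] [AddCommGroup 𝔥] [Module ℂ 𝔥] (D : KacMoodyDatum I 𝔥)
  {K : Type*} [AddMonoidWithOne K]

/-- The `k`-th graded component for `deg ħ = 1` and a degree function `deg` on the generators:
the span of all `ħ^a g_1 ⋯ g_l` with `g_1, …, g_l` generators and `a + ∑ deg g_i = k`. -/
noncomputable def YForm.degree (deg : YGen I 𝔥 K → ℤ) (k : ℤ) : Submodule ℂ (YForm D K) :=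
  Submodule.span ℂ {y | ∃ (a : ℕ) (l : List (YGen I 𝔥 K)),
    (a : ℤ) + (l.map deg).sum = k ∧ y = hb (YForm D K) ^ a * (l.map (YForm.gen D)).prod}

/-- The graded component `(Y_ħ𝔤)_k`, zero for `k < 0`. -/
noncomputable def Yangian.degree (k : ℤ) : Submodule ℂ (Yangian D) :=
  YForm.degree D (fun x => (x.map (fun n : ℕ => (n : ℤ))).deg) k

/-- The graded component `(𝔻Y_ħ𝔤)_k`. -/
noncomputable def DYangianForm.degree (k : ℤ) : Submodule ℂ (DYangianForm D) :=
  YForm.degree D YGen.deg k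

instance (deg : YGen I 𝔥 K → ℤ) : SetLike.GradedMonoid (YForm.degree D deg) where
  one_mem := Submodule.subset_span ⟨0, [], by simp, by simp⟩
  mul_mem := by
    intro i j x y hx hy
    have : YForm.degree D deg i * YForm.degree D deg j ≤ YForm.degree D deg (i + j) := by
      unfold YForm.degree
      rw [Submodule.span_mul_span]
      refine Submodule.span_mono ?_
      rintro _ ⟨_, ⟨a, l, rfl, rfl⟩, _, ⟨b, l', rfl, rfl⟩, rfl⟩
      refine ⟨a + b, l ++ l', by push_cast; simp only [List.map_append, List.sum_append]; ring, ?_⟩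
      have : Commute (l.map (YForm.gen D)).prod (hb (YForm D K) ^ b) :=
        (show Commute _ (hb (YForm D K)) from (Algebra.commutes _ _).symm).pow_right b
      simp only [List.map_append, List.prod_append, pow_add]
      rw [mul_assoc, ← mul_assoc _ (hb (YForm D K) ^ b), this.eq]
      simp only [mul_assoc]
    exact this (Submodule.mul_mem_mul hx hy)

instance : SetLike.GradedMonoid (Yangian.degree D) :=
  inferInstanceAs (SetLike.GradedMonoid (YForm.degree D _))

theorem Yangian.gen_mem_degree (x : YGen I 𝔥 ℕ) :
    YForm.gen D x ∈ Yangian.degree D (x.map (fun n : ℕ => (n : ℤ))).deg :=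
  Submodule.subset_span ⟨0, [x], by simp, by simp⟩

theorem Yangian.hb_pow_mem_degree (n : ℕ) : hb (Yangian D) ^ n ∈ Yangian.degree D n :=
  Submodule.subset_span ⟨n, [], by simp, by simp⟩

theorem Yangian.one_mem_degree : (1 : Yangian D) ∈ Yangian.degree D (0 : ℕ) := by
  simpa using Yangian.hb_pow_mem_degree D 0

theorem Yangian.degree_of_neg {k : ℤ} (hk : k < 0) : Yangian.degree D k = ⊥ := by
  unfold Yangian.degree YForm.degree
  rw [Submodule.span_eq_bot]
  rintro _ ⟨a, l, h, -⟩
  exfalso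
  have : 0 ≤ (l.map fun x : YGen I 𝔥 ℕ => (x.map (fun n : ℕ => (n : ℤ))).deg).sum := by
    refine List.sum_nonneg ?_
    intro z hz
    obtain ⟨x, -, rfl⟩ := List.mem_map.1 hz
    cases x <;> simp [YGen.map, YGen.deg]
  omega

theorem algebraMap_mem_iSup_of_hb {A : Type*} [Ring A] [Algebra ℂ A] [Algebra ℂ[X] A]
    [IsScalarTower ℂ ℂ[X] A] (S : Subalgebra ℂ A) (h : hb A ∈ S) (p : ℂ[X]) :
    algebraMap ℂ[X] A p ∈ S := by
  induction p using Polynomial.induction_on' with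
  | add p q hp hq => rw [map_add]; exact add_mem hp hq
  | monomial n c =>
    rw [← Polynomial.C_mul_X_pow_eq_monomial, map_mul, map_pow, ← Polynomial.algebraMap_eq,
      ← IsScalarTower.algebraMap_apply]
    exact mul_mem (S.algebraMap_mem c) (pow_mem h n)

theorem Yangian.mem_range_coeAlgHom (y : Yangian D) :
    y ∈ (DirectSum.coeAlgHom (Yangian.degree D)).range := by
  have hm : ∀ k, ∀ y ∈ Yangian.degree D k, y ∈ (DirectSum.coeAlgHom (Yangian.degree D)).range :=
    fun k y hy => ⟨DirectSum.of (fun k => Yangian.degree D k) k ⟨y, hy⟩,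
      DirectSum.coeAlgHom_of _ _ _⟩
  obtain ⟨f, rfl⟩ : ∃ f, YForm.mk D f = y := RingQuot.mkAlgHom_surjective _ _ y
  induction f using FreeAlgebra.induction with
  | grade0 p =>
    rw [AlgHom.commutes]
    exact algebraMap_mem_iSup_of_hb _
      (hm 1 _ (by simpa using Yangian.hb_pow_mem_degree D 1)) p
  | grade1 x => exact hm _ _ (Yangian.gen_mem_degree D x)
  | mul a b ha hb => rw [map_mul]; exact mul_mem ha hb
  | add a b ha hb => rw [map_add]; exact add_mem ha hb

end Grading

section CompletedYangian

variable {I 𝔥 : Type*} [Fintype I] [AddCommGroup 𝔥] [Module ℂ 𝔥] (D : KacMoodyDatum I 𝔥)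

/-- Power series `∑_k y_k t^k` with `y_k ∈ (Y_ħ𝔤)_k`. -/
noncomputable def completedYangianSubalgebra : Subalgebra ℂ (PowerSeries (Yangian D)) where
  carrier := {f | ∀ k : ℕ, PowerSeries.coeff k f ∈ Yangian.degree D k}
  zero_mem' := fun k => by simp
  one_mem' := fun k => by
    rw [PowerSeries.coeff_one]
    split_ifs with h
    · subst h
      exact Yangian.one_mem_degree D
    · exact zero_mem _
  add_mem' := fun ha hb k => by rw [map_add]; exact add_mem (ha k) (hb k)
  mul_mem' := fun {a b} ha hb k => by
    rw [PowerSeries.coeff_mul]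
    refine sum_mem fun x hx => ?_
    rw [← Finset.HasAntidiagonal.mem_antidiagonal.1 hx, Nat.cast_add]
    exact SetLike.GradedMul.mul_mem (ha _) (hb _)
  algebraMap_mem' := fun c k => by
    rw [PowerSeries.algebraMap_apply, PowerSeries.coeff_C]
    split_ifs with h
    · subst h
      rw [Algebra.algebraMap_eq_smul_one]
      exact Submodule.smul_mem _ _ (Yangian.one_mem_degree D)
    · exact zero_mem _

/-- The completed Yangian `∏_{k ∈ ℕ} (Y_ħ𝔤)_k`. Its elements are written as `∑_k y_k t^k` with
`y_k ∈ (Y_ħ𝔤)_k`, where `t` only keeps track of the degree. -/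
def CompletedYangian : Type _ := completedYangianSubalgebra D

noncomputable instance : Ring (CompletedYangian D) :=
  inferInstanceAs (Ring (completedYangianSubalgebra D))

/-- The component `y_k ∈ (Y_ħ𝔤)_k` of an element of the completed Yangian. -/
noncomputable def CompletedYangian.coeff (k : ℕ) (y : CompletedYangian D) : Yangian D :=
  PowerSeries.coeff k y.1

/-- The element of `∏_k (Y_ħ𝔤)_k` with the given components. -/
def CompletedYangian.mk (y : ℕ → Yangian D) (hy : ∀ k : ℕ, y k ∈ Yangian.degree D k) :
    CompletedYangian D :=
  ⟨PowerSeries.mk y, fun k => by rw [PowerSeries.coeff_mk]; exact hy k⟩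

variable {D}

@[simp]
theorem CompletedYangian.coeff_mk' (y : ℕ → Yangian D) (hy : ∀ k : ℕ, y k ∈ Yangian.degree D k)
    (k : ℕ) : CompletedYangian.coeff D k (CompletedYangian.mk D y hy) = y k :=
  PowerSeries.coeff_mk _ _

theorem CompletedYangian.ext {y y' : CompletedYangian D}
    (h : ∀ k, CompletedYangian.coeff D k y = CompletedYangian.coeff D k y') : y = y' :=
  Subtype.ext (PowerSeries.ext h)

theorem CompletedYangian.coeff_mem (k : ℕ) (y : CompletedYangian D) :
    CompletedYangian.coeff D k y ∈ Yangian.degree D k := y.2 k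

theorem CompletedYangian.coeff_add (k : ℕ) (y y' : CompletedYangian D) :
    CompletedYangian.coeff D k (y + y') =
      CompletedYangian.coeff D k y + CompletedYangian.coeff D k y' :=
  map_add (PowerSeries.coeff k) y.1 y'.1

theorem CompletedYangian.coeff_zero (k : ℕ) :
    CompletedYangian.coeff D k (0 : CompletedYangian D) = 0 :=
  map_zero (PowerSeries.coeff k)

theorem CompletedYangian.coeff_one (k : ℕ) :
    CompletedYangian.coeff D k (1 : CompletedYangian D) = if k = 0 then 1 else 0 :=
  PowerSeries.coeff_one k

theorem CompletedYangian.coeff_mul (k : ℕ) (y y' : CompletedYangian D) :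
    CompletedYangian.coeff D k (y * y') = ∑ x ∈ Finset.HasAntidiagonal.antidiagonal k,
      CompletedYangian.coeff D x.1 y * CompletedYangian.coeff D x.2 y' :=
  PowerSeries.coeff_mul k y.1 y'.1

variable (D)

/-- `∑_k c_k ħ^k ↦ (c_k ħ^k)_k`. -/
noncomputable def CompletedYangian.scalar : ℂ⟦X⟧ →+* CompletedYangian D where
  toFun p := CompletedYangian.mk D (fun k => PowerSeries.coeff k p • hb (Yangian D) ^ k)
    fun k => Submodule.smul_mem _ _ (Yangian.hb_pow_mem_degree D k)
  map_zero' := CompletedYangian.ext fun k => by simp [CompletedYangian.coeff_zero]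
  map_one' := CompletedYangian.ext fun k => by
    simp only [CompletedYangian.coeff_mk', CompletedYangian.coeff_one, PowerSeries.coeff_one]
    split_ifs with h <;> simp [h]
  map_add' p q := CompletedYangian.ext fun k => by
    simp [CompletedYangian.coeff_add, add_smul]
  map_mul' p q := CompletedYangian.ext fun k => by
    simp only [CompletedYangian.coeff_mk', CompletedYangian.coeff_mul, PowerSeries.coeff_mul,
      Finset.sum_smul]
    refine Finset.sum_congr rfl fun x hx => ?_
    rw [smul_mul_smul_comm, ← pow_add, Finset.HasAntidiagonal.mem_antidiagonal.1 hx]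

noncomputable instance : Algebra ℂ⟦X⟧ (CompletedYangian D) :=
  RingHom.toAlgebra' (CompletedYangian.scalar D) fun p y => CompletedYangian.ext fun k => by
    rw [CompletedYangian.coeff_mul, CompletedYangian.coeff_mul,
      ← Finset.Nat.sum_antidiagonal_swap]
    refine Finset.sum_congr rfl fun x _ => ?_
    have : Commute (CompletedYangian.coeff D x.1 y) (hb (Yangian D) ^ x.2) :=
      (show Commute _ (hb (Yangian D)) from (Algebra.commutes _ _).symm).pow_right _
    simp only [CompletedYangian.scalar, RingHom.coe_mk, MonoidHom.coe_mk, OneHom.coe_mk,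
      CompletedYangian.coeff_mk', Prod.fst_swap, Prod.snd_swap]
    rw [smul_mul_assoc, mul_smul_comm, this.eq]

theorem CompletedYangian.coeff_algebraMap (k : ℕ) (p : ℂ⟦X⟧) :
    CompletedYangian.coeff D k (algebraMap ℂ⟦X⟧ (CompletedYangian D) p) =
      PowerSeries.coeff k p • hb (Yangian D) ^ k := by
  change CompletedYangian.coeff D k (CompletedYangian.scalar D p) = _
  simp only [CompletedYangian.scalar, RingHom.coe_mk, MonoidHom.coe_mk, OneHom.coe_mk,
    CompletedYangian.coeff_mk']

noncomputable instance : Algebra ℂ[X] (CompletedYangian D) :=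
  Algebra.compHom _ (Polynomial.coeToPowerSeries.ringHom (R := ℂ))

noncomputable instance : Algebra ℂ (CompletedYangian D) :=
  Algebra.compHom _ (Polynomial.C (R := ℂ))

instance : IsScalarTower ℂ ℂ[X] (CompletedYangian D) := IsScalarTower.of_algebraMap_eq fun _ => rfl

end CompletedYangian

section ToCompleted

variable {I 𝔥 : Type*} [Fintype I] [AddCommGroup 𝔥] [Module ℂ 𝔥] (D : KacMoodyDatum I 𝔥)

/-- `h ↦ h`, `h_{ir} ↦ t^r h_{ir}`, `x_{ir}^± ↦ t^r x_{ir}^±`. -/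
def scaleGen {B : Type*} [Ring B] (t : B) (g : YGen I 𝔥 ℕ → B) : YGen I 𝔥 ℕ → B
  | .cartan a => g (.cartan a)
  | .h i r => t ^ r * g (.h i r)
  | .x ε i r => t ^ r * g (.x ε i r)

theorem lie_mul_mul {B : Type*} [Ring B] {t : B} (ht : ∀ b, t * b = b * t) (a b : B) (r s : ℕ) :
    ⁅t ^ r * a, t ^ s * b⁆ = t ^ (r + s) * ⁅a, b⁆ := by
  have hc : ∀ (n : ℕ) (b : B), b * t ^ n = t ^ n * b := fun n b =>
    ((show Commute b t from (ht b).symm).pow_right n).eq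
  simp only [Ring.lie_def]
  rw [mul_sub, mul_assoc, ← mul_assoc a, hc, mul_assoc (t ^ s) b, ← mul_assoc b, hc, pow_add]
  simp only [mul_assoc]
  rw [← mul_assoc (t ^ s) (t ^ r), hc r (t ^ s)]
  simp only [mul_assoc]

theorem mul_mul_comm_pow {B : Type*} [Ring B] {t : B} (ht : ∀ b, t * b = b * t) (a b : B)
    (r s : ℕ) : (t ^ r * a) * (t ^ s * b) = t ^ (r + s) * (a * b) := by
  rw [mul_assoc, ← mul_assoc a, ((show Commute a t from (ht a).symm).pow_right s).eq, pow_add]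
  simp only [mul_assoc]

theorem scale_serre {B : Type*} [Ring B] {t : B} (ht : ∀ b, t * b = b * t) {m : ℕ}
    {a a' : ℕ → B} (r : Fin m → ℕ) (s : ℕ)
    (h : ∑ π : Equiv.Perm (Fin m),
      (List.ofFn fun k => a (r (π k))).foldr (fun a b => ⁅a, b⁆) (a' s) = 0) :
    ∑ π : Equiv.Perm (Fin m),
      (List.ofFn fun k => t ^ (r (π k)) * a (r (π k))).foldr (fun a b => ⁅a, b⁆) (t ^ s * a' s)
      = 0 := by
  let T : Subring.center B := ⟨t, Subring.mem_center_iff.2 fun b => (ht b).symm⟩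
  have e : ∀ (n : ℕ) (b : B), t ^ n * b = (T ^ n) • b := by
    intro n b
    rw [Subring.smul_def, smul_eq_mul]
    simp [T]
  rw [← serreMultilinear_apply (fun k => a (r k))] at h
  rw [← serreMultilinear_apply (fun k => t ^ (r k) * a (r k))]
  simp only [e]
  rw [MultilinearMap.map_smul_univ, map_smul, LinearMap.smul_apply, h, smul_zero, smul_zero]

variable {D} in
theorem YSat.scale {B : Type*} [Ring B] [Algebra ℂ B] {ħ t : B} (ht : ∀ b, t * b = b * t)
    {g : YGen I 𝔥 ℕ → B} (hg : YSat D ℕ ħ g) : YSat D ℕ (t * ħ) (scaleGen t g) := by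
  intro a b hab
  have e1 : ∀ b : B, b = t ^ 0 * b := fun b => by simp
  have e2 : ∀ (ħ b : B) (n : ℕ), t * ħ * (t ^ n * b) = t ^ (n + 1) * (ħ * b) := fun ħ b n => by
    rw [show t * ħ = t ^ 1 * ħ by simp, mul_mul_comm_pow ht, add_comm]
  cases hab with
  | cartan_add a b => exact hg (.cartan_add a b)
  | cartan_smul z a => exact hg (.cartan_smul z a)
  | h_zero i => simpa [scaleGen] using hg (.h_zero i)
  | h_h i j r s => simp only [scaleGen]; rw [lie_mul_mul ht, hg (.h_h i j r s), mul_zero]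
  | h_cartan i r a =>
    simp only [scaleGen]
    rw [e1 (g (.cartan a)), lie_mul_mul ht, hg (.h_cartan i r a), mul_zero]
  | cartan_cartan a b => exact hg (.cartan_cartan a b)
  | cartan_x ε j s a =>
    simp only [scaleGen]
    rw [e1 (g (.cartan a)), lie_mul_mul ht, hg (.cartan_x ε j s a), zero_add, mul_smul_comm]
  | x_x_same i r s =>
    simp only [scaleGen]
    rw [lie_mul_mul ht, hg (.x_x_same i r s)]
  | x_x_ne i j hij r s =>
    simp only [scaleGen]
    rw [lie_mul_mul ht, hg (.x_x_ne i j hij r s), mul_zero]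
  | h_x ε i j r s =>
    simp only [scaleGen]
    rw [lie_mul_mul ht, lie_mul_mul ht, show r + 1 + s = r + (s + 1) by omega, ← mul_sub,
      hg (.h_x ε i j r s), mul_mul_comm_pow ht, mul_mul_comm_pow ht, add_comm s r, ← mul_add, e2,
      mul_smul_comm, add_assoc]
  | x_x ε i j r s =>
    simp only [scaleGen]
    rw [lie_mul_mul ht, lie_mul_mul ht, show r + 1 + s = r + (s + 1) by omega, ← mul_sub,
      hg (.x_x ε i j r s), mul_mul_comm_pow ht, mul_mul_comm_pow ht, add_comm s r, ← mul_add, e2,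
      mul_smul_comm, add_assoc]
  | serre ε i j hij r s =>
    simp only [scaleGen]
    exact scale_serre ht (a := fun k => g (.x ε i k)) (a' := fun k => g (.x ε j k)) r s
      (hg (.serre ε i j hij r s))

variable {D} in
theorem YSat.of_injective {K F F' : Type*} [AddMonoidWithOne K] [Ring F] [Algebra ℂ F] [Ring F']
    [Algebra ℂ F'] {ħ : F} {g : YGen I 𝔥 K → F} (f : F →ₐ[ℂ] F') (hf : Function.Injective f)
    (h : YSat D K (f ħ) (fun x => f (g x))) : YSat D K ħ g :=
  fun _ _ hab => hf (h (hab.map f))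

/-- The inclusion of the completed Yangian into the power series in `t`. -/
noncomputable def CompletedYangian.val : CompletedYangian D →ₐ[ℂ] PowerSeries (Yangian D) where
  toFun y := y.1
  map_zero' := rfl
  map_one' := rfl
  map_add' _ _ := rfl
  map_mul' _ _ := rfl
  commutes' c := by
    ext k
    have := CompletedYangian.coeff_algebraMap D k ((Polynomial.C c : ℂ[X]) : ℂ⟦X⟧)
    refine this.trans ?_
    rw [PowerSeries.algebraMap_apply, Polynomial.coe_C, PowerSeries.coeff_C, PowerSeries.coeff_C]
    split_ifs with h
    · subst h
      rw [pow_zero, Algebra.algebraMap_eq_smul_one]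
    · rw [zero_smul]

/-- The images `h`, `h_{ir} t^r`, `x_{ir}^± t^r` of the generators in the completed Yangian. -/
noncomputable def CompletedYangian.gen (x : YGen I 𝔥 ℕ) : CompletedYangian D :=
  CompletedYangian.mk D
    (fun k => if (k : ℤ) = (x.map (fun n : ℕ => (n : ℤ))).deg then YForm.gen D x else 0)
    fun k => by
      split_ifs with h
      · rw [h]
        exact Yangian.gen_mem_degree D x
      · exact zero_mem _

/-- The constant power series. -/
noncomputable def yangianToPowerSeries : Yangian D →ₐ[ℂ] PowerSeries (Yangian D) :=
  { (PowerSeries.C : Yangian D →+* PowerSeries (Yangian D)) with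
    commutes' := fun _ => PowerSeries.algebraMap_apply.symm }

theorem CompletedYangian.sat : YSat D ℕ (hb (CompletedYangian D)) (CompletedYangian.gen D) := by
  refine YSat.of_injective (CompletedYangian.val D) Subtype.val_injective ?_
  have h1 := ((YForm.sat D (K := ℕ)).map
    (yangianToPowerSeries D)).scale
        (t := PowerSeries.X) (fun b => (PowerSeries.commute_X b).eq.symm)
  convert h1 using 1
  · ext k
    refine (CompletedYangian.coeff_algebraMap D k ((Polynomial.X : ℂ[X]) : ℂ⟦X⟧)).trans ?_
    rw [Polynomial.coe_X, PowerSeries.coeff_X]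
    change _ = PowerSeries.coeff k (PowerSeries.X * PowerSeries.C (hb (Yangian D)))
    rw [PowerSeries.coeff_mul_C, PowerSeries.coeff_X]
    split_ifs with h
    · subst h; simp
    · simp
  · ext x k
    have hv : CompletedYangian.val D (CompletedYangian.gen D x) = PowerSeries.mk fun k : ℕ =>
      if (k : ℤ) = (x.map (fun n : ℕ => (n : ℤ))).deg then YForm.gen D x else 0 := rfl
    rw [hv, PowerSeries.coeff_mk]
    cases x with
    | cartan a =>
      change _ = PowerSeries.coeff k (PowerSeries.C (YForm.gen D (.cartan a : YGen I 𝔥 ℕ)))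
      refine Eq.trans ?_ (PowerSeries.coeff_C k _).symm
      simp [YGen.map, YGen.deg]
    | h i r =>
      change _ = PowerSeries.coeff k (PowerSeries.X ^ r * PowerSeries.C (YForm.gen D (.h i r)))
      rw [PowerSeries.coeff_mul_C, PowerSeries.coeff_X_pow]
      simp [YGen.map, YGen.deg]
    | x ε i r =>
      change _ = PowerSeries.coeff k (PowerSeries.X ^ r * PowerSeries.C (YForm.gen D (.x ε i r)))
      rw [PowerSeries.coeff_mul_C, PowerSeries.coeff_X_pow]
      simp [YGen.map, YGen.deg]

/-- The canonical homomorphism `Y_ħ𝔤 → ∏_k (Y_ħ𝔤)_k`. -/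
noncomputable def toCompleted : Yangian D →ₐ[ℂ[X]] CompletedYangian D :=
  YForm.lift D (CompletedYangian.gen D) (CompletedYangian.sat D)

/-- A homogeneous element of degree `n` is sent to the sequence concentrated in degree `n`. -/
theorem coeff_toCompleted {n : ℤ} {y : Yangian D} (hy : y ∈ Yangian.degree D n) (k : ℕ) :
    CompletedYangian.coeff D k (toCompleted D y) = if (k : ℤ) = n then y else 0 := by
  let f : Yangian D →ₐ[ℂ] PowerSeries (Yangian D) :=
    (CompletedYangian.val D).comp ((toCompleted D).restrictScalars ℂ)
  change PowerSeries.coeff k (f y) = _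
  have hgen : ∀ x, f (YForm.gen D x) = PowerSeries.mk fun k => if (k : ℤ) =
      (x.map (fun n : ℕ => (n : ℤ))).deg then YForm.gen D x else 0 := fun x =>
    congrArg (CompletedYangian.val D) (YForm.lift_gen D _ (CompletedYangian.sat D) x)
  have hħ : f (hb (Yangian D)) = PowerSeries.monomial 1 (hb (Yangian D)) := by
    have : f (hb (Yangian D)) = CompletedYangian.val D (hb (CompletedYangian D)) :=
      congrArg (CompletedYangian.val D) ((toCompleted D).commutes _)
    rw [this]
    ext k
    refine (CompletedYangian.coeff_algebraMap D k ((Polynomial.X : ℂ[X]) : ℂ⟦X⟧)).trans ?_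
    rw [Polynomial.coe_X, PowerSeries.coeff_X, PowerSeries.coeff_monomial]
    split_ifs with h
    · subst h; simp
    · simp
  have hlist : ∀ l : List (YGen I 𝔥 ℕ), ∃ m : ℕ,
      (m : ℤ) = (l.map fun x => (x.map (fun n : ℕ => (n : ℤ))).deg).sum ∧
      f (l.map (YForm.gen D)).prod = PowerSeries.monomial m (l.map (YForm.gen D)).prod := by
    intro l
    induction l with
    | nil => exact ⟨0, by simp, by rw [List.map_nil, List.prod_nil, map_one, PowerSeries.monomial_zero_eq_C_apply, map_one]⟩
    | cons x l ih =>
      obtain ⟨m, hm, hf⟩ := ih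
      obtain ⟨r, hr⟩ : ∃ r : ℕ, (r : ℤ) = (x.map (fun n : ℕ => (n : ℤ))).deg := by
        cases x with
        | cartan a => exact ⟨0, rfl⟩
        | h i r => exact ⟨r, rfl⟩
        | x ε i r => exact ⟨r, rfl⟩
      refine ⟨r + m, by push_cast; rw [hm, hr]; simp, ?_⟩
      have : f (YForm.gen D x) = PowerSeries.monomial r (YForm.gen D x) := by
        rw [hgen]
        ext k
        rw [PowerSeries.coeff_mk, PowerSeries.coeff_monomial, ← hr]
        simp
      rw [List.map_cons, List.prod_cons, map_mul, hf, this, PowerSeries.monomial_mul_monomial]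
  induction hy using Submodule.span_induction with
  | mem y hy =>
    obtain ⟨a, l, rfl, rfl⟩ := hy
    obtain ⟨m, hm, hf⟩ := hlist l
    have hp : ∀ a : ℕ, f (hb (Yangian D) ^ a) = PowerSeries.monomial a (hb (Yangian D) ^ a) := by
      intro a
      induction a with
      | zero => rw [pow_zero, map_one, PowerSeries.monomial_zero_eq_C_apply, map_one]
      | succ a ih => rw [pow_succ, map_mul, ih, hħ, PowerSeries.monomial_mul_monomial]
    rw [map_mul]
    erw [hp, hf]
    rw [PowerSeries.monomial_mul_monomial, PowerSeries.coeff_monomial]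
    simp only [← hm]
    norm_cast
  | zero => simp
  | add x y _ _ hx hy => rw [map_add, map_add, hx, hy]; split_ifs <;> simp
  | smul c x _ hx => rw [map_smul, PowerSeries.coeff_smul, hx]; split_ifs <;> simp

end ToCompleted

section FormalSeries

variable {I 𝔥 : Type*} [Fintype I] [AddCommGroup 𝔥] [Module ℂ 𝔥] (D : KacMoodyDatum I 𝔥)

/-- The algebra `Y_ħ𝔤[z; z^{-1}]]` of formal Laurent series in `z^{-1}`:
the coefficient of `z^{-m}` of `f` is `f.coeff m`. -/
abbrev YLaurent : Type _ := HahnSeries ℤ (Yangian D)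

/-- The subspace `z^n ∏_{k ∈ ℕ} (Y_ħ𝔤)_k z^{-k}`, that is, the coefficient of `z^{n-k}` is in
`(Y_ħ𝔤)_k` for each `k` (and is zero for `k < 0`). -/
noncomputable def LPiece (n : ℤ) : Submodule ℂ (YLaurent D) where
  carrier := {f | ∀ k : ℤ, f.coeff (k - n) ∈ Yangian.degree D k}
  zero_mem' := fun k => by simp
  add_mem' := fun ha hb k => by rw [HahnSeries.coeff_add]; exact add_mem (ha k) (hb k)
  smul_mem' := fun c f hf k => by
    rw [HahnSeries.coeff_smul]; exact Submodule.smul_mem _ _ (hf k)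

theorem LPiece.coeff_mem {n : ℤ} {f : YLaurent D} (hf : f ∈ LPiece D n) (a : ℤ) :
    f.coeff a ∈ Yangian.degree D (a + n) := by
  have := hf (a + n)
  rwa [add_sub_cancel_right] at this

instance : SetLike.GradedMonoid (LPiece D) where
  one_mem := fun k => by
    rw [HahnSeries.coeff_one, sub_zero]
    split_ifs with h
    · subst h
      exact_mod_cast Yangian.one_mem_degree D
    · exact zero_mem _
  mul_mem := fun m n f g hf hg k => by
    rw [HahnSeries.coeff_mul]
    refine sum_mem fun x hx => ?_
    have h := (Finset.mem_antidiagonal.1 hx).2.2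
    have e : k = (x.1 + m) + (x.2 + n) := by omega
    rw [e]
    exact SetLike.GradedMul.mul_mem (LPiece.coeff_mem D hf _) (LPiece.coeff_mem D hg _)

theorem LPiece.single_mem {k : ℤ} {y : Yangian D} (hy : y ∈ Yangian.degree D k) (a : ℤ) :
    HahnSeries.single a y ∈ LPiece D (k - a) := fun j => by
  rw [HahnSeries.coeff_single]
  split_ifs with h
  · have : j = k := by omega
    exact this ▸ hy
  · exact zero_mem _

theorem LPiece.hb_mem : hb (YLaurent D) ∈ (DirectSum.coeAlgHom (LPiece D)).range := by
  have h : hb (YLaurent D) = HahnSeries.single 0 (hb (Yangian D)) := rfl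
  have h2 := LPiece.single_mem D (by simpa using Yangian.hb_pow_mem_degree D 1) (0 : ℤ)
  exact ⟨DirectSum.of (fun k => LPiece D k) _ ⟨_, h2⟩, (DirectSum.coeAlgHom_of _ _ _).trans h.symm⟩

/-- The `ℂ[ħ]`-subalgebra `⨁_{n ∈ ℤ} z^n ∏_{k ∈ ℕ} (Y_ħ𝔤)_k z^{-k}` of `Y_ħ𝔤[z; z^{-1}]]`,
consisting of all finite sums of elements of the summands. -/
noncomputable def LForm : Subalgebra ℂ[X] (YLaurent D) :=
  { (DirectSum.coeAlgHom (LPiece D)).range with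
    algebraMap_mem' := fun p => algebraMap_mem_iSup_of_hb _ (LPiece.hb_mem D) p }

theorem LPiece.mem_LForm {n : ℤ} {f : YLaurent D} (hf : f ∈ LPiece D n) : f ∈ LForm D :=
  ⟨DirectSum.of (fun k => LPiece D k) n ⟨f, hf⟩, DirectSum.coeAlgHom_of _ _ _⟩

/-- The inclusion `Y_ħ𝔤[z] ⊂ Y_ħ𝔤[z; z^{-1}]]`. -/
noncomputable def polyToLaurent : Polynomial (Yangian D) →+* YLaurent D :=
  Polynomial.eval₂RingHom' HahnSeries.C (HahnSeries.single (-1) 1) fun a => by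
    change HahnSeries.single 0 a * _ = _ * HahnSeries.single 0 a
    rw [HahnSeries.single_mul_single, HahnSeries.single_mul_single, add_comm, mul_one, one_mul]

theorem C_mem_LForm (y : Yangian D) : (HahnSeries.C y : YLaurent D) ∈ LForm D := by
  obtain ⟨x, rfl⟩ := Yangian.mem_range_coeAlgHom D y
  induction x using DirectSum.induction_on with
  | zero => rw [map_zero, map_zero]; exact zero_mem _
  | of k y =>
    have : DirectSum.coeAlgHom (Yangian.degree D) (DirectSum.of (fun k => Yangian.degree D k) k y)
      = (y : Yangian D) := DirectSum.coeAlgHom_of _ _ _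
    erw [this]
    exact LPiece.mem_LForm D (LPiece.single_mem D y.2 0)
  | add a b ha hb => rw [map_add, map_add]; exact add_mem ha hb

theorem polyToLaurent_mem (p : Polynomial (Yangian D)) : polyToLaurent D p ∈ LForm D := by
  induction p using Polynomial.induction_on' with
  | add p q hp hq => rw [map_add]; exact add_mem hp hq
  | monomial n y =>
    change Polynomial.eval₂ _ _ _ ∈ _
    rw [Polynomial.eval₂_monomial]
    refine mul_mem (C_mem_LForm D y) (pow_mem ?_ n)
    exact LPiece.mem_LForm D (LPiece.single_mem D (Yangian.one_mem_degree D) (-1))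

/-- The inclusion `Y_ħ𝔤[z] ⊂ ⨁_{n ∈ ℤ} z^n ∏_{k ∈ ℕ} (Y_ħ𝔤)_k z^{-k}`. -/
noncomputable def polyToLForm : Polynomial (Yangian D) →+* LForm D :=
  (polyToLaurent D).codRestrict (LForm D) (polyToLaurent_mem D)

end FormalSeries

section HAdic

variable (A : Type*) [Ring A] [Algebra ℂ[X] A]

/-- The ideal `ħ^n A`. -/
noncomputable def hIdeal (n : ℕ) : Ideal A where
  carrier := {a | ∃ b, a = hb A ^ n * b}
  zero_mem' := ⟨0, by simp⟩
  add_mem' := by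
    rintro _ _ ⟨a, rfl⟩ ⟨b, rfl⟩
    exact ⟨a + b, by rw [mul_add]⟩
  smul_mem' := by
    rintro c _ ⟨a, rfl⟩
    refine ⟨c * a, ?_⟩
    have : Commute c (hb A ^ n) := (show Commute c (hb A) from (Algebra.commutes _ _).symm).pow_right n
    rw [smul_eq_mul, ← mul_assoc, this.eq, mul_assoc]

instance (n : ℕ) : (hIdeal A n).IsTwoSided where
  mul_mem_of_left := by
    rintro _ b ⟨a, rfl⟩
    exact ⟨a * b, by rw [mul_assoc]⟩

theorem hIdeal_antitone {m n : ℕ} (h : m ≤ n) : hIdeal A n ≤ hIdeal A m := by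
  rintro _ ⟨a, rfl⟩
  obtain ⟨k, rfl⟩ := Nat.exists_eq_add_of_le h
  exact ⟨hb A ^ k * a, by rw [pow_add, mul_assoc]⟩

/-- Compatible sequences in `∏_n A / ħ^n A`. -/
noncomputable def hCompletionSubring : Subring (∀ n : ℕ, A ⧸ hIdeal A n) where
  carrier := {x | ∀ (m n : ℕ) (h : m ≤ n), Ideal.Quotient.factor (hIdeal_antitone A h) (x n) = x m}
  zero_mem' := fun m n h => by simp
  one_mem' := fun m n h => by simp
  add_mem' := fun ha hb m n h => by simp [ha m n h, hb m n h]
  mul_mem' := fun ha hb m n h => by simp [ha m n h, hb m n h]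
  neg_mem' := fun ha m n h => by simp [ha m n h]

/-- The `ħ`-adic completion `lim_n A / ħ^n A` of a `ℂ[ħ]`-algebra. -/
def HCompletion : Type _ := hCompletionSubring A

noncomputable instance : Ring (HCompletion A) := inferInstanceAs (Ring (hCompletionSubring A))

/-- The canonical homomorphism `A → lim_n A / ħ^n A`. -/
noncomputable def HCompletion.of : A →+* HCompletion A :=
  (RingHom.pi fun n => Ideal.Quotient.mk (hIdeal A n)).codRestrict (hCompletionSubring A)
    fun a _ _ h => Ideal.Quotient.factor_mk (hIdeal_antitone A h) a

/-- The projection `lim_n A / ħ^n A → A / ħ^n A`. -/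
noncomputable def HCompletion.eval (n : ℕ) : HCompletion A →+* A ⧸ hIdeal A n :=
  (Pi.evalRingHom _ n).comp (hCompletionSubring A).subtype

variable {A}

theorem HCompletion.exists_eq_mk (x : HCompletion A) (n : ℕ) :
    ∃ a : A, ∀ m ≤ n, HCompletion.eval A m x = Ideal.Quotient.mk (hIdeal A m) a := by
  obtain ⟨a, ha⟩ := Ideal.Quotient.mk_surjective (x.1 n)
  exact ⟨a, fun m hm => (x.2 m n hm).symm.trans (by rw [← ha, Ideal.Quotient.factor_mk])⟩

theorem HCompletion.eval_add {x y : HCompletion A} {n : ℕ} {a b : A}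
    (hx : HCompletion.eval A n x = Ideal.Quotient.mk (hIdeal A n) a)
    (hy : HCompletion.eval A n y = Ideal.Quotient.mk (hIdeal A n) b) :
    HCompletion.eval A n (x + y) = Ideal.Quotient.mk (hIdeal A n) (a + b) := by
  rw [map_add, hx, hy, map_add]

theorem HCompletion.eval_mul {x y : HCompletion A} {n : ℕ} {a b : A}
    (hx : HCompletion.eval A n x = Ideal.Quotient.mk (hIdeal A n) a)
    (hy : HCompletion.eval A n y = Ideal.Quotient.mk (hIdeal A n) b) :
    HCompletion.eval A n (x * y) = Ideal.Quotient.mk (hIdeal A n) (a * b) := by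
  rw [map_mul, hx, hy, map_mul]

theorem mk_hIdeal_eq_of_coeff {p q : ℂ[X]} {n : ℕ} (h : ∀ k < n, p.coeff k = q.coeff k) :
    Ideal.Quotient.mk (hIdeal A n) (algebraMap ℂ[X] A p) =
      Ideal.Quotient.mk (hIdeal A n) (algebraMap ℂ[X] A q) := by
  obtain ⟨r, hr⟩ : (Polynomial.X ^ n : ℂ[X]) ∣ p - q :=
    Polynomial.X_pow_dvd_iff.2 fun k hk => by rw [Polynomial.coeff_sub, h k hk, sub_self]
  refine Ideal.Quotient.eq.2 ⟨algebraMap ℂ[X] A r, ?_⟩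
  rw [← map_sub, hr, map_mul, map_pow]

variable (A)

/-- `∑_k c_k ħ^k` as an element of `lim_n A / ħ^n A`. -/
noncomputable def HCompletion.scalar : ℂ⟦X⟧ →+* HCompletion A where
  toFun p := ⟨fun n => Ideal.Quotient.mk (hIdeal A n) (algebraMap ℂ[X] A (PowerSeries.trunc n p)),
    fun m n h => by
      rw [Ideal.Quotient.factor_mk]
      refine mk_hIdeal_eq_of_coeff fun k hk => ?_
      rw [PowerSeries.coeff_trunc, PowerSeries.coeff_trunc, if_pos hk, if_pos (by omega)]⟩
  map_zero' := Subtype.ext (funext fun n => by simp; rfl)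
  map_one' := Subtype.ext (funext fun n => by
    change _ = Ideal.Quotient.mk (hIdeal A n) 1
    rw [← map_one (algebraMap ℂ[X] A)]
    refine mk_hIdeal_eq_of_coeff fun k hk => ?_
    rw [PowerSeries.coeff_trunc, if_pos hk, PowerSeries.coeff_one, Polynomial.coeff_one])
  map_add' p q := Subtype.ext (funext fun n => by
    change _ = Ideal.Quotient.mk (hIdeal A n) _ + Ideal.Quotient.mk (hIdeal A n) _
    rw [← map_add, ← map_add, ← map_add])
  map_mul' p q := Subtype.ext (funext fun n => by
    change _ = Ideal.Quotient.mk (hIdeal A n) _ * Ideal.Quotient.mk (hIdeal A n) _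
    rw [← map_mul, ← map_mul]
    refine mk_hIdeal_eq_of_coeff fun k hk => ?_
    rw [PowerSeries.coeff_trunc, if_pos hk, PowerSeries.coeff_mul, Polynomial.coeff_mul]
    refine Finset.sum_congr rfl fun x hx => ?_
    have := Finset.HasAntidiagonal.mem_antidiagonal.1 hx
    rw [PowerSeries.coeff_trunc, PowerSeries.coeff_trunc, if_pos (by omega), if_pos (by omega)])

noncomputable instance : Algebra ℂ⟦X⟧ (HCompletion A) :=
  RingHom.toAlgebra' (HCompletion.scalar A) fun p x => Subtype.ext (funext fun n => by
    obtain ⟨a, ha⟩ := Ideal.Quotient.mk_surjective (x.1 n)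
    change Ideal.Quotient.mk (hIdeal A n) _ * x.1 n = x.1 n * Ideal.Quotient.mk (hIdeal A n) _
    rw [← ha, ← map_mul, ← map_mul, Algebra.commutes])

end HAdic

section Evaluation

variable {I 𝔥 : Type*} [Fintype I] [AddCommGroup 𝔥] [Module ℂ 𝔥] (D : KacMoodyDatum I 𝔥)

/-- The `ħ`-adic completion of `⨁_{n ∈ ℤ} z^n ∏_{k ∈ ℕ} (Y_ħ𝔤)_k z^{-k}`. -/
abbrev LHat : Type _ := HCompletion (LForm D)

theorem coeAlgHom_LPiece_injective : Function.Injective (DirectSum.coeAlgHom (LPiece D)) := by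
  rw [injective_iff_map_eq_zero]
  intro x hx
  -- for `k = a + n`, the degree `k` part of the coefficient of `z^{-a}` only sees the summand `n`
  have key : ∀ (a n : ℤ), 0 ≤ a + n → ((x n : LPiece D n) : YLaurent D).coeff a = 0 := by
    intro a n han
    let φ : YLaurent D →+ Yangian D :=
      { toFun := fun f => CompletedYangian.coeff D (a + n).toNat (toCompleted D (f.coeff a))
        map_zero' := by rw [HahnSeries.coeff_zero, map_zero, CompletedYangian.coeff_zero]
        map_add' := fun f g => by
          rw [HahnSeries.coeff_add, map_add, CompletedYangian.coeff_add] }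
    have hφ : ∀ (m : ℤ) (f : LPiece D m), φ f = if m = n then (f : YLaurent D).coeff a else 0 := by
      intro m f
      refine (coeff_toCompleted D (LPiece.coeff_mem D f.2 a) _).trans ?_
      rw [Int.toNat_of_nonneg han]
      by_cases h : m = n
      · rw [if_pos h, if_pos (by omega)]
      · rw [if_neg h, if_neg (by omega)]
    have hsum : ∀ y : ⨁ m, LPiece D m, φ (DirectSum.coeAlgHom (LPiece D) y) =
        ((y n : LPiece D n) : YLaurent D).coeff a := by
      intro y
      induction y using DirectSum.induction_on with
      | zero => rw [map_zero, map_zero]; rfl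
      | of m f =>
        have e : DirectSum.coeAlgHom (LPiece D) (DirectSum.of (fun k => LPiece D k) m f)
          = (f : YLaurent D) := DirectSum.coeAlgHom_of _ _ _
        erw [e, hφ]
        split_ifs with h
        · subst h; rw [DirectSum.of_eq_same]
        · rw [DirectSum.of_eq_of_ne _ _ _ (Ne.symm h)]; rfl
      | add y y' h h' => rw [map_add, map_add, h, h']; rfl
    rw [← hsum, hx, map_zero]
  refine DFinsupp.ext fun n => Subtype.ext (HahnSeries.ext (funext fun a => ?_))
  by_cases han : 0 ≤ a + n
  · exact key a n han
  · have := LPiece.coeff_mem D (x n).2 a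
    rw [Yangian.degree_of_neg D (by omega)] at this
    exact this

/-- `⨁_n z^n ∏_k (Y_ħ𝔤)_k z^{-k}` is the direct sum of its summands. -/
noncomputable def LForm.equiv : (⨁ n, LPiece D n) ≃+* LForm D :=
  RingEquiv.ofBijective
    ((DirectSum.coeAlgHom (LPiece D)).toRingHom.codRestrict (LForm D) fun x => ⟨x, rfl⟩)
    ⟨fun _ _ h => coeAlgHom_LPiece_injective D (congrArg Subtype.val h),
      fun y => ⟨y.2.choose, Subtype.ext y.2.choose_spec⟩⟩

theorem LForm.equiv_of {n : ℤ} (f : LPiece D n) :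
    LForm.equiv D (DirectSum.of (fun n => LPiece D n) n f) = ⟨f, LPiece.mem_LForm D f.2⟩ :=
  Subtype.ext (DirectSum.coeAlgHom_of _ _ _)

/-- Evaluation of `z^n ∑_k y_k z^{-k}` at `z = c`: the sequence `(c^{n-k} y_k)_k`. -/
noncomputable def evPiece (c : ℂˣ) (n : ℤ) : LPiece D n →+ CompletedYangian D where
  toFun f := CompletedYangian.mk D
    (fun k => ((c ^ (n - (k : ℤ)) : ℂˣ) : ℂ) • (f : YLaurent D).coeff ((k : ℤ) - n))
    fun k => Submodule.smul_mem _ _ (f.2 k)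
  map_zero' := CompletedYangian.ext fun k => by simp [CompletedYangian.coeff_zero]
  map_add' f g := CompletedYangian.ext fun k => by simp [CompletedYangian.coeff_add]

theorem coeff_evPiece (c : ℂˣ) (n : ℤ) (f : LPiece D n) (k : ℕ) :
    CompletedYangian.coeff D k (evPiece D c n f) =
      ((c ^ (n - (k : ℤ)) : ℂˣ) : ℂ) • (f : YLaurent D).coeff ((k : ℤ) - n) := by
  simp only [evPiece, AddMonoidHom.coe_mk, ZeroHom.coe_mk, CompletedYangian.coeff_mk']

theorem coeff_LPiece_mul {m n : ℤ} {f g : YLaurent D} (hf : f ∈ LPiece D m) (hg : g ∈ LPiece D n)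
    (k : ℕ) : (f * g).coeff ((k : ℤ) - (m + n)) = ∑ x ∈ Finset.HasAntidiagonal.antidiagonal k,
      f.coeff ((x.1 : ℤ) - m) * g.coeff ((x.2 : ℤ) - n) := by
  have h0 : ∀ {n : ℤ} {f : YLaurent D}, f ∈ LPiece D n → ∀ a, a + n < 0 → f.coeff a = 0 := by
    intro n f hf a ha
    have := LPiece.coeff_mem D hf a
    rwa [Yangian.degree_of_neg D ha, Submodule.mem_bot] at this
  rw [HahnSeries.coeff_mul]
  symm
  refine Finset.sum_bij_ne_zero (fun x _ _ => ((x.1 : ℤ) - m, (x.2 : ℤ) - n)) ?_ ?_ ?_ ?_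
  · intro x hx hne
    have := Finset.HasAntidiagonal.mem_antidiagonal.1 hx
    refine Finset.mem_antidiagonal.2 ⟨left_ne_zero_of_mul hne, right_ne_zero_of_mul hne, ?_⟩
    dsimp only
    omega
  · intro x _ _ y _ _ h
    have h1 := congrArg Prod.fst h
    have h2 := congrArg Prod.snd h
    dsimp only at h1 h2
    exact Prod.ext (by omega) (by omega)
  · intro y hy hne
    obtain ⟨h1, h2, h3⟩ := Finset.mem_antidiagonal.1 hy
    have h1' : 0 ≤ y.1 + m := by
      by_contra h
      exact h1 (h0 hf _ (by omega))
    have h2' : 0 ≤ y.2 + n := by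
      by_contra h
      exact h2 (h0 hg _ (by omega))
    have e1 : (((y.1 + m).toNat : ℕ) : ℤ) - m = y.1 := by omega
    have e2 : (((y.2 + n).toNat : ℕ) : ℤ) - n = y.2 := by omega
    refine ⟨((y.1 + m).toNat, (y.2 + n).toNat), ?_, ?_, ?_⟩
    · rw [Finset.HasAntidiagonal.mem_antidiagonal]
      dsimp only
      omega
    · dsimp only
      rw [e1, e2]
      exact hne
    · dsimp only
      rw [e1, e2]
  · intro x _ _
    rfl

/-- Evaluation at `z = c` on `⨁_{n ∈ ℤ} z^n ∏_{k ∈ ℕ} (Y_ħ𝔤)_k z^{-k}`. -/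
noncomputable def evForm (c : ℂˣ) : LForm D →+* CompletedYangian D :=
  (DirectSum.toSemiring (evPiece D c)
    (CompletedYangian.ext fun k => by
      rw [coeff_evPiece, CompletedYangian.coeff_one]
      change _ • (1 : YLaurent D).coeff _ = _
      rw [HahnSeries.coeff_one]
      by_cases h : k = 0
      · subst h; simp
      · rw [if_neg h, if_neg (by omega), smul_zero])
    (fun {m n} f g => CompletedYangian.ext fun k => by
      rw [coeff_evPiece, CompletedYangian.coeff_mul]
      change _ • ((f : YLaurent D) * (g : YLaurent D)).coeff _ = _
      rw [coeff_LPiece_mul D f.2 g.2, Finset.smul_sum]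
      refine Finset.sum_congr rfl fun x hx => ?_
      have h := Finset.HasAntidiagonal.mem_antidiagonal.1 hx
      rw [coeff_evPiece, coeff_evPiece, smul_mul_smul_comm, ← Units.val_mul, ← zpow_add]
      congr 3
      omega)).comp (LForm.equiv D).symm.toRingHom

/-- `z^n ∑_k y_k z^{-k}` is sent to `(c^{n-k} y_k)_k`. -/
theorem evForm_of_mem (c : ℂˣ) {n : ℤ} {f : YLaurent D} (hf : f ∈ LPiece D n) :
    evForm D c ⟨f, LPiece.mem_LForm D hf⟩ = evPiece D c n ⟨f, hf⟩ := by
  have : (LForm.equiv D).symm ⟨f, LPiece.mem_LForm D hf⟩ =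
      DirectSum.of (fun n => LPiece D n) n ⟨f, hf⟩ := by
    rw [RingEquiv.symm_apply_eq, LForm.equiv_of]
  rw [evForm, RingHom.comp_apply]
  erw [this]
  exact DirectSum.toSemiring_of _ _ _ _ _

theorem evForm_algebraMap (c : ℂˣ) (p : ℂ[X]) :
    evForm D c (algebraMap ℂ[X] _ p) = algebraMap ℂ[X] (CompletedYangian D) p := by
  induction p using Polynomial.induction_on' with
  | add p q hp hq => rw [map_add, map_add, map_add, hp, hq]
  | monomial n z =>
    have h := LPiece.single_mem D
      (Submodule.smul_mem _ z (Yangian.hb_pow_mem_degree D n)) (0 : ℤ)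
    have e : algebraMap ℂ[X] (LForm D) (Polynomial.monomial n z) =
        ⟨HahnSeries.single 0 (z • hb (Yangian D) ^ n), LPiece.mem_LForm D h⟩ := by
      refine Subtype.ext ?_
      change HahnSeries.single 0 (algebraMap ℂ[X] (Yangian D) (Polynomial.monomial n z)) = _
      have e' : algebraMap ℂ[X] (Yangian D) (Polynomial.monomial n z) =
          z • hb (Yangian D) ^ n := by
        rw [← Polynomial.C_mul_X_pow_eq_monomial, map_mul, map_pow, Algebra.smul_def]
        rfl
      exact congrArg _ e'
    rw [e, evForm_of_mem D c h]
    refine CompletedYangian.ext fun k => ?_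
    rw [coeff_evPiece]
    refine Eq.trans ?_ (CompletedYangian.coeff_algebraMap D k
      ((Polynomial.monomial n z : ℂ[X]) : ℂ⟦X⟧)).symm
    rw [Polynomial.coeff_coe, Polynomial.coeff_monomial, HahnSeries.coeff_single]
    by_cases hk : k = n
    · subst hk; simp
    · rw [if_neg (by omega), if_neg (by omega), smul_zero, zero_smul]

theorem coeff_evForm_eq (c : ℂˣ) {n k : ℕ} (hk : k < n) {f g : LForm D}
    (h : Ideal.Quotient.mk (hIdeal (LForm D) n) f = Ideal.Quotient.mk (hIdeal (LForm D) n) g) :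
    CompletedYangian.coeff D k (evForm D c f) = CompletedYangian.coeff D k (evForm D c g) := by
  obtain ⟨r, hr⟩ := Ideal.Quotient.eq.1 h
  have e : f = g + hb (LForm D) ^ n * r := by rw [← hr]; abel
  rw [e, map_add, CompletedYangian.coeff_add, map_mul, ← map_pow, evForm_algebraMap,
    CompletedYangian.coeff_mul]
  refine add_eq_left.2 (Finset.sum_eq_zero fun x hx => ?_)
  have hx := Finset.HasAntidiagonal.mem_antidiagonal.1 hx
  have : CompletedYangian.coeff D x.1
      (algebraMap ℂ[X] (CompletedYangian D) (Polynomial.X ^ n)) = 0 := by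
    refine (CompletedYangian.coeff_algebraMap D x.1
      ((Polynomial.X ^ n : ℂ[X]) : ℂ⟦X⟧)).trans ?_
    rw [Polynomial.coeff_coe, Polynomial.coeff_X_pow, if_neg (by omega), zero_smul]
  rw [this, zero_mul]

/-- The component of degree `k` of the evaluation at `z = c` of an element of the completion,
computed on a representative modulo `ħ^{k+1}`. -/
noncomputable def evCoeff (c : ℂˣ) (x : LHat D) (k : ℕ) : Yangian D :=
  CompletedYangian.coeff D k (evForm D c (x.exists_eq_mk (k + 1)).choose)

theorem evCoeff_eq (c : ℂˣ) (x : LHat D) {k n : ℕ} (hk : k < n) {f : LForm D}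
    (hf : HCompletion.eval _ n x = Ideal.Quotient.mk (hIdeal (LForm D) n) f) :
    evCoeff D c x k = CompletedYangian.coeff D k (evForm D c f) := by
  obtain ⟨g, hg⟩ := x.exists_eq_mk n
  rw [coeff_evForm_eq D c hk (hf.symm.trans (hg n le_rfl))]
  exact coeff_evForm_eq D c (Nat.lt_succ_self k)
    (((x.exists_eq_mk (k + 1)).choose_spec _ le_rfl).symm.trans (hg _ hk))

/-- The sequence of the components `evCoeff`. -/
noncomputable def evFun (c : ℂˣ) (x : LHat D) : CompletedYangian D :=
  CompletedYangian.mk D (evCoeff D c x) fun _ => CompletedYangian.coeff_mem _ _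

theorem coeff_evFun (c : ℂˣ) (x : LHat D) {k n : ℕ} (hk : k < n) {f : LForm D}
    (hf : HCompletion.eval _ n x = Ideal.Quotient.mk (hIdeal (LForm D) n) f) :
    CompletedYangian.coeff D k (evFun D c x) = CompletedYangian.coeff D k (evForm D c f) :=
  (PowerSeries.coeff_mk k _).trans (evCoeff_eq D c x hk hf)

/-- The evaluation homomorphism `f(z) ↦ f(c)` on the `ħ`-adic completion of
`⨁_{n ∈ ℤ} z^n ∏_{k ∈ ℕ} (Y_ħ𝔤)_k z^{-k}`: the extension of `evForm` by continuity. -/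
noncomputable def evHat (c : ℂˣ) : LHat D →ₐ[ℂ⟦X⟧] CompletedYangian D where
  toFun := evFun D c
  map_zero' := CompletedYangian.ext fun k => by
    rw [coeff_evFun D c 0 (Nat.lt_succ_self k) (f := 0) (by rw [map_zero, map_zero]), map_zero]
  map_one' := CompletedYangian.ext fun k => by
    rw [coeff_evFun D c 1 (Nat.lt_succ_self k) (f := 1) (by rw [map_one, map_one]), map_one]
  map_add' x y := CompletedYangian.ext fun k => by
    obtain ⟨f, hf⟩ := x.exists_eq_mk (k + 1)
    obtain ⟨g, hg⟩ := y.exists_eq_mk (k + 1)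
    rw [CompletedYangian.coeff_add, coeff_evFun D c x (Nat.lt_succ_self k) (hf _ le_rfl),
      coeff_evFun D c y (Nat.lt_succ_self k) (hg _ le_rfl),
      coeff_evFun D c (x + y) (Nat.lt_succ_self k) (f := f + g)
        (HCompletion.eval_add (hf _ le_rfl) (hg _ le_rfl)),
      map_add, CompletedYangian.coeff_add]
  map_mul' x y := CompletedYangian.ext fun k => by
    obtain ⟨f, hf⟩ := x.exists_eq_mk (k + 1)
    obtain ⟨g, hg⟩ := y.exists_eq_mk (k + 1)
    rw [CompletedYangian.coeff_mul, coeff_evFun D c (x * y) (Nat.lt_succ_self k) (f := f * g)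
        (HCompletion.eval_mul (hf _ le_rfl) (hg _ le_rfl)),
      map_mul, CompletedYangian.coeff_mul]
    refine Finset.sum_congr rfl fun i hi => ?_
    have hi := Finset.HasAntidiagonal.mem_antidiagonal.1 hi
    rw [coeff_evFun D c x (by omega : i.1 < k + 1) (hf _ le_rfl),
      coeff_evFun D c y (by omega : i.2 < k + 1) (hg _ le_rfl)]
  commutes' p := CompletedYangian.ext fun k => by
    rw [CompletedYangian.coeff_algebraMap,
      coeff_evFun D c _ (Nat.lt_succ_self k)
        (f := algebraMap ℂ[X] _ (PowerSeries.trunc (k + 1) p)) rfl, evForm_algebraMap]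
    refine (CompletedYangian.coeff_algebraMap D k
      ((PowerSeries.trunc (k + 1) p : ℂ[X]) : ℂ⟦X⟧)).trans ?_
    rw [Polynomial.coeff_coe, PowerSeries.coeff_trunc, if_pos (Nat.lt_succ_self k)]

/-- On `⨁_n z^n ∏_k (Y_ħ𝔤)_k z^{-k}`, `evHat` is the evaluation `evForm`. -/
theorem evHat_of (c : ℂˣ) (f : LForm D) : evHat D c (HCompletion.of (LForm D) f) = evForm D c f :=
  CompletedYangian.ext fun k => coeff_evFun D c _ (Nat.lt_succ_self k) rfl

end Evaluation

section DeltaFunction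

/-- A formal series in `ℂ[[z^{±1}, u^{±1}]]`; `f a b` is the coefficient of `z^a u^b`. -/
abbrev FormalZU : Type := ℤ → ℤ → ℂ

/-- The formal delta function `δ(z/u) = ∑_{r ∈ ℤ} (z/u)^r`. -/
def deltaZU : FormalZU := fun a b => if a + b = 0 then 1 else 0

/-- The formal derivative `∂_z`. -/
noncomputable def derivZ (f : FormalZU) : FormalZU := fun a b => ((a : ℂ) + 1) * f (a + 1) b

/-- `∂_z^{(n)} = (1 / n!) ∂_z^n`. -/
noncomputable def divDerivZ (n : ℕ) (f : FormalZU) : FormalZU :=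
  (n.factorial : ℂ)⁻¹ • derivZ^[n] f

/-- The coefficient of `z^a u^b` in `∑_{n ∈ ℕ} y_n ∂_z^{(n)} (δ(z/u))`; at most one summand is
nonzero. -/
noncomputable def deltaSum {Y : Type*} [AddCommGroup Y] [Module ℂ Y] (y : ℕ → Y) (a b : ℤ) : Y :=
  ∑ᶠ n : ℕ, divDerivZ n deltaZU a b • y n

end DeltaFunction

/-! The map is forced by the shift formulas: for every integer `r`, send `𝓧_{ir}^±` to `∑_k (r
choose k) x_{ik}^± z^{r-k}` with generalized binomial coefficients, and likewise for `𝓗_{ir}`. For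
`r ≥ 0` the sum is finite and equals `τ_z`; for `r < 0` it is an infinite series in `z^{-1}`,
homogeneous of degree `r`, which is why completed graded pieces are needed.

Existence. The relations with integer indices follow from those with natural indices. The
Chu–Vandermonde identity gives the relation `[x^+, x^-] = h` (`lie_binomSeries_add`). Pascal's rule
reduces the relations involving `ħ` to their coefficients (`binomSeries_exchange`). The Serre
relations follow by multilinearity over the center, applied to truncations (`binomSeries_serre`).
The resulting family defines a homomorphism on `𝔻Y_ħ𝔤`, and, after evaluating power series at `ħ` in
the `ħ`-adic completion, a homomorphism on `DY_ħ𝔤` (`DYangian.lift`).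

Uniqueness. The condition on `ι` fixes only the nonnegative modes, so the negative ones must be
recovered. Let two solutions agree on `𝓧_{i,s+1}^±`, let `b` be the difference of their values on
`𝓧_{is}^±`, and put `κ = ±d_i`. The relation between `h_{i1}, h_{i0}` and the modes `s, s+1` loses
its `s+1` terms in the difference. As `[h_{i0}, b] = 2κ b` and `h_{i1} ↦ h_{i1} + ζ h_{i0}`, with `ζ
= z` or `ζ = c`, it becomes `2κ ζ b + (h_{i1} - κħ h_{i0}) b + b (-h_{i1} - κħ h_{i0}) = 0`. The
first term dominates the others, which multiply by elements of degree 1, so `b = 0`. For the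
completed Yangian this is an induction on the degree (`CompletedYangian.eq_zero_of_scalar_add`).
Over formal series in `z` the operator is bijective on the uncompleted algebra and commutes with
`ħ`, hence is injective modulo each `ħ^n` (`LHat.eq_zero_of_zShift`). Then `𝓗_{is} = [𝓧_{is}^+,
𝓧_{i0}^-]` is determined as well, and `ħ`-adic separatedness gives equality everywhere
(`DYangian.algHom_ext_iota`). -/

/-! ### Relations between binomial series in `w = z^{-1}`. -/

section BinomialSeries

variable {B : Type*} [Ring B]

/-- `∑_k (r choose k) a_k w^k`. -/
noncomputable def binomSeries (r : ℤ) (a : ℕ → B) : PowerSeries B :=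
  PowerSeries.mk fun k => Ring.choose r k • a k

@[simp]
theorem coeff_binomSeries (r : ℤ) (a : ℕ → B) (k : ℕ) :
    PowerSeries.coeff k (binomSeries r a) = Ring.choose r k • a k := PowerSeries.coeff_mk _ _

theorem binomSeries_zero (a : ℕ → B) : binomSeries 0 a = PowerSeries.C (a 0) := by
  ext k
  rw [coeff_binomSeries, PowerSeries.coeff_C]
  cases k with
  | zero => simp
  | succ k => simp [Ring.choose_zero_succ]

/-- Pascal's rule, valid for every integer `r`. It trades a step in `r` for a step in the index of
the sequence. -/
theorem binomSeries_succ (r : ℤ) (a : ℕ → B) :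
    binomSeries (r + 1) a = binomSeries r a + PowerSeries.X * binomSeries r (fun k => a (k + 1)) := by
  ext k
  rw [map_add]
  cases k with
  | zero => simp
  | succ k =>
    rw [PowerSeries.coeff_succ_X_mul]
    simp only [coeff_binomSeries]
    rw [Ring.choose_succ_succ, add_smul, add_comm]

theorem coeff_binomSeries_mul (r s : ℤ) (a b : ℕ → B) (n : ℕ) :
    PowerSeries.coeff n (binomSeries r a * binomSeries s b) =
      ∑ x ∈ Finset.HasAntidiagonal.antidiagonal n,
        (Ring.choose r x.1 * Ring.choose s x.2) • (a x.1 * b x.2) := by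
  rw [PowerSeries.coeff_mul]
  refine Finset.sum_congr rfl fun x _ => ?_
  rw [coeff_binomSeries, coeff_binomSeries, smul_mul_smul_comm]

/-- The reversed product is summed over the same index pairs with the same binomial weights as in
`coeff_binomSeries_mul`, so that the two can be subtracted or added term by term. -/
theorem coeff_binomSeries_mul' (r s : ℤ) (a b : ℕ → B) (n : ℕ) :
    PowerSeries.coeff n (binomSeries s b * binomSeries r a) =
      ∑ x ∈ Finset.HasAntidiagonal.antidiagonal n,
        (Ring.choose r x.1 * Ring.choose s x.2) • (b x.2 * a x.1) := by
  rw [coeff_binomSeries_mul, ← Finset.Nat.sum_antidiagonal_swap]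
  refine Finset.sum_congr rfl fun x _ => ?_
  rw [Prod.fst_swap, Prod.snd_swap, mul_comm (Ring.choose s _)]

theorem coeff_lie_binomSeries (r s : ℤ) (a b : ℕ → B) (n : ℕ) :
    PowerSeries.coeff n ⁅binomSeries r a, binomSeries s b⁆ =
      ∑ x ∈ Finset.HasAntidiagonal.antidiagonal n,
        (Ring.choose r x.1 * Ring.choose s x.2) • ⁅a x.1, b x.2⁆ := by
  rw [Ring.lie_def, map_sub, coeff_binomSeries_mul, coeff_binomSeries_mul',
    ← Finset.sum_sub_distrib]
  simp only [Ring.lie_def, smul_sub]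

theorem lie_binomSeries_zero {a b : ℕ → B} (h : ∀ r s, ⁅a r, b s⁆ = 0) (r s : ℤ) :
    ⁅binomSeries r a, binomSeries s b⁆ = 0 := by
  ext n
  rw [coeff_lie_binomSeries]
  simp [h]

/-- On an antidiagonal all brackets equal the same `c n`, so the weights add up by the
Chu–Vandermonde identity for integer upper arguments. -/
theorem lie_binomSeries_add {a b c : ℕ → B} (h : ∀ r s, ⁅a r, b s⁆ = c (r + s)) (r s : ℤ) :
    ⁅binomSeries r a, binomSeries s b⁆ = binomSeries (r + s) c := by
  ext n
  rw [coeff_lie_binomSeries, coeff_binomSeries, Ring.add_choose_eq n (Commute.all r s),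
    Finset.sum_smul]
  refine Finset.sum_congr rfl fun x hx => ?_
  rw [h, Finset.HasAntidiagonal.mem_antidiagonal.1 hx]

theorem lie_C_binomSeries (y : B) (a : ℕ → B) (r : ℤ) :
    ⁅PowerSeries.C y, binomSeries r a⁆ = binomSeries r (fun k => ⁅y, a k⁆) := by
  ext n
  rw [Ring.lie_def, map_sub, PowerSeries.coeff_C_mul, PowerSeries.coeff_mul_C, coeff_binomSeries,
    coeff_binomSeries, Ring.lie_def, mul_smul_comm, smul_mul_assoc, smul_sub]

/-- Pascal's rule splits both raised series. The unshifted parts give the same bracket twice and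
cancel; the shifted parts carry a factor `X`, and to them the hypothesis applies coefficient by
coefficient. -/
theorem binomSeries_exchange [Algebra ℂ B] {ħ : B} {a a' : ℕ → B} {κ : ℂ}
    (h : ∀ r s, ⁅a (r + 1), a' s⁆ - ⁅a r, a' (s + 1)⁆ = κ • (ħ * (a r * a' s + a' s * a r)))
    (r s : ℤ) :
    ⁅binomSeries (r + 1) a, binomSeries s a'⁆ - ⁅binomSeries r a, binomSeries (s + 1) a'⁆ =
      PowerSeries.X * κ • (PowerSeries.C ħ * (binomSeries r a * binomSeries s a' +
        binomSeries s a' * binomSeries r a)) := by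
  have e : ⁅binomSeries (r + 1) a, binomSeries s a'⁆ - ⁅binomSeries r a, binomSeries (s + 1) a'⁆ =
      PowerSeries.X * (⁅binomSeries r (fun k => a (k + 1)), binomSeries s a'⁆ -
        ⁅binomSeries r a, binomSeries s (fun k => a' (k + 1))⁆) := by
    rw [binomSeries_succ, binomSeries_succ]
    have h1 : ∀ p q : PowerSeries B, p * (PowerSeries.X * q) = PowerSeries.X * (p * q) := by
      intro p q
      rw [← mul_assoc, (PowerSeries.commute_X p).eq, mul_assoc]
    simp only [Ring.lie_def, add_mul, mul_add, mul_sub, h1, mul_assoc]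
    abel
  rw [e]
  congr 1
  ext n
  rw [map_sub, PowerSeries.coeff_smul, PowerSeries.coeff_C_mul, map_add, coeff_lie_binomSeries,
    coeff_lie_binomSeries, coeff_binomSeries_mul, coeff_binomSeries_mul', ← Finset.sum_add_distrib,
    Finset.mul_sum, Finset.smul_sum, ← Finset.sum_sub_distrib]
  refine Finset.sum_congr rfl fun x _ => ?_
  rw [← smul_sub, h, ← smul_add, mul_smul_comm, smul_comm]

/-- Multiplication respects congruence modulo `X^(n+1)`; this allows infinite series to be replaced
by finite truncations inside iterated brackets. -/
theorem coeff_mul_congr {f f' g g' : PowerSeries B} {n : ℕ}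
    (hf : ∀ k ≤ n, PowerSeries.coeff k f = PowerSeries.coeff k f')
    (hg : ∀ k ≤ n, PowerSeries.coeff k g = PowerSeries.coeff k g') :
    ∀ k ≤ n, PowerSeries.coeff k (f * g) = PowerSeries.coeff k (f' * g') := by
  intro k hk
  rw [PowerSeries.coeff_mul, PowerSeries.coeff_mul]
  refine Finset.sum_congr rfl fun x hx => ?_
  have := Finset.HasAntidiagonal.mem_antidiagonal.1 hx
  rw [hf _ (by omega), hg _ (by omega)]

theorem coeff_foldr_lie_congr {ι : Type*} (l : List ι) {f f' : ι → PowerSeries B}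
    {g g' : PowerSeries B} {n : ℕ}
    (hf : ∀ i, ∀ k ≤ n, PowerSeries.coeff k (f i) = PowerSeries.coeff k (f' i))
    (hg : ∀ k ≤ n, PowerSeries.coeff k g = PowerSeries.coeff k g') :
    ∀ k ≤ n, PowerSeries.coeff k ((l.map f).foldr (fun a b => ⁅a, b⁆) g) =
      PowerSeries.coeff k ((l.map f').foldr (fun a b => ⁅a, b⁆) g') := by
  induction l with
  | nil => exact hg
  | cons i l ih =>
    intro k hk
    rw [List.map_cons, List.foldr_cons, List.map_cons, List.foldr_cons, Ring.lie_def, Ring.lie_def,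
      map_sub, map_sub, coeff_mul_congr (hf i) ih k hk, coeff_mul_congr ih (hf i) k hk]

theorem foldr_lie_map_C {ι : Type*} (l : List ι) (f : ι → B) (y : B) :
    (l.map fun i => PowerSeries.C (f i)).foldr (fun a b => ⁅a, b⁆) (PowerSeries.C y) =
      PowerSeries.C ((l.map f).foldr (fun a b => ⁅a, b⁆) y) := by
  induction l with
  | nil => rfl
  | cons i l ih =>
    rw [List.map_cons, List.foldr_cons, ih, List.map_cons, List.foldr_cons]
    simp only [Ring.lie_def, map_sub, map_mul]

/-- The Serre expression is multilinear over the center, but multilinearity expands only finite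
sums. The coefficient of `X^n` depends on the series modulo `X^(n+1)`, and there each one is a
finite sum of central multiples of the constants `a k`; the expansion then consists of multiples of
the given Serre relations. -/
theorem binomSeries_serre {m : ℕ} {a a' : ℕ → B}
    (h : ∀ (r : Fin m → ℕ) (s : ℕ), ∑ π : Equiv.Perm (Fin m),
      (List.ofFn fun k => a (r (π k))).foldr (fun a b => ⁅a, b⁆) (a' s) = 0)
    (r : Fin m → ℤ) (s : ℤ) :
    ∑ π : Equiv.Perm (Fin m),
      (List.ofFn fun k => binomSeries (r (π k)) a).foldr (fun a b => ⁅a, b⁆) (binomSeries s a')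
      = 0 := by
  ext n
  -- The variable is regarded as a central scalar, so that `binomial · X^k` can be pulled out of
  -- `serreMultilinear`.
  let C : Subring.center (PowerSeries B) :=
    ⟨PowerSeries.X, Subring.mem_center_iff.2 fun b => (PowerSeries.commute_X b).eq⟩
  let t : ℤ → (ℕ → B) → PowerSeries B := fun r a =>
    ∑ k ∈ Finset.range (n + 1),
      (((Ring.choose r k : ℤ) : Subring.center (PowerSeries B)) * C ^ k) • PowerSeries.C (a k)
  have ht : ∀ (r : ℤ) (a : ℕ → B), ∀ k ≤ n,
      PowerSeries.coeff k (binomSeries r a) = PowerSeries.coeff k (t r a) := by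
    intro r a k hk
    have e : ∀ j, (((Ring.choose r j : ℤ) : Subring.center (PowerSeries B)) * C ^ j) • PowerSeries.C (a j)
        = PowerSeries.monomial j (Ring.choose r j • a j) := by
      intro j
      rw [Subring.smul_def, smul_eq_mul]
      ext i
      have : (((Ring.choose r j : ℤ) : Subring.center (PowerSeries B)) * C ^ j : PowerSeries B) *
          PowerSeries.C (a j) = Ring.choose r j • (PowerSeries.X ^ j * PowerSeries.C (a j)) := by
        simp [C, zsmul_eq_mul, mul_assoc]
      push_cast at this ⊢
      rw [this, map_zsmul, PowerSeries.coeff_mul_C, PowerSeries.coeff_X_pow,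
        PowerSeries.coeff_monomial]
      split_ifs <;> simp
    simp only [t, e, map_sum, PowerSeries.coeff_monomial]
    rw [Finset.sum_ite_eq, if_pos (Finset.mem_range.2 (by omega)), coeff_binomSeries]
  have h' : ∀ (r : Fin m → ℕ) (s : ℕ), serreMultilinear (PowerSeries B) m
      (fun k => PowerSeries.C (a (r k))) (PowerSeries.C (a' s)) = 0 := by
    intro r s
    rw [serreMultilinear_apply]
    have := congrArg PowerSeries.C (h r s)
    rw [map_sum, map_zero] at this
    rw [← this]
    refine Finset.sum_congr rfl fun π _ => ?_
    rw [List.ofFn_eq_map, List.ofFn_eq_map, foldr_lie_map_C]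
  -- The truncations satisfy the relation exactly, not only modulo `X^(n+1)`.
  have key : ∑ π : Equiv.Perm (Fin m),
      (List.ofFn fun k => t (r (π k)) a).foldr (fun a b => ⁅a, b⁆) (t s a') = 0 := by
    rw [← serreMultilinear_apply (fun k => t (r k) a)]
    simp only [t]
    rw [MultilinearMap.map_sum_finset, LinearMap.sum_apply]
    refine Finset.sum_eq_zero fun u _ => ?_
    rw [MultilinearMap.map_smul_univ, map_sum]
    refine Finset.sum_eq_zero fun l _ => ?_
    rw [LinearMap.smul_apply, map_smul, h', smul_zero, smul_zero]
  rw [← key, map_sum, map_sum]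
  refine Finset.sum_congr rfl fun π _ => ?_
  rw [List.ofFn_eq_map, List.ofFn_eq_map]
  exact coeff_foldr_lie_congr _ (fun i => ht _ _) (ht _ _) n le_rfl

end BinomialSeries

/-! ### The same relations for Laurent series in `z^{-1}`. -/

section LaurentShift

variable {B : Type*} [Ring B]

/-- `∑_k (r choose k) a_k z^{r-k}`; the coefficient of `z^{-m}` is indexed by `m`. -/
noncomputable def laurentShift (r : ℤ) (a : ℕ → B) : HahnSeries ℤ B :=
  HahnSeries.single (-r) 1 * HahnSeries.ofPowerSeries ℤ B (binomSeries r a)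

theorem single_one_comm (r : ℤ) (f : HahnSeries ℤ B) :
    HahnSeries.single r 1 * f = f * HahnSeries.single r 1 := by
  ext a
  obtain ⟨b, rfl⟩ : ∃ b, a = b + r := ⟨a - r, by omega⟩
  rw [HahnSeries.coeff_single_mul_add, HahnSeries.coeff_mul_single_add, one_mul, mul_one]

theorem ofPowerSeries_coeff_of_neg (f : PowerSeries B) {m : ℤ} (hm : m < 0) :
    (HahnSeries.ofPowerSeries ℤ B f).coeff m = 0 := by
  rw [HahnSeries.ofPowerSeries_apply]
  refine HahnSeries.embDomain_of_notMem_range ?_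
  rintro ⟨n, hn⟩
  simp at hn
  omega

theorem coeff_single_mul_ofPowerSeries (r : ℤ) (p : PowerSeries B) (k : ℕ) :
    (HahnSeries.single (-r) 1 * HahnSeries.ofPowerSeries ℤ B p).coeff (k - r) =
      PowerSeries.coeff k p := by
  rw [sub_eq_add_neg, HahnSeries.coeff_single_mul_add, one_mul]
  exact HahnSeries.ofPowerSeries_apply_coeff _ _

theorem coeff_single_mul_ofPowerSeries_of_neg (r : ℤ) (p : PowerSeries B)
    {m : ℤ} (hm : m + r < 0) :
    (HahnSeries.single (-r) 1 * HahnSeries.ofPowerSeries ℤ B p).coeff m = 0 := by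
  have : m = (m + r) + (-r) := by omega
  rw [this, HahnSeries.coeff_single_mul_add, one_mul, ofPowerSeries_coeff_of_neg _ hm]

theorem coeff_laurentShift (r : ℤ) (a : ℕ → B) (k : ℕ) :
    (laurentShift r a).coeff (k - r) = Ring.choose r k • a k := by
  rw [laurentShift, coeff_single_mul_ofPowerSeries, coeff_binomSeries]

theorem coeff_laurentShift_of_neg (r : ℤ) (a : ℕ → B) {m : ℤ} (hm : m + r < 0) :
    (laurentShift r a).coeff m = 0 :=
  coeff_single_mul_ofPowerSeries_of_neg _ _ hm

theorem laurentShift_zero (a : ℕ → B) : laurentShift 0 a = HahnSeries.C (a 0) := by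
  rw [laurentShift, binomSeries_zero, HahnSeries.ofPowerSeries_C, neg_zero]
  exact one_mul _

theorem single_mul_mul_single_mul (r s : ℤ) (f g : HahnSeries ℤ B) :
    (HahnSeries.single r 1 * f) * (HahnSeries.single s 1 * g) =
      HahnSeries.single (r + s) 1 * (f * g) := by
  rw [mul_assoc, ← mul_assoc f, ← single_one_comm s f, mul_assoc, ← mul_assoc,
    HahnSeries.single_mul_single, one_mul]

theorem lie_single_mul_single_mul (r s : ℤ) (f g : HahnSeries ℤ B) :
    ⁅HahnSeries.single r 1 * f, HahnSeries.single s 1 * g⁆ =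
      HahnSeries.single (r + s) 1 * ⁅f, g⁆ := by
  rw [Ring.lie_def, Ring.lie_def, single_mul_mul_single_mul, single_mul_mul_single_mul, mul_sub,
    add_comm s r]

theorem ofPowerSeries_lie (f g : PowerSeries B) :
    HahnSeries.ofPowerSeries ℤ B ⁅f, g⁆ =
      ⁅HahnSeries.ofPowerSeries ℤ B f, HahnSeries.ofPowerSeries ℤ B g⁆ := by
  simp only [Ring.lie_def, map_sub, map_mul]

/-- Powers of `z` are central, so they can be collected in front, and each bracket is computed among
power series in `z^{-1}`. -/
theorem lie_laurentShift (r s : ℤ) (a b : ℕ → B) :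
    ⁅laurentShift r a, laurentShift s b⁆ =
      HahnSeries.single (-r + -s) 1 *
        HahnSeries.ofPowerSeries ℤ B ⁅binomSeries r a, binomSeries s b⁆ := by
  rw [laurentShift, laurentShift, lie_single_mul_single_mul, ofPowerSeries_lie]

theorem lie_laurentShift_zero {a b : ℕ → B} (h : ∀ r s, ⁅a r, b s⁆ = 0) (r s : ℤ) :
    ⁅laurentShift r a, laurentShift s b⁆ = 0 := by
  rw [lie_laurentShift, lie_binomSeries_zero h, map_zero, mul_zero]

theorem lie_laurentShift_add {a b c : ℕ → B} (h : ∀ r s, ⁅a r, b s⁆ = c (r + s)) (r s : ℤ) :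
    ⁅laurentShift r a, laurentShift s b⁆ = laurentShift (r + s) c := by
  rw [lie_laurentShift, lie_binomSeries_add h, laurentShift, neg_add]

theorem lie_C_laurentShift (y : B) (a : ℕ → B) (r : ℤ) :
    ⁅(HahnSeries.C y : HahnSeries ℤ B), laurentShift r a⁆ = laurentShift r (fun k => ⁅y, a k⁆) := by
  rw [laurentShift, laurentShift, ← lie_C_binomSeries, ofPowerSeries_lie,
    HahnSeries.ofPowerSeries_C]
  have := lie_single_mul_single_mul 0 (-r) (HahnSeries.C y)
    (HahnSeries.ofPowerSeries ℤ B (binomSeries r a))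
  rwa [zero_add, show HahnSeries.single (0 : ℤ) (1 : B) = 1 from rfl, one_mul] at this

theorem laurentShift_exchange [Algebra ℂ B] {ħ : B} {a a' : ℕ → B} {κ : ℂ}
    (h : ∀ r s, ⁅a (r + 1), a' s⁆ - ⁅a r, a' (s + 1)⁆ = κ • (ħ * (a r * a' s + a' s * a r)))
    (r s : ℤ) :
    ⁅laurentShift (r + 1) a, laurentShift s a'⁆ - ⁅laurentShift r a, laurentShift (s + 1) a'⁆ =
      κ • (HahnSeries.C ħ * (laurentShift r a * laurentShift s a' +
        laurentShift s a' * laurentShift r a)) := by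
  have hs : ∀ f : PowerSeries B, HahnSeries.ofPowerSeries ℤ B (κ • f) =
      κ • HahnSeries.ofPowerSeries ℤ B f := fun f =>
    map_smul (HahnSeries.ofPowerSeriesAlg ℤ (A := B) ℂ) κ f
  -- Both brackets carry the prefactor `z^{r+s+1}`. The factor `X` from `binomSeries_exchange` is
  -- `z^{-1}` and lowers it to the `z^{r+s}` of the right-hand side.
  rw [lie_laurentShift, lie_laurentShift, show -r + -(s + 1) = -(r + 1) + -s by ring, ← mul_sub,
    ← map_sub, binomSeries_exchange h, map_mul, HahnSeries.ofPowerSeries_X, ← mul_assoc,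
    HahnSeries.single_mul_single, one_mul, hs, map_mul, HahnSeries.ofPowerSeries_C, map_add,
    map_mul, map_mul, mul_smul_comm, show -(r + 1) + -s + 1 = -r + -s by ring]
  congr 1
  rw [laurentShift, laurentShift, single_mul_mul_single_mul, single_mul_mul_single_mul,
    add_comm (-s) (-r), ← mul_add, ← mul_assoc, ← mul_assoc, single_one_comm]

theorem foldr_lie_single_mul {ι : Type*} (l : List ι) (r : ι → ℤ) (f : ι → PowerSeries B)
    (s : ℤ) (g : PowerSeries B) :
    (l.map fun i => HahnSeries.single (r i) 1 * HahnSeries.ofPowerSeries ℤ B (f i)).foldr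
        (fun a b => ⁅a, b⁆) (HahnSeries.single s 1 * HahnSeries.ofPowerSeries ℤ B g) =
      HahnSeries.single ((l.map r).sum + s) 1 *
        HahnSeries.ofPowerSeries ℤ B ((l.map f).foldr (fun a b => ⁅a, b⁆) g) := by
  induction l with
  | nil => simp
  | cons i l ih =>
    simp only [List.map_cons, List.foldr_cons, List.sum_cons]
    rw [ih, lie_single_mul_single_mul, ofPowerSeries_lie, add_assoc]

/-- Each permutation contributes the same power of `z`, with exponent the sum of all `r k` and `s`,
so the identity is a multiple of `binomSeries_serre`. -/
theorem laurentShift_serre {m : ℕ} {a a' : ℕ → B}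
    (h : ∀ (r : Fin m → ℕ) (s : ℕ), ∑ π : Equiv.Perm (Fin m),
      (List.ofFn fun k => a (r (π k))).foldr (fun a b => ⁅a, b⁆) (a' s) = 0)
    (r : Fin m → ℤ) (s : ℤ) :
    ∑ π : Equiv.Perm (Fin m),
      (List.ofFn fun k => laurentShift (r (π k)) a).foldr (fun a b => ⁅a, b⁆) (laurentShift s a')
      = 0 := by
  have := congrArg (fun f => HahnSeries.single (∑ k, -r k + -s) 1 *
    HahnSeries.ofPowerSeries ℤ B f) (binomSeries_serre h r s)
  simp only [map_sum, map_zero, mul_zero, Finset.mul_sum] at this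
  rw [← this]
  refine Finset.sum_congr rfl fun π _ => ?_
  rw [List.ofFn_eq_map, List.ofFn_eq_map]
  simp only [laurentShift]
  rw [foldr_lie_single_mul, ← List.ofFn_eq_map, List.sum_ofFn,
    Equiv.sum_comp π (fun k => -r k)]

end LaurentShift

/-! ### Evaluation of power series at `ħ` in an `ħ`-adic completion. -/

section SeriesEval

variable {F A : Type*} [Ring F] [Ring A] [Algebra ℂ[X] A] (φ : F →+* A)

/-- `∑_k f_k t^k ↦ ∑_k φ(f_k) ħ^k` on polynomials. -/
noncomputable def polyEval : Polynomial F →+* A :=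
  Polynomial.eval₂RingHom' φ (hb A) fun _ => (Algebra.commutes _ _).symm

theorem polyEval_C (a : F) : polyEval φ (Polynomial.C a) = φ a := Polynomial.eval₂_C _ _

theorem polyEval_X : polyEval φ Polynomial.X = hb A := Polynomial.eval₂_X _ _

/-- The difference is divisible by `X^n`, and `X` is evaluated at `ħ`. Consequently the truncations
used by `seriesEval` are compatible and multiplicative modulo `ħ^n`. -/
theorem mk_polyEval_congr {n : ℕ} {p q : Polynomial F} (h : ∀ k < n, p.coeff k = q.coeff k) :
    Ideal.Quotient.mk (hIdeal A n) (polyEval φ p) = Ideal.Quotient.mk (hIdeal A n) (polyEval φ q) := by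
  obtain ⟨r, hr⟩ : (Polynomial.X ^ n : Polynomial F) ∣ p - q :=
    Polynomial.X_pow_dvd_iff.2 fun k hk => by rw [Polynomial.coeff_sub, h k hk, sub_self]
  refine Ideal.Quotient.eq.2 ⟨polyEval φ r, ?_⟩
  rw [← map_sub, hr, map_mul, map_pow, polyEval_X]

/-- `∑_k f_k t^k ↦ ∑_k φ(f_k) ħ^k`, with values in the `ħ`-adic completion. -/
noncomputable def seriesEval : PowerSeries F →+* HCompletion A where
  toFun f := ⟨fun n => Ideal.Quotient.mk (hIdeal A n) (polyEval φ (PowerSeries.trunc n f)),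
    fun m n h => by
      rw [Ideal.Quotient.factor_mk]
      refine mk_polyEval_congr φ fun k hk => ?_
      rw [PowerSeries.coeff_trunc, PowerSeries.coeff_trunc, if_pos hk, if_pos (by omega)]⟩
  map_zero' := Subtype.ext (funext fun n => by simp; rfl)
  map_one' := Subtype.ext (funext fun n => by
    change _ = Ideal.Quotient.mk (hIdeal A n) 1
    rw [← map_one (polyEval φ)]
    refine mk_polyEval_congr φ fun k hk => ?_
    rw [PowerSeries.coeff_trunc, if_pos hk, PowerSeries.coeff_one, Polynomial.coeff_one])
  map_add' p q := Subtype.ext (funext fun n => by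
    change _ = Ideal.Quotient.mk (hIdeal A n) _ + Ideal.Quotient.mk (hIdeal A n) _
    rw [← map_add, ← map_add, ← map_add])
  map_mul' p q := Subtype.ext (funext fun n => by
    change _ = Ideal.Quotient.mk (hIdeal A n) _ * Ideal.Quotient.mk (hIdeal A n) _
    rw [← map_mul, ← map_mul]
    refine mk_polyEval_congr φ fun k hk => ?_
    rw [PowerSeries.coeff_trunc, if_pos hk, PowerSeries.coeff_mul, Polynomial.coeff_mul]
    refine Finset.sum_congr rfl fun x hx => ?_
    have := Finset.HasAntidiagonal.mem_antidiagonal.1 hx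
    rw [PowerSeries.coeff_trunc, PowerSeries.coeff_trunc, if_pos (by omega), if_pos (by omega)])

theorem HCompletion.ext {x y : HCompletion A}
    (h : ∀ n, HCompletion.eval A n x = HCompletion.eval A n y) : x = y :=
  Subtype.ext (funext h)

theorem eval_of (n : ℕ) (a : A) :
    HCompletion.eval A n (HCompletion.of A a) = Ideal.Quotient.mk (hIdeal A n) a := rfl

theorem seriesEval_coe (p : Polynomial F) :
    seriesEval φ (p : PowerSeries F) = HCompletion.of A (polyEval φ p) :=
  HCompletion.ext fun n => mk_polyEval_congr φ fun k hk => by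
    rw [PowerSeries.coeff_trunc, if_pos hk, Polynomial.coeff_coe]

theorem seriesEval_C (a : F) : seriesEval φ (PowerSeries.C a) = HCompletion.of A (φ a) := by
  rw [← Polynomial.coe_C, seriesEval_coe, polyEval_C]

theorem seriesEval_X : seriesEval φ PowerSeries.X = HCompletion.of A (hb A) := by
  rw [← Polynomial.coe_X, seriesEval_coe, polyEval_X]

/-- The source of separatedness: an element divisible by every power of `ħ` vanishes in every
quotient, hence is zero. -/
theorem eval_of_hb_pow (n : ℕ) (x : HCompletion A) :
    HCompletion.eval A n (HCompletion.of A (hb A) ^ n * x) = 0 := by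
  rw [map_mul, map_pow, eval_of, ← map_pow]
  have : Ideal.Quotient.mk (hIdeal A n) (hb A ^ n) = 0 :=
    Ideal.Quotient.eq_zero_iff_mem.2 ⟨1, (mul_one _).symm⟩
  rw [this, zero_mul]

theorem algebraMap_polynomial_HCompletion (p : ℂ[X]) :
    algebraMap ℂ⟦X⟧ (HCompletion A) (p : ℂ⟦X⟧) = HCompletion.of A (algebraMap ℂ[X] A p) :=
  HCompletion.ext fun n => mk_hIdeal_eq_of_coeff fun k hk => by
    rw [PowerSeries.coeff_trunc, if_pos hk, Polynomial.coeff_coe]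

theorem algebraMap_X_HCompletion :
    algebraMap ℂ⟦X⟧ (HCompletion A) PowerSeries.X = HCompletion.of A (hb A) := by
  rw [← Polynomial.coe_X, algebraMap_polynomial_HCompletion]

end SeriesEval

/-! ### The universal property of the Yangian double. -/

section DYangianLift

variable {I 𝔥 : Type*} [Fintype I] [AddCommGroup 𝔥] [Module ℂ 𝔥] (D : KacMoodyDatum I 𝔥)
  {A : Type*} [Ring A] [Algebra ℂ A] [Algebra ℂ[X] A]

-- The equality is tested modulo each `ħ^n`. The composite with the projection is a homomorphism of
-- `ℂ`-algebras sending the variable to `ħ` and the free generators to `g`, so it carries each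
-- formal relation to a relation among the `g`.
variable {D} in
theorem seriesEval_eq_of_rel {g : YGen I 𝔥 ℤ → A} (hg : YSat D ℤ (hb A) g) {a b : DYFree I 𝔥}
    (h : YRel D ℤ PowerSeries.X (fun x => PowerSeries.C (FreeAlgebra.ι ℂ x)) a b) :
    seriesEval (FreeAlgebra.lift ℂ g).toRingHom a = seriesEval (FreeAlgebra.lift ℂ g).toRingHom b := by
  refine HCompletion.ext fun n => ?_
  let ψ : DYFree I 𝔥 →ₐ[ℂ] A ⧸ hIdeal A n :=
    { (HCompletion.eval A n).comp (seriesEval (FreeAlgebra.lift ℂ g).toRingHom) with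
      commutes' := fun c => by
        change HCompletion.eval A n (seriesEval (FreeAlgebra.lift ℂ g).toRingHom _) = _
        rw [PowerSeries.algebraMap_apply, seriesEval_C, eval_of]
        exact congrArg _ ((FreeAlgebra.lift ℂ g).commutes c) }
  have h1 := h.map ψ
  change ψ a = ψ b
  refine (hg.map (Ideal.Quotient.mkₐ ℂ (hIdeal A n))) ?_
  -- Two identifications remain: the images under `ψ` of the variable and of the free generators.
  convert h1 using 1
  · exact congrArg (HCompletion.eval A n) (seriesEval_X (FreeAlgebra.lift ℂ g).toRingHom).symm
  · ext x
    refine Eq.trans ?_ (congrArg (HCompletion.eval A n)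
      (seriesEval_C (FreeAlgebra.lift ℂ g).toRingHom _).symm)
    rw [eval_of]
    exact congrArg _ (FreeAlgebra.lift_ι_apply g x).symm

-- An element of the closure differs from the ideal of relations by a multiple of `ħ^n`, for every
-- `n`. Its image therefore dies modulo every `ħ^n`, which is enough in a separated target.
variable {D} in
theorem seriesEval_eq_zero_of_mem {g : YGen I 𝔥 ℤ → A} (hg : YSat D ℤ (hb A) g) {a : DYFree I 𝔥}
    (ha : a ∈ DYClosedIdeal D) : seriesEval (FreeAlgebra.lift ℂ g).toRingHom a = 0 := by
  have hle : DYRelIdeal D ≤ TwoSidedIdeal.ker (seriesEval (FreeAlgebra.lift ℂ g).toRingHom) := by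
    refine TwoSidedIdeal.span_le.2 ?_
    rintro _ ⟨a, b, hab, rfl⟩
    refine (TwoSidedIdeal.mem_ker _).2 ?_
    rw [map_sub, seriesEval_eq_of_rel hg hab, sub_self]
  refine HCompletion.ext fun n => ?_
  obtain ⟨j, hj, f, rfl⟩ := ha n
  have hj0 : seriesEval (FreeAlgebra.lift ℂ g).toRingHom j = 0 := (TwoSidedIdeal.mem_ker _).1 (hle hj)
  rw [map_add, hj0, zero_add, map_mul, map_pow, seriesEval_X, eval_of_hb_pow, map_zero]

variable [IsScalarTower ℂ ℂ[X] A]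

/-- A family satisfying the relations in a `ℂ[ħ]`-algebra `A` defines a homomorphism from the
Yangian double to the `ħ`-adic completion of `A`. -/
noncomputable def DYangian.lift (g : YGen I 𝔥 ℤ → A) (hg : YSat D ℤ (hb A) g) :
    DYangian D →ₐ[ℂ⟦X⟧] HCompletion A :=
  { Ideal.Quotient.lift (DYClosedIdeal D) (seriesEval (FreeAlgebra.lift ℂ g).toRingHom)
      fun _ ha => seriesEval_eq_zero_of_mem hg ha with
    commutes' := fun p => by
      refine (Ideal.Quotient.lift_mk _ _ _).trans (HCompletion.ext fun n => ?_)
      change Ideal.Quotient.mk (hIdeal A n) _ =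
        Ideal.Quotient.mk (hIdeal A n) (algebraMap ℂ[X] A (PowerSeries.trunc n p))
      -- Modulo `ħ^n` a scalar series acts through its truncation, so linearity over `ℂ⟦ħ⟧` reduces
      -- to this statement on polynomials.
      have e : ∀ q : ℂ[X], algebraMap ℂ[X] A q = polyEval (FreeAlgebra.lift ℂ g).toRingHom
          (q.map (algebraMap ℂ (FreeAlgebra ℂ (YGen I 𝔥 ℤ)))) := by
        intro q
        induction q using Polynomial.induction_on' with
        | add p q hp hq => rw [map_add, hp, hq, Polynomial.map_add, map_add]
        | monomial n c =>
          rw [← Polynomial.C_mul_X_pow_eq_monomial, Polynomial.map_mul, Polynomial.map_pow,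
            Polynomial.map_X, Polynomial.map_C, map_mul, map_mul, map_pow, map_pow, polyEval_X,
            polyEval_C, ← Polynomial.algebraMap_eq, ← IsScalarTower.algebraMap_apply]
          congr 1
          exact ((FreeAlgebra.lift ℂ g).commutes c).symm
      rw [e]
      refine mk_polyEval_congr _ fun k hk => ?_
      rw [PowerSeries.coeff_trunc, if_pos hk, Polynomial.coeff_map, PowerSeries.coeff_trunc,
        if_pos hk, PowerSeries.coeff_map] }

theorem DYangian.lift_gen (g : YGen I 𝔥 ℤ → A) (hg : YSat D ℤ (hb A) g) (x : YGen I 𝔥 ℤ) :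
    DYangian.lift D g hg (DYangian.gen D x) = HCompletion.of A (g x) := by
  refine (Ideal.Quotient.lift_mk _ _ _).trans ((seriesEval_C _ _).trans ?_)
  exact congrArg _ (FreeAlgebra.lift_ι_apply g x)

theorem YForm.mk_surjective (K : Type*) [AddMonoidWithOne K] :
    Function.Surjective (YForm.mk D (K := K)) := RingQuot.mkAlgHom_surjective _ _

/-- Stated for ring homomorphisms, with agreement on scalars as a separate hypothesis, because
`polyToLForm` and `evForm` are bare ring homomorphisms. -/
theorem YForm.ringHom_ext {K : Type*} [AddMonoidWithOne K] {B : Type*} [Ring B]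
    {f f' : YForm D K →+* B}
    (h : ∀ x, f (YForm.gen D x) = f' (YForm.gen D x))
    (h' : ∀ p : ℂ[X], f (algebraMap ℂ[X] _ p) = f' (algebraMap ℂ[X] _ p)) (y : YForm D K) :
    f y = f' y := by
  obtain ⟨y, rfl⟩ := YForm.mk_surjective D K y
  induction y using FreeAlgebra.induction with
  | grade0 p => rw [AlgHom.commutes, h']
  | grade1 x => exact h x
  | mul a b ha hb => simp only [map_mul, ha, hb]
  | add a b ha hb => simp only [map_add, ha, hb]

theorem DYangian.lift_jMap (g : YGen I 𝔥 ℤ → A) (hg : YSat D ℤ (hb A) g) (x : DYangianForm D) :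
    DYangian.lift D g hg (jMap D x) = HCompletion.of A (YForm.lift D g hg x) := by
  refine YForm.ringHom_ext D
    (f := (DYangian.lift D g hg).toRingHom.comp (jMap D).toRingHom)
    (f' := (HCompletion.of A).comp (YForm.lift D g hg).toRingHom) (fun x => ?_) (fun p => ?_) x
  · change DYangian.lift D g hg (jMap D (YForm.gen D x)) =
      HCompletion.of A (YForm.lift D g hg (YForm.gen D x))
    rw [jMap, YForm.lift_gen, YForm.lift_gen, DYangian.lift_gen]
  · change DYangian.lift D g hg (jMap D (algebraMap _ _ p)) =
      HCompletion.of A (YForm.lift D g hg (algebraMap _ _ p))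
    rw [AlgHom.commutes, AlgHom.commutes, ← algebraMap_polynomial_HCompletion]
    exact (DYangian.lift D g hg).commutes _

end DYangianLift

/-! ### The images of the generators, and the construction of `Φ_z`. -/

section LaurentGenerators

variable {I 𝔥 : Type*} [Fintype I] [AddCommGroup 𝔥] [Module ℂ 𝔥] (D : KacMoodyDatum I 𝔥)

/-- `h ↦ h`, `h_{ir} ↦ ∑_k (r choose k) h_{ik} z^{r-k}`, `x_{ir}^± ↦ ∑_k (r choose k) x_{ik}^± z^{r-k}`
for `r ∈ ℤ`. -/
noncomputable def laurentGen {B : Type*} [Ring B] (g : YGen I 𝔥 ℕ → B) :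
    YGen I 𝔥 ℤ → HahnSeries ℤ B
  | .cartan a => HahnSeries.C (g (.cartan a))
  | .h i r => laurentShift r (fun k => g (.h i k))
  | .x ε i r => laurentShift r (fun k => g (.x ε i k))

theorem lie_comm_eq_zero {B : Type*} [Ring B] {a b : B} (h : ⁅a, b⁆ = 0) : ⁅b, a⁆ = 0 := by
  rw [Ring.lie_def, sub_eq_zero] at *
  exact h.symm

-- This is the existence half of the theorem: relations with natural indices propagate to all
-- integer indices under the formal shift.
variable {D} in
theorem YSat.laurent {B : Type*} [Ring B] [Algebra ℂ B] {ħ : B}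
    {g : YGen I 𝔥 ℕ → B} (hg : YSat D ℕ ħ g) :
    YSat D ℤ (HahnSeries.C ħ : HahnSeries ℤ B) (laurentGen g) := by
  have hs : ∀ (c : ℂ) (b : B), (HahnSeries.C (c • b) : HahnSeries ℤ B) = c • HahnSeries.C b := by
    intro c b
    ext a
    rw [HahnSeries.coeff_smul, HahnSeries.C_apply, HahnSeries.C_apply, HahnSeries.coeff_single,
      HahnSeries.coeff_single]
    split_ifs <;> simp
  intro a b hab
  cases hab with
  | cartan_add a b => simp only [laurentGen]; rw [hg (.cartan_add a b), map_add]
  | cartan_smul z a => simp only [laurentGen]; rw [hg (.cartan_smul z a), hs]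
  | h_zero i => simp only [laurentGen]; rw [laurentShift_zero, hg (.h_zero i), hs]
  | h_h i j r s => exact lie_laurentShift_zero (fun r s => hg (.h_h i j r s)) r s
  | h_cartan i r a =>
    simp only [laurentGen]
    -- The bracket is reversed because `lie_C_laurentShift` expects the constant on the left.
    refine lie_comm_eq_zero ?_
    rw [lie_C_laurentShift]
    have : (fun k => ⁅g (.cartan a), g (.h i k)⁆) = fun _ => 0 :=
      funext fun k => lie_comm_eq_zero (hg (.h_cartan i k a))
    rw [this, laurentShift]
    have : binomSeries r (fun _ => (0 : B)) = 0 := by ext; simp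
    rw [this, map_zero, mul_zero]
  | cartan_cartan a b =>
    simp only [laurentGen]
    rw [Ring.lie_def, ← map_mul, ← map_mul, ← map_sub, ← Ring.lie_def, hg (.cartan_cartan a b),
      map_zero]
  | cartan_x ε j s a =>
    simp only [laurentGen]
    rw [lie_C_laurentShift]
    have : (fun k => ⁅g (.cartan a), g (.x ε j k)⁆) =
        fun k => (((ε : ℤ) : ℂ) * D.root j a) • g (.x ε j k) :=
      funext fun k => hg (.cartan_x ε j k a)
    rw [this, laurentShift, laurentShift, ← mul_smul_comm]
    congr 1
    refine Eq.trans ?_ (map_smul (HahnSeries.ofPowerSeriesAlg ℤ (A := B) ℂ) _ _)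
    refine congrArg (HahnSeries.ofPowerSeries ℤ B) (PowerSeries.ext fun k => ?_)
    rw [coeff_binomSeries, PowerSeries.coeff_smul, coeff_binomSeries, smul_comm]
  | x_x_same i r s =>
    exact lie_laurentShift_add (c := fun k => g (.h i k)) (fun r s => hg (.x_x_same i r s)) r s
  | x_x_ne i j hij r s => exact lie_laurentShift_zero (fun r s => hg (.x_x_ne i j hij r s)) r s
  | h_x ε i j r s => exact laurentShift_exchange (fun r s => hg (.h_x ε i j r s)) r s
  | x_x ε i j r s => exact laurentShift_exchange (fun r s => hg (.x_x ε i j r s)) r s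
  | serre ε i j hij r s => exact laurentShift_serre (fun r s => hg (.serre ε i j hij r s)) r s

theorem mem_LPiece_of_nat {f : YLaurent D} {n : ℤ} (h : ∀ m, m + n < 0 → f.coeff m = 0)
    (h' : ∀ k : ℕ, f.coeff (k - n) ∈ Yangian.degree D k) : f ∈ LPiece D n := by
  intro k
  by_cases hk : k < 0
  · rw [h _ (by omega)]
    exact zero_mem _
  · obtain ⟨k, rfl⟩ := Int.eq_ofNat_of_zero_le (not_lt.1 hk)
    exact h' k

/-- The coefficient of `z^{r-k}` is an integer multiple of `a k`, of degree `k`, so every term has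
total degree `r`. -/
theorem laurentShift_mem_LPiece (r : ℤ) {a : ℕ → Yangian D} (ha : ∀ k : ℕ, a k ∈ Yangian.degree D k) :
    laurentShift r a ∈ LPiece D r :=
  mem_LPiece_of_nat D (fun _ hm => coeff_laurentShift_of_neg r a hm) fun k => by
    rw [coeff_laurentShift]
    exact zsmul_mem (ha k) _

theorem laurentGen_mem_LPiece (x : YGen I 𝔥 ℤ) : laurentGen (YForm.gen D) x ∈ LPiece D x.deg := by
  cases x with
  | cartan a =>
    have := LPiece.single_mem D (Yangian.gen_mem_degree D (.cartan a : YGen I 𝔥 ℕ)) 0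
    rwa [sub_zero] at this
  | h i r => exact laurentShift_mem_LPiece D r fun k => Yangian.gen_mem_degree D (.h i k)
  | x ε i r => exact laurentShift_mem_LPiece D r fun k => Yangian.gen_mem_degree D (.x ε i k)

/-- The images of the generators of the Yangian double in `⨁_n z^n ∏_k (Y_ħ𝔤)_k z^{-k}`. -/
noncomputable def LForm.gen (x : YGen I 𝔥 ℤ) : LForm D :=
  ⟨laurentGen (YForm.gen D) x, LPiece.mem_LForm D (laurentGen_mem_LPiece D x)⟩

/-- The relations hold among Laurent series, and the inclusion of the subalgebra reflects them. -/
theorem LForm.sat : YSat D ℤ (hb (LForm D)) (LForm.gen D) :=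
  YSat.of_injective ((LForm D).val.restrictScalars ℂ) Subtype.val_injective (YForm.sat D).laurent

/-- The homomorphism `Φ_z`. -/
noncomputable def PhiZ : DYangian D →ₐ[ℂ⟦X⟧] LHat D := DYangian.lift D (LForm.gen D) (LForm.sat D)

/-- The homomorphism `Φ_z ∘ ȷ`. -/
noncomputable def phiForm : DYangianForm D →ₐ[ℂ[X]] LForm D :=
  YForm.lift D (LForm.gen D) (LForm.sat D)

/-- A graded component is spanned by monomials in `ħ` and the generators. Each factor is sent to the
piece of its own degree, and degrees add under products. -/
theorem phiForm_mem_LPiece (n : ℤ) {x : DYangianForm D} (hx : x ∈ DYangianForm.degree D n) :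
    (phiForm D x : YLaurent D) ∈ LPiece D n := by
  let f : DYangianForm D →ₐ[ℂ] YLaurent D := ((LForm D).val.comp (phiForm D)).restrictScalars ℂ
  change x ∈ (LPiece D n).comap f.toLinearMap
  refine (Submodule.span_le.2 ?_) hx
  rintro _ ⟨a, l, rfl, rfl⟩
  change f _ ∈ LPiece D _
  rw [map_mul, map_pow, map_list_prod, List.map_map]
  refine SetLike.GradedMul.mul_mem ?_ ?_
  · have h1 : f (hb (DYangianForm D)) ∈ LPiece D 1 := by
      have : f (hb (DYangianForm D)) = HahnSeries.single 0 (hb (Yangian D)) :=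
        ((LForm D).val.comp (phiForm D)).commutes _
      rw [this]
      simpa using LPiece.single_mem D (by simpa using Yangian.hb_pow_mem_degree D 1) (0 : ℤ)
    simpa using SetLike.pow_mem_graded a h1
  · refine SetLike.list_prod_map_mem_graded _ _ _ fun x _ => ?_
    have : f (YForm.gen D x) = laurentGen (YForm.gen D) x :=
      congrArg Subtype.val (YForm.lift_gen D _ (LForm.sat D) x)
    rw [Function.comp_apply, this]
    exact laurentGen_mem_LPiece D x

end LaurentGenerators

/-! ### When a homomorphism from the Yangian double is determined by its restriction along `ι`. -/

section Extensionality

variable {I 𝔥 : Type*} [Fintype I] [AddCommGroup 𝔥] [Module ℂ 𝔥] {D : KacMoodyDatum I 𝔥}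
  {B : Type*} [Ring B] [Algebra ℂ⟦X⟧ B]

theorem DYangian.mk_surjective : Function.Surjective (DYangian.mk D) :=
  Ideal.Quotient.mk_surjective

theorem DYangian.mk_X :
    DYangian.mk D PowerSeries.X = algebraMap ℂ⟦X⟧ (DYangian D) PowerSeries.X := by
  change _ = DYangian.mk D (PowerSeries.map (algebraMap ℂ _) PowerSeries.X)
  rw [PowerSeries.map_X]

theorem DYangian.mk_C_algebraMap (c : ℂ) : DYangian.mk D (PowerSeries.C (algebraMap ℂ _ c)) =
    algebraMap ℂ⟦X⟧ (DYangian D) (PowerSeries.C c) := by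
  change _ = DYangian.mk D (PowerSeries.map (algebraMap ℂ _) (PowerSeries.C c))
  rw [PowerSeries.map_C]

theorem DYangian.hb_eq : hb (DYangian D) = algebraMap ℂ⟦X⟧ (DYangian D) PowerSeries.X := by
  rw [← Polynomial.coe_X]
  rfl

theorem DYangian.smul_eq (c : ℂ) (x : DYangian D) :
    c • x = algebraMap ℂ⟦X⟧ (DYangian D) (PowerSeries.C c) * x := by
  rw [Algebra.smul_def, ← Polynomial.coe_C]
  rfl

/-- Homomorphisms from the Yangian double to an `ħ`-adically separated algebra are determined by
their values on the generators. -/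
theorem DYangian.algHom_ext
    (hsep : ∀ b : B, (∀ n : ℕ, ∃ b', b = algebraMap ℂ⟦X⟧ B PowerSeries.X ^ n * b') → b = 0)
    {Ψ Ψ' : DYangian D →ₐ[ℂ⟦X⟧] B} (h : ∀ x, Ψ (DYangian.gen D x) = Ψ' (DYangian.gen D x)) :
    Ψ = Ψ' := by
  have hX : ∀ Ψ : DYangian D →ₐ[ℂ⟦X⟧] B,
      Ψ (DYangian.mk D PowerSeries.X) = algebraMap ℂ⟦X⟧ B PowerSeries.X := fun Ψ => by
    rw [DYangian.mk_X, AlgHom.commutes]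
  have hC : ∀ a, Ψ (DYangian.mk D (PowerSeries.C a)) = Ψ' (DYangian.mk D (PowerSeries.C a)) := by
    intro a
    induction a using FreeAlgebra.induction with
    | grade0 c => rw [DYangian.mk_C_algebraMap, AlgHom.commutes, AlgHom.commutes]
    | grade1 x => exact h x
    | mul a b ha hb => simp only [map_mul, ha, hb]
    | add a b ha hb => simp only [map_add, ha, hb]
  have hP : ∀ p : Polynomial (FreeAlgebra ℂ (YGen I 𝔥 ℤ)),
      Ψ (DYangian.mk D (p : DYFree I 𝔥)) = Ψ' (DYangian.mk D (p : DYFree I 𝔥)) := by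
    intro p
    induction p using Polynomial.induction_on' with
    | add p q hp hq => simp only [Polynomial.coe_add, map_add, hp, hq]
    | monomial n a =>
      rw [← Polynomial.C_mul_X_pow_eq_monomial, Polynomial.coe_mul, Polynomial.coe_C,
        Polynomial.coe_pow, Polynomial.coe_X]
      simp only [map_mul, map_pow, hC, hX]
  refine AlgHom.ext fun x => ?_
  obtain ⟨f, rfl⟩ := DYangian.mk_surjective x
  rw [← sub_eq_zero]
  refine hsep _ fun n => ?_
  -- Both maps agree on the truncation, which is a polynomial, so the difference of their values on
  -- `f` is divisible by `ħ^n`. Linearity over `ℂ⟦ħ⟧` thus replaces any continuity assumption.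
  obtain ⟨f', hf'⟩ : (PowerSeries.X ^ n : DYFree I 𝔥) ∣ f - (PowerSeries.trunc n f : DYFree I 𝔥) := by
    refine PowerSeries.X_pow_dvd_iff.2 fun k hk => ?_
    rw [map_sub, Polynomial.coeff_coe, PowerSeries.coeff_trunc, if_pos hk, sub_self]
  refine ⟨Ψ (DYangian.mk D f') - Ψ' (DYangian.mk D f'), ?_⟩
  rw [eq_add_of_sub_eq hf', map_add, map_add, map_add, hP, map_mul, map_mul, map_mul, map_pow,
    map_pow, map_pow, hX, hX, mul_sub]
  abel

theorem iotaMap_gen (x : YGen I 𝔥 ℕ) :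
    iotaMap D (YForm.gen D x) = DYangian.gen D (x.map (fun n : ℕ => (n : ℤ))) := by
  rw [iotaMap, AlgHom.comp_apply, iotaForm, YForm.lift_gen, jMap, YForm.lift_gen]

theorem map_lie_hom (Ψ : DYangian D →ₐ[ℂ⟦X⟧] B) (x y : DYangian D) : Ψ ⁅x, y⁆ = ⁅Ψ x, Ψ y⁆ := by
  simp only [Ring.lie_def, map_sub, map_mul]

/-- Since `h_{i0} = d_i α_i^∨` and `α_i(α_i^∨) = 2`, every mode of `𝓧_i^±` is an eigenvector with
eigenvalue `±2 d_i`. -/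
theorem lie_map_h_zero (Ψ : DYangian D →ₐ[ℂ⟦X⟧] B) (ε : ℤˣ) (i : I) (s : ℤ) :
    ⁅Ψ (DYangian.gen D (.h i 0)), Ψ (DYangian.gen D (.x ε i s))⁆ =
      algebraMap ℂ⟦X⟧ B (PowerSeries.C (2 * (((ε : ℤ) : ℂ) * D.d i))) *
        Ψ (DYangian.gen D (.x ε i s)) := by
  have h0 := DYangian.sat D (.h_zero i)
  have h1 := DYangian.sat D (.cartan_x ε i s (D.coroot i))
  have hl : ∀ (c : ℂ) (x y : DYangian D), ⁅c • x, y⁆ = c • ⁅x, y⁆ := fun c x y => by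
    rw [Ring.lie_def, Ring.lie_def, smul_mul_assoc, mul_smul_comm, smul_sub]
  rw [← map_lie_hom, h0, hl, h1, smul_smul, DYangian.smul_eq, map_mul, AlgHom.commutes,
    D.root_coroot, D.A_diag,
    show (D.d i : ℂ) * (((ε : ℤ) : ℂ) * ((2 : ℤ) : ℂ)) = 2 * (((ε : ℤ) : ℂ) * D.d i) by
      push_cast; ring]

/-- The relation between `h` and `x` for `i = j` and `r = 0`, where `d_ii = d_i`. It ties the mode
`s` to the mode `s + 1` using only `h_{i0}` and `h_{i1}`, whose images are known, and so allows
descent to negative modes. -/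
theorem lie_map_h_one (Ψ : DYangian D →ₐ[ℂ⟦X⟧] B) (ε : ℤˣ) (i : I) (s : ℤ) :
    ⁅Ψ (DYangian.gen D (.h i 1)), Ψ (DYangian.gen D (.x ε i s))⁆ -
      ⁅Ψ (DYangian.gen D (.h i 0)), Ψ (DYangian.gen D (.x ε i (s + 1)))⁆ =
      algebraMap ℂ⟦X⟧ B (PowerSeries.C (((ε : ℤ) : ℂ) * D.d i)) *
        (algebraMap ℂ⟦X⟧ B PowerSeries.X *
          (Ψ (DYangian.gen D (.h i 0)) * Ψ (DYangian.gen D (.x ε i s)) +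
            Ψ (DYangian.gen D (.x ε i s)) * Ψ (DYangian.gen D (.h i 0)))) := by
  have h1 := congrArg Ψ (DYangian.sat D (.h_x ε i i 0 s))
  have hd : D.dd i i = D.d i := by
    rw [KacMoodyDatum.dd, D.A_diag]
    push_cast
    ring
  rw [map_sub, map_lie_hom, map_lie_hom, DYangian.smul_eq, DYangian.hb_eq, hd, zero_add] at h1
  rw [h1]
  simp only [map_mul, map_add, AlgHom.commutes]

/-- Uniqueness of the extension along `ι`: if `h_{i0}` and `h_{i1}` are sent to `η_{i0}` and
`η_{i1} + ζ η_{i0}`, the image of `x_{i,s}^±` is determined by the image of `x_{i,s+1}^±` as soon as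
a certain operator is injective. -/
theorem DYangian.algHom_ext_iota
    (hsep : ∀ b : B, (∀ n : ℕ, ∃ b', b = algebraMap ℂ⟦X⟧ B PowerSeries.X ^ n * b') → b = 0)
    (η₀ η₁ : I → B) (ζ : B) (hζ : ∀ b, ζ * b = b * ζ)
    (hinj : ∀ (i : I) (κ : ℂ), κ ≠ 0 → ∀ b : B,
      algebraMap ℂ⟦X⟧ B (PowerSeries.C (2 * κ)) * (ζ * b) +
        (η₁ i - algebraMap ℂ⟦X⟧ B (PowerSeries.C κ) * (algebraMap ℂ⟦X⟧ B PowerSeries.X * η₀ i)) * b +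
        b * (-η₁ i - algebraMap ℂ⟦X⟧ B (PowerSeries.C κ) * (algebraMap ℂ⟦X⟧ B PowerSeries.X * η₀ i))
        = 0 → b = 0)
    {Ψ Ψ' : DYangian D →ₐ[ℂ⟦X⟧] B} (h : ∀ y, Ψ (iotaMap D y) = Ψ' (iotaMap D y))
    (h₀ : ∀ i, Ψ (iotaMap D (YForm.gen D (.h i 0))) = η₀ i)
    (h₁ : ∀ i, Ψ (iotaMap D (YForm.gen D (.h i 1))) = η₁ i + ζ * η₀ i) :
    Ψ = Ψ' := by
  have hnat : ∀ x : YGen I 𝔥 ℕ, Ψ (DYangian.gen D (x.map (fun n : ℕ => (n : ℤ)))) =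
      Ψ' (DYangian.gen D (x.map (fun n : ℕ => (n : ℤ)))) := fun x => by
    rw [← iotaMap_gen, h]
  have e0 : ∀ i, Ψ (DYangian.gen D (.h i 0)) = η₀ i := fun i => by
    rw [← h₀, iotaMap_gen]; rfl
  have e1 : ∀ i, Ψ (DYangian.gen D (.h i 1)) = η₁ i + ζ * η₀ i := fun i => by
    rw [← h₁, iotaMap_gen]; rfl
  have e0' : ∀ i, Ψ' (DYangian.gen D (.h i 0)) = η₀ i := fun i => by
    rw [← e0]; exact (hnat (.h i 0)).symm
  have e1' : ∀ i, Ψ' (DYangian.gen D (.h i 1)) = η₁ i + ζ * η₀ i := fun i => by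
    rw [← e1]; exact (hnat (.h i 1)).symm
  -- Descent by one mode: the two copies of `lie_map_h_one` are subtracted, the mode `s + 1`
  -- cancels, and `hinj` applies to the difference of the modes `s`.
  have step : ∀ ε i s, Ψ (DYangian.gen D (.x ε i (s + 1))) = Ψ' (DYangian.gen D (.x ε i (s + 1))) →
      Ψ (DYangian.gen D (.x ε i s)) = Ψ' (DYangian.gen D (.x ε i s)) := by
    intro ε i s hs
    have hκ : ((ε : ℤ) : ℂ) * D.d i ≠ 0 := by
      refine mul_ne_zero ?_ (Nat.cast_ne_zero.2 (D.d_pos i).ne')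
      exact_mod_cast ε.ne_zero
    rw [← sub_eq_zero]
    refine hinj i _ hκ _ ?_
    have a1 := lie_map_h_zero Ψ ε i s
    have a2 := lie_map_h_zero Ψ' ε i s
    have b1 := lie_map_h_one Ψ ε i s
    have b2 := lie_map_h_one Ψ' ε i s
    rw [e0] at a1
    rw [e0'] at a2
    rw [e0, e1, hs] at b1
    rw [e0', e1'] at b2
    -- The rest is arithmetic in a noncommutative ring with central `ζ`, `K = κ`, `M = 2κ` and `t =
    -- ħ`; `W` is the common value at the mode `s + 1`.
    generalize Ψ (DYangian.gen D (.x ε i s)) = X at *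
    generalize Ψ' (DYangian.gen D (.x ε i s)) = X' at *
    generalize ((ε : ℤ) : ℂ) * D.d i = κ at *
    generalize Ψ' (DYangian.gen D (.x ε i (s + 1))) = W at *
    have cK : ∀ b, b * algebraMap ℂ⟦X⟧ B (PowerSeries.C κ) =
        algebraMap ℂ⟦X⟧ B (PowerSeries.C κ) * b := fun b => (Algebra.commutes _ _).symm
    have cX : ∀ b, b * algebraMap ℂ⟦X⟧ B PowerSeries.X =
        algebraMap ℂ⟦X⟧ B PowerSeries.X * b := fun b => (Algebra.commutes _ _).symm
    have c2 : ∀ b, b * algebraMap ℂ⟦X⟧ B (PowerSeries.C (2 * κ)) =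
        algebraMap ℂ⟦X⟧ B (PowerSeries.C (2 * κ)) * b := fun b => (Algebra.commutes _ _).symm
    generalize algebraMap ℂ⟦X⟧ B (PowerSeries.C κ) = K at *
    generalize algebraMap ℂ⟦X⟧ B (PowerSeries.C (2 * κ)) = M at *
    generalize algebraMap ℂ⟦X⟧ B PowerSeries.X = t at *
    have lie_sub : ∀ p q r : B, ⁅p, q - r⁆ = ⁅p, q⁆ - ⁅p, r⁆ := fun p q r => by
      simp only [Ring.lie_def, mul_sub, sub_mul]
      abel
    have hY : ⁅η₀ i, X - X'⁆ = M * (X - X') := by rw [lie_sub, a1, a2, mul_sub]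
    have hZ : ⁅η₁ i + ζ * η₀ i, X - X'⁆ =
        K * (t * (η₀ i * (X - X') + (X - X') * η₀ i)) := by
      have : ⁅η₁ i + ζ * η₀ i, X - X'⁆ = (⁅η₁ i + ζ * η₀ i, X⁆ - ⁅η₀ i, W⁆) -
        (⁅η₁ i + ζ * η₀ i, X'⁆ - ⁅η₀ i, W⁆) := by rw [lie_sub]; abel
      rw [this, b1, b2]
      simp only [mul_sub, mul_add, sub_mul]
      abel
    generalize X - X' = b at *
    -- The eigenvalue equation `hY`, multiplied by `ζ`, identifies the contribution of `ζ h_{i0}` to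
    -- the bracket in `hZ` with `2κ ζ b`, the dominant term in `hinj`.
    have hz : M * (ζ * b) = ζ * (η₀ i * b - b * η₀ i) := by
      rw [← Ring.lie_def, hY, ← mul_assoc, ← mul_assoc, c2]
    have hb' : b * (ζ * η₀ i) = ζ * (b * η₀ i) := by rw [← mul_assoc, ← hζ, mul_assoc]
    have hk : b * (K * (t * η₀ i)) = K * (t * (b * η₀ i)) := by
      rw [← mul_assoc, cK, mul_assoc, ← mul_assoc b, cX, mul_assoc]
    rw [Ring.lie_def, add_mul, mul_add b, hb', mul_add t, mul_add K] at hZ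
    rw [hz, mul_sub, sub_mul, mul_sub b, hk, mul_neg]
    simp only [mul_assoc] at hZ ⊢
    rw [← sub_eq_zero] at hZ
    rw [← hZ]
    abel
  have hx : ∀ ε i (s : ℤ), Ψ (DYangian.gen D (.x ε i s)) = Ψ' (DYangian.gen D (.x ε i s)) := by
    intro ε i s
    -- The descent starts at the mode `0`, which lies in the image of `ι`.
    have hneg : ∀ n : ℕ, Ψ (DYangian.gen D (.x ε i (-n))) = Ψ' (DYangian.gen D (.x ε i (-n))) := by
      intro n
      induction n with
      | zero => exact hnat (.x ε i 0)
      | succ n ih =>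
        refine step _ _ _ ?_
        rw [show (-((n + 1 : ℕ) : ℤ) + 1) = -n by push_cast; ring]
        exact ih
    obtain ⟨n, rfl | rfl⟩ := s.eq_nat_or_neg
    · exact hnat (.x ε i n)
    · exact hneg n
  refine DYangian.algHom_ext hsep fun x => ?_
  cases x with
  | cartan a => exact hnat (.cartan a)
  | x ε i s => exact hx ε i s
  | h i s =>
    -- All modes of `𝓗_i` are recovered from `𝓗_{is} = [𝓧_{is}^+, 𝓧_{i0}^-]`.
    have := DYangian.sat D (.x_x_same i s 0)
    rw [add_zero] at this
    rw [← this, map_lie_hom, map_lie_hom, hx, hx]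

end Extensionality

/-! ### Separatedness of the targets, and the injectivity needed for the completed Yangian. -/

section Separated

theorem HCompletion.eq_zero_of_forall_hb_pow {A : Type*} [Ring A] [Algebra ℂ[X] A]
    (b : HCompletion A)
    (h : ∀ n : ℕ, ∃ b', b = algebraMap ℂ⟦X⟧ (HCompletion A) PowerSeries.X ^ n * b') : b = 0 :=
  HCompletion.ext fun n => by
    obtain ⟨b', rfl⟩ := h n
    rw [algebraMap_X_HCompletion, eval_of_hb_pow, map_zero]

variable {I 𝔥 : Type*} [Fintype I] [AddCommGroup 𝔥] [Module ℂ 𝔥] (D : KacMoodyDatum I 𝔥)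

/-- As `ħ` has degree `1`, a multiple of `ħ^(k+1)` has no component of degree `k`. -/
theorem CompletedYangian.eq_zero_of_forall_hb_pow (b : CompletedYangian D)
    (h : ∀ n : ℕ, ∃ b', b = algebraMap ℂ⟦X⟧ (CompletedYangian D) PowerSeries.X ^ n * b') : b = 0 :=
  CompletedYangian.ext fun k => by
    obtain ⟨b', rfl⟩ := h (k + 1)
    rw [← map_pow, CompletedYangian.coeff_mul, CompletedYangian.coeff_zero]
    refine Finset.sum_eq_zero fun x hx => ?_
    have := Finset.HasAntidiagonal.mem_antidiagonal.1 hx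
    rw [CompletedYangian.coeff_algebraMap, PowerSeries.coeff_X_pow, if_neg (by omega), zero_smul,
      zero_mul]

/-- If `b` starts in degree at least `k`, multiplication on either side by an element without
constant term pushes it past degree `k`. -/
theorem CompletedYangian.coeff_mul_eq_zero {a b : CompletedYangian D} {k : ℕ}
    (ha : CompletedYangian.coeff D 0 a = 0) (hb : ∀ j < k, CompletedYangian.coeff D j b = 0) :
    CompletedYangian.coeff D k (a * b) = 0 ∧ CompletedYangian.coeff D k (b * a) = 0 := by
  rw [CompletedYangian.coeff_mul, CompletedYangian.coeff_mul]
  refine ⟨Finset.sum_eq_zero fun x hx => ?_, Finset.sum_eq_zero fun x hx => ?_⟩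
  · have hx := Finset.HasAntidiagonal.mem_antidiagonal.1 hx
    rcases Nat.eq_zero_or_pos x.1 with h | h
    · rw [h, ha, zero_mul]
    · rw [hb x.2 (by omega), mul_zero]
  · have hx := Finset.HasAntidiagonal.mem_antidiagonal.1 hx
    rcases Nat.eq_zero_or_pos x.2 with h | h
    · rw [h, ha, mul_zero]
    · rw [hb x.1 (by omega), zero_mul]

theorem CompletedYangian.coeff_C_mul (k : ℕ) (c : ℂ) (b : CompletedYangian D) :
    CompletedYangian.coeff D k (algebraMap ℂ⟦X⟧ (CompletedYangian D) (PowerSeries.C c) * b) =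
      c • CompletedYangian.coeff D k b := by
  rw [CompletedYangian.coeff_mul, Finset.sum_eq_single (0, k)]
  · rw [CompletedYangian.coeff_algebraMap, PowerSeries.coeff_zero_C, pow_zero, smul_mul_assoc,
      one_mul]
  · intro x hx hne
    have hx := Finset.HasAntidiagonal.mem_antidiagonal.1 hx
    have : x.1 ≠ 0 := fun h => hne (Prod.ext h (by dsimp only; omega))
    rw [CompletedYangian.coeff_algebraMap, PowerSeries.coeff_C, if_neg this, zero_smul, zero_mul]
  · intro h
    exact absurd (Finset.HasAntidiagonal.mem_antidiagonal.2 (by simp)) h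

/-- Adding operators of positive degree to a nonzero scalar gives an injective operator on
`∏_k (Y_ħ𝔤)_k`. -/
theorem CompletedYangian.eq_zero_of_scalar_add {c : ℂ} (hc : c ≠ 0) {a a' b : CompletedYangian D}
    (ha : CompletedYangian.coeff D 0 a = 0) (ha' : CompletedYangian.coeff D 0 a' = 0)
    (h : algebraMap ℂ⟦X⟧ (CompletedYangian D) (PowerSeries.C c) * b + a * b + b * a' = 0) :
    b = 0 := by
  refine CompletedYangian.ext fun k => ?_
  rw [CompletedYangian.coeff_zero]
  -- Once the components of `b` below degree `k` vanish, only the scalar term contributes in degree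
  -- `k`.
  induction k using Nat.strong_induction_on with
  | _ k ih =>
    have := congrArg (CompletedYangian.coeff D k) h
    rw [CompletedYangian.coeff_add, CompletedYangian.coeff_add, CompletedYangian.coeff_C_mul,
      (CompletedYangian.coeff_mul_eq_zero D ha ih).1, (CompletedYangian.coeff_mul_eq_zero D ha' ih).2,
      add_zero, add_zero, CompletedYangian.coeff_zero] at this
    exact (smul_eq_zero.1 this).resolve_left hc

end Separated

/-! ### The injectivity needed for formal series in `z`. -/

section LHatInjective

variable {I 𝔥 : Type*} [Fintype I] [AddCommGroup 𝔥] [Module ℂ 𝔥] (D : KacMoodyDatum I 𝔥)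

/-- The operator `f ↦ c z f + a f + f a'`. -/
noncomputable def zShiftOp (c : ℂ) (a a' : Yangian D) : YLaurent D →+ YLaurent D :=
  AddMonoidHom.mulLeft (HahnSeries.single (-1) (algebraMap ℂ _ c)) +
    AddMonoidHom.mulLeft (HahnSeries.C a) + AddMonoidHom.mulRight (HahnSeries.C a')

theorem zShiftOp_apply (c : ℂ) (a a' : Yangian D) (f : YLaurent D) : zShiftOp D c a a' f =
    HahnSeries.single (-1) (algebraMap ℂ _ c) * f + HahnSeries.C a * f + f * HahnSeries.C a' := rfl

theorem coeff_zShiftOp (c : ℂ) (a a' : Yangian D) (f : YLaurent D) (m : ℤ) :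
    (zShiftOp D c a a' f).coeff m = c • f.coeff (m + 1) + a * f.coeff m + f.coeff m * a' := by
  rw [zShiftOp_apply, HahnSeries.coeff_add, HahnSeries.coeff_add, HahnSeries.C_apply,
    HahnSeries.C_apply, HahnSeries.coeff_single_zero_mul, HahnSeries.coeff_mul_single_zero]
  have : (HahnSeries.single (-1) (algebraMap ℂ (Yangian D) c) * f).coeff ((m + 1) + -1) =
      algebraMap ℂ (Yangian D) c * f.coeff (m + 1) := HahnSeries.coeff_single_mul_add
  rw [add_neg_cancel_right] at this
  rw [this, Algebra.smul_def]

/-- A nonzero series has a highest power of `z`. Multiplication by `c z` raises it by one, beyond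
the reach of the other two terms. Since the coefficient of `z^{-m}` is stored at `m`, the new top
coefficient sits at `f.order - 1`. -/
theorem zShiftOp_injective {c : ℂ} (hc : c ≠ 0) {a a' : Yangian D} {f : YLaurent D}
    (h : zShiftOp D c a a' f = 0) : f = 0 := by
  by_contra hf
  have h1 := congrArg (fun g => HahnSeries.coeff g (f.order - 1)) h
  simp only [coeff_zShiftOp, HahnSeries.coeff_zero] at h1
  rw [HahnSeries.coeff_eq_zero_of_lt_order (show f.order - 1 < f.order by omega), mul_zero, zero_mul,
    add_zero, add_zero, sub_add_cancel] at h1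
  exact hf (HahnSeries.coeff_order_eq_zero.1 ((smul_eq_zero.1 h1).resolve_left hc))

/-- The coefficients of the solution of `c z f + a f + f a' = ∑_k g_k z^{n-k}`. -/
noncomputable def zShiftInv (c : ℂ) (a a' : Yangian D) (g : ℕ → Yangian D) : ℕ → Yangian D
  | 0 => c⁻¹ • g 0
  | k + 1 => c⁻¹ • (g (k + 1) - a * zShiftInv c a a' g k - zShiftInv c a a' g k * a')

theorem zShiftInv_mem {c : ℂ} {a a' : Yangian D} (ha : a ∈ Yangian.degree D 1)
    (ha' : a' ∈ Yangian.degree D 1) {g : ℕ → Yangian D} (hg : ∀ k : ℕ, g k ∈ Yangian.degree D k)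
    (k : ℕ) : zShiftInv D c a a' g k ∈ Yangian.degree D k := by
  induction k with
  | zero => exact Submodule.smul_mem _ _ (hg 0)
  | succ k ih =>
    refine Submodule.smul_mem _ _ (sub_mem (sub_mem (hg _) ?_) ?_)
    · rw [Nat.cast_succ, add_comm]
      exact SetLike.GradedMul.mul_mem ha ih
    · rw [Nat.cast_succ]
      exact SetLike.GradedMul.mul_mem ih ha'

/-- The equation is solved from the top power of `z` downwards, dividing by `c` each time. The
solution is homogeneous of one degree less because `z`, `a` and `a'` all have degree `1`. -/
theorem zShiftOp_surjOn_LPiece {c : ℂ} (hc : c ≠ 0) {a a' : Yangian D}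
    (ha : a ∈ Yangian.degree D 1) (ha' : a' ∈ Yangian.degree D 1) {n : ℤ} {g : YLaurent D}
    (hg : g ∈ LPiece D n) : ∃ f ∈ LPiece D (n - 1), zShiftOp D c a a' f = g := by
  let F := zShiftInv D c a a' fun k => g.coeff (k - n)
  let f : YLaurent D := HahnSeries.single (-(n - 1)) 1 *
    HahnSeries.ofPowerSeries ℤ _ (PowerSeries.mk F)
  have hF : ∀ k : ℕ, f.coeff (k - (n - 1)) = F k := fun k => by
    rw [coeff_single_mul_ofPowerSeries, PowerSeries.coeff_mk]
  have hF0 : ∀ m, m + (n - 1) < 0 → f.coeff m = 0 := fun m hm =>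
    coeff_single_mul_ofPowerSeries_of_neg _ _ hm
  refine ⟨f, mem_LPiece_of_nat D hF0 fun k => ?_, HahnSeries.ext (funext fun m => ?_)⟩
  · rw [hF]
    exact zShiftInv_mem D ha ha' (fun k => hg k) k
  · rw [coeff_zShiftOp]
    by_cases hm : m + n < 0
    · rw [hF0 _ (by omega), hF0 _ (by omega), smul_zero, mul_zero, zero_mul, add_zero, add_zero]
      have := LPiece.coeff_mem D hg m
      rw [Yangian.degree_of_neg D hm, Submodule.mem_bot] at this
      exact this.symm
    · obtain ⟨k, hk⟩ := Int.eq_ofNat_of_zero_le (not_lt.1 hm)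
      obtain rfl : m = k - n := by omega
      rw [show ((k : ℤ) - n + 1) = k - (n - 1) by ring, hF]
      cases k with
      | zero =>
        -- At the top power `z^n` only `c z f` contributes, since `f` starts at `z^{n-1}`.
        rw [hF0 _ (by push_cast; omega), mul_zero, zero_mul, add_zero, add_zero]
        exact smul_inv_smul₀ hc _
      | succ k =>
        have e : f.coeff (((k + 1 : ℕ) : ℤ) - n) = F k := by
          rw [← hF]
          congr 1
          push_cast
          ring
        rw [e]
        change c • c⁻¹ • (g.coeff _ - a * F k - F k * a') + _ + _ = _
        rw [smul_inv_smul₀ hc]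
        abel

/-- Surjectivity matters because injectivity alone does not survive reduction modulo `ħ^n`; a
preimage of the quotient by `ħ^n` is needed inside the same algebra. -/
theorem zShiftOp_surjOn_LForm {c : ℂ} (hc : c ≠ 0) {a a' : Yangian D}
    (ha : a ∈ Yangian.degree D 1) (ha' : a' ∈ Yangian.degree D 1) {g : YLaurent D}
    (hg : g ∈ LForm D) : ∃ f ∈ LForm D, zShiftOp D c a a' f = g := by
  obtain ⟨x, rfl⟩ := hg
  change ∃ f ∈ LForm D, zShiftOp D c a a' f = DirectSum.coeAlgHom (LPiece D) x
  induction x using DirectSum.induction_on with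
  | zero => exact ⟨0, zero_mem _, by rw [map_zero, map_zero]⟩
  | of n g =>
    have e : DirectSum.coeAlgHom (LPiece D) (DirectSum.of (fun k => LPiece D k) n g)
      = (g : YLaurent D) := DirectSum.coeAlgHom_of _ _ _
    erw [e]
    obtain ⟨f, hf, h⟩ := zShiftOp_surjOn_LPiece D hc ha ha' g.2
    exact ⟨f, LPiece.mem_LForm D hf, h⟩
  | add x y hx hy =>
    obtain ⟨f, hf, h⟩ := hx
    obtain ⟨f', hf', h'⟩ := hy
    exact ⟨f + f', add_mem hf hf', by rw [map_add, map_add, h, h']⟩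

theorem zShiftOp_hb_pow_mul (c : ℂ) (a a' : Yangian D) (n : ℕ) (f : YLaurent D) :
    zShiftOp D c a a' (hb (YLaurent D) ^ n * f) = hb (YLaurent D) ^ n * zShiftOp D c a a' f := by
  have hcomm : ∀ g : YLaurent D, g * hb (YLaurent D) ^ n = hb (YLaurent D) ^ n * g := fun g =>
    ((show Commute g (hb (YLaurent D)) from (Algebra.commutes _ _).symm).pow_right n).eq
  simp only [zShiftOp_apply, mul_add, ← mul_assoc, hcomm]

/-- On the `ħ`-adic completion of `⨁_n z^n ∏_k (Y_ħ𝔤)_k z^{-k}`, the operator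
`f ↦ c z f + a f + f a'` is injective if `a` and `a'` are of degree `1`. -/
theorem LHat.eq_zero_of_zShift {c : ℂ} (hc : c ≠ 0) {a a' : Yangian D}
    (ha : a ∈ Yangian.degree D 1) (ha' : a' ∈ Yangian.degree D 1) {u v w : LForm D}
    (hu : (u : YLaurent D) = HahnSeries.single (-1) (algebraMap ℂ _ c))
    (hv : (v : YLaurent D) = HahnSeries.C a) (hw : (w : YLaurent D) = HahnSeries.C a') {b : LHat D}
    (h : HCompletion.of _ u * b + HCompletion.of _ v * b + b * HCompletion.of _ w = 0) : b = 0 := by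
  refine HCompletion.ext fun n => ?_
  obtain ⟨f, hf⟩ := b.exists_eq_mk n
  have hf := hf n le_rfl
  have h1 : Ideal.Quotient.mk (hIdeal (LForm D) n) (u * f + v * f + f * w) = 0 := by
    rw [← HCompletion.eval_add (HCompletion.eval_add (HCompletion.eval_mul (eval_of n u) hf)
      (HCompletion.eval_mul (eval_of n v) hf)) (HCompletion.eval_mul hf (eval_of n w)), h]
    exact RingHom.map_zero _
  obtain ⟨g, hg⟩ := Ideal.Quotient.eq_zero_iff_mem.1 h1
  have hT : zShiftOp D c a a' f = hb (YLaurent D) ^ n * g := by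
    have := congrArg Subtype.val hg
    rw [zShiftOp_apply, ← hu, ← hv, ← hw]
    exact this
  -- Write `T` for the operator, which commutes with `ħ`. From `T f = ħ^n g` and `g = T g'` follows
  -- `T f = T (ħ^n g')`, so `f = ħ^n g'` by injectivity.
  obtain ⟨g', hg', e⟩ := zShiftOp_surjOn_LForm D hc ha ha' g.2
  have hfg : (f : YLaurent D) = hb (YLaurent D) ^ n * g' := by
    refine sub_eq_zero.1 (zShiftOp_injective D hc (a := a) (a' := a') ?_)
    rw [map_sub, hT, zShiftOp_hb_pow_mul, e, sub_self]
  refine hf.trans (Eq.trans ?_ (RingHom.map_zero _).symm)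
  exact Ideal.Quotient.eq_zero_iff_mem.2 ⟨⟨g', hg'⟩, Subtype.ext hfg⟩

end LHatInjective

/-! ### Coefficients of the divided derivatives of the delta function. -/

section DeltaCoefficients

/-- The coefficient of `u^{-r}` in `δ(z/u)` is `z^r`, whose `n`-th derivative is `r(r-1)⋯(r-n+1)
z^{r-n}`; division by `n!` gives the generalized binomial coefficient. -/
theorem divDerivZ_deltaZU (n : ℕ) (r a : ℤ) :
    divDerivZ n deltaZU a (-r) = if a + n = r then ((Ring.choose r n : ℤ) : ℂ) else 0 := by
  have key : ∀ (n : ℕ) (a : ℤ), derivZ^[n] deltaZU a (-r) =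
      if a + n = r then (descPochhammer ℤ n).smeval (r : ℂ) else 0 := by
    intro n
    induction n with
    | zero =>
      intro a
      simp [deltaZU, ← sub_eq_add_neg, sub_eq_zero]
    | succ n ih =>
      intro a
      rw [Function.iterate_succ_apply']
      simp only [derivZ]
      rw [ih, show a + 1 + (n : ℤ) = a + ((n + 1 : ℕ) : ℤ) by push_cast; ring]
      split_ifs with h
      -- When `a + (n + 1) = r`, the factor `a + 1` produced by the new derivative is `r - n`, the
      -- last factor of the longer falling factorial.
      · rw [descPochhammer_succ_right, Polynomial.smeval_mul, mul_comm ((a : ℂ) + 1),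
          Polynomial.smeval_sub, Polynomial.smeval_X, Polynomial.smeval_natCast, ← h, pow_one,
          pow_zero, nsmul_one]
        congr 1
        push_cast
        ring
      · rw [mul_zero]
  have hc : ((Ring.choose r n : ℤ) : ℂ) = Ring.choose (r : ℂ) n :=
    Ring.map_choose (Int.castRingHom ℂ) r n
  simp only [divDerivZ, Pi.smul_apply, key, hc]
  split_ifs
  · rw [Ring.choose_eq_smul]
  · rw [smul_zero]

/-- Only `n = r - a` contributes to `z^a u^{-r}`, and nothing does if `a > r`. The index on the left
is `-a` because coefficients are stored by powers of `z^{-1}`. -/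
theorem coeff_laurentShift_eq_deltaSum {B : Type*} [Ring B] [Algebra ℂ B] (r : ℤ) (y : ℕ → B)
    (a : ℤ) : (laurentShift r y).coeff (-a) = deltaSum y a (-r) := by
  simp only [deltaSum, divDerivZ_deltaZU]
  by_cases h : a ≤ r
  · obtain ⟨k, hk⟩ := Int.eq_ofNat_of_zero_le (sub_nonneg.2 h)
    obtain rfl : a = r - k := by omega
    rw [neg_sub, coeff_laurentShift, finsum_eq_single _ k, if_pos (by ring), Int.cast_smul_eq_zsmul]
    intro n hn
    rw [if_neg (by omega), zero_smul]
  · rw [coeff_laurentShift_of_neg _ _ (by omega)]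
    symm
    refine finsum_eq_zero_of_forall_eq_zero fun n => ?_
    rw [if_neg (by omega), zero_smul]

end DeltaCoefficients

/-! ### Comparison of `Φ_z` and its evaluations with the shift homomorphisms. -/

section ShiftCompatibility

variable {B B' : Type*} [Ring B] [Ring B']

/-- The same recursion as `shiftSeq_succ` with `c = z`; hence the two shifts coincide for natural
`r`. -/
theorem laurentShift_succ (r : ℤ) (a : ℕ → B) : laurentShift (r + 1) a =
    laurentShift r (fun k => a (k + 1)) + HahnSeries.single (-1) 1 * laurentShift r a := by
  rw [laurentShift, binomSeries_succ, map_add, map_mul, HahnSeries.ofPowerSeries_X, mul_add,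
    ← mul_assoc, HahnSeries.single_mul_single, laurentShift, laurentShift, ← mul_assoc,
    HahnSeries.single_mul_single, one_mul, add_comm, show -(r + 1) + 1 = -r by ring,
    show -(r + 1) = -1 + -r by ring]

theorem laurentShift_natCast (r : ℕ) (a : ℕ → B) : laurentShift (r : ℤ) a =
    shiftSeq (HahnSeries.single (-1) 1) (fun k => HahnSeries.C (a k)) r := by
  induction r generalizing a with
  | zero => rw [Nat.cast_zero, laurentShift_zero, shiftSeq_zero]
  | succ r ih => rw [Nat.cast_succ, laurentShift_succ, shiftSeq_succ, ih, ih]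

theorem map_shiftSeq (f : B →+* B') (c : B) (a : ℕ → B) (r : ℕ) :
    f (shiftSeq c a r) = shiftSeq (f c) (fun k => f (a k)) r := by
  simp [shiftSeq]

theorem map_shiftGen {I 𝔥 : Type*} (f : B →+* B') (c : B) (g : YGen I 𝔥 ℕ → B) (x : YGen I 𝔥 ℕ) :
    f (shiftGen c g x) = shiftGen (f c) (fun x => f (g x)) x := by
  cases x with
  | cartan a => rfl
  | h i r => exact map_shiftSeq _ _ _ _
  | x ε i r => exact map_shiftSeq _ _ _ _

theorem laurentGen_map_natCast {I 𝔥 : Type*} (g : YGen I 𝔥 ℕ → B) (x : YGen I 𝔥 ℕ) :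
    laurentGen g (x.map (fun n : ℕ => (n : ℤ))) =
      shiftGen (HahnSeries.single (-1) 1) (fun x => HahnSeries.C (g x)) x := by
  cases x with
  | cartan a => rfl
  | h i r => exact laurentShift_natCast _ _
  | x ε i r => exact laurentShift_natCast _ _

variable {I 𝔥 : Type*} [Fintype I] [AddCommGroup 𝔥] [Module ℂ 𝔥] (D : KacMoodyDatum I 𝔥)

theorem polyToLaurent_C (y : Yangian D) : polyToLaurent D (Polynomial.C y) = HahnSeries.C y :=
  Polynomial.eval₂_C _ _

theorem polyToLaurent_X : polyToLaurent D Polynomial.X = HahnSeries.single (-1) 1 :=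
  Polynomial.eval₂_X _ _

theorem polyToLForm_C_algebraMap (p : ℂ[X]) :
    polyToLForm D (Polynomial.C (algebraMap ℂ[X] _ p)) = algebraMap ℂ[X] (LForm D) p :=
  Subtype.ext (polyToLaurent_C D _)

theorem tauZ_algebraMap (p : ℂ[X]) : tauZ D (algebraMap ℂ[X] _ p) =
    Polynomial.C (algebraMap ℂ[X] (Yangian D) p) := (tauZ D).commutes p

theorem tauZ_gen (x : YGen I 𝔥 ℕ) : tauZ D (YForm.gen D x) =
    shiftGen Polynomial.X (fun x => Polynomial.C (YForm.gen D x)) x := YForm.lift_gen _ _ _ _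

theorem polyToLForm_tauZ_gen (x : YGen I 𝔥 ℕ) : polyToLForm D (tauZ D (YForm.gen D x)) =
    LForm.gen D (x.map (fun n : ℕ => (n : ℤ))) := by
  refine Subtype.ext ?_
  change polyToLaurent D (tauZ D (YForm.gen D x)) = laurentGen (YForm.gen D) _
  rw [tauZ_gen, map_shiftGen, laurentGen_map_natCast, polyToLaurent_X]
  simp only [polyToLaurent_C]

theorem PhiZ_gen (x : YGen I 𝔥 ℤ) :
    PhiZ D (DYangian.gen D x) = HCompletion.of (LForm D) (LForm.gen D x) :=
  DYangian.lift_gen D _ _ x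

/-- `Φ_z ∘ ȷ` takes values in `⨁_n z^n ∏_k (Y_ħ𝔤)_k z^{-k}`. -/
theorem PhiZ_jMap (x : DYangianForm D) :
    PhiZ D (jMap D x) = HCompletion.of (LForm D) (phiForm D x) := DYangian.lift_jMap D _ _ x

/-- `Φ_z ∘ ι = τ_z`. -/
theorem PhiZ_iotaMap (y : Yangian D) :
    PhiZ D (iotaMap D y) = HCompletion.of (LForm D) (polyToLForm D (tauZ D y)) := by
  -- The identity already holds before `ħ`-adic completion, where it is checked on generators and
  -- scalars.
  have : phiForm D (iotaForm D y) = polyToLForm D (tauZ D y) := by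
    refine YForm.ringHom_ext D (f := ((phiForm D).comp (iotaForm D)).toRingHom)
      (f' := (polyToLForm D).comp (tauZ D).toRingHom) (fun x => ?_) (fun p => ?_) y
    · change phiForm D (iotaForm D (YForm.gen D x)) = polyToLForm D (tauZ D (YForm.gen D x))
      rw [iotaForm, YForm.lift_gen, phiForm, YForm.lift_gen, polyToLForm_tauZ_gen]
    · change ((phiForm D).comp (iotaForm D)) (algebraMap _ _ p) =
        polyToLForm D (tauZ D (algebraMap _ _ p))
      rw [AlgHom.commutes, tauZ_algebraMap, polyToLForm_C_algebraMap]
  rw [← this, ← PhiZ_jMap]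
  rfl

theorem evForm_polyToLForm_C (c : ℂˣ) (y : Yangian D) :
    evForm D c (polyToLForm D (Polynomial.C y)) = toCompleted D y := by
  refine YForm.ringHom_ext D (f := (evForm D c).comp ((polyToLForm D).comp Polynomial.C))
    (f' := (toCompleted D).toRingHom) (fun x => ?_) (fun p => ?_) y
  -- A generator of degree `k`, as a constant in `z`, lies in the summand `z^k ∏_j (Y_ħ𝔤)_j z^{-j}`,
  -- so evaluation multiplies it by `c^{k-k} = 1`.
  · have hx := LPiece.single_mem D (Yangian.gen_mem_degree D x) 0
    have e : polyToLForm D (Polynomial.C (YForm.gen D x)) = ⟨_, LPiece.mem_LForm D hx⟩ :=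
      Subtype.ext (polyToLaurent_C D _)
    change evForm D c (polyToLForm D (Polynomial.C (YForm.gen D x))) = toCompleted D (YForm.gen D x)
    rw [e, evForm_of_mem D c hx]
    refine CompletedYangian.ext fun k => ?_
    rw [coeff_evPiece, coeff_toCompleted D (Yangian.gen_mem_degree D x), HahnSeries.coeff_single]
    by_cases h : (k : ℤ) = (x.map (fun n : ℕ => (n : ℤ))).deg
    · rw [if_pos h, if_pos (by omega), h, sub_zero, sub_self, zpow_zero, Units.val_one, one_smul]
    · rw [if_neg h, if_neg (by omega), smul_zero]
  · change evForm D c (polyToLForm D (Polynomial.C (algebraMap _ _ p))) =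
      toCompleted D (algebraMap _ _ p)
    rw [polyToLForm_C_algebraMap, evForm_algebraMap, AlgHom.commutes]

theorem coeff_toCompleted_algebraMap (c : ℂ) (k : ℕ) :
    CompletedYangian.coeff D k (toCompleted D (algebraMap ℂ (Yangian D) c)) =
      if k = 0 then algebraMap ℂ (Yangian D) c else 0 := by
  have h : algebraMap ℂ (Yangian D) c ∈ Yangian.degree D 0 := by
    rw [Algebra.algebraMap_eq_smul_one]
    exact Submodule.smul_mem _ _ (Yangian.one_mem_degree D)
  rw [coeff_toCompleted D h]
  simp

theorem evForm_polyToLForm_X (c : ℂˣ) :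
    evForm D c (polyToLForm D Polynomial.X) = toCompleted D (algebraMap ℂ (Yangian D) c) := by
  -- The element `z` lies in the summand of degree `0 - (-1) = 1` with coefficient in degree `0`, so
  -- evaluation produces `c^{1-0}`.
  have hx := LPiece.single_mem D (Yangian.one_mem_degree D) (-1)
  have e : polyToLForm D Polynomial.X = ⟨_, LPiece.mem_LForm D hx⟩ :=
    Subtype.ext (polyToLaurent_X D)
  rw [e, evForm_of_mem D c hx]
  refine CompletedYangian.ext fun k => ?_
  rw [coeff_evPiece, coeff_toCompleted_algebraMap, HahnSeries.coeff_single]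
  by_cases h : k = 0
  · subst h
    rw [if_pos rfl, if_pos (by simp), Algebra.algebraMap_eq_smul_one]
    simp
  · rw [if_neg h, if_neg (by push_cast; omega), smul_zero]

theorem tauC_gen (c : ℂ) (x : YGen I 𝔥 ℕ) : tauC D c (YForm.gen D x) =
    shiftGen (algebraMap ℂ _ c) (YForm.gen D) x := YForm.lift_gen _ _ _ _

theorem evForm_polyToLForm_tauZ (c : ℂˣ) (y : Yangian D) :
    evForm D c (polyToLForm D (tauZ D y)) = toCompleted D (tauC D (c : ℂ) y) := by
  refine YForm.ringHom_ext D (f := (evForm D c).comp ((polyToLForm D).comp (tauZ D).toRingHom))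
    (f' := ((toCompleted D).comp (tauC D (c : ℂ))).toRingHom) (fun x => ?_) (fun p => ?_) y
  · change ((evForm D c).comp (polyToLForm D)) (tauZ D (YForm.gen D x)) =
      (toCompleted D).toRingHom (tauC D (c : ℂ) (YForm.gen D x))
    rw [tauZ_gen, tauC_gen, map_shiftGen, map_shiftGen]
    simp only [RingHom.comp_apply, evForm_polyToLForm_C, evForm_polyToLForm_X]
    rfl
  · change evForm D c (polyToLForm D (tauZ D (algebraMap _ _ p))) =
      ((toCompleted D).comp (tauC D (c : ℂ))) (algebraMap _ _ p)
    rw [tauZ_algebraMap, polyToLForm_C_algebraMap, evForm_algebraMap, AlgHom.commutes]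

/-- `Ev_c ∘ Φ_z ∘ ι = τ_c`. -/
theorem evHat_PhiZ_iotaMap (c : ℂˣ) (y : Yangian D) :
    evHat D c (PhiZ D (iotaMap D y)) = toCompleted D (tauC D (c : ℂ) y) := by
  rw [PhiZ_iotaMap, evHat_of, evForm_polyToLForm_tauZ]

end ShiftCompatibility

/-! ### Uniqueness of `Φ_z` and of `Φ_c`. -/

section Uniqueness

variable {I 𝔥 : Type*} [Fintype I] [AddCommGroup 𝔥] [Module ℂ 𝔥] (D : KacMoodyDatum I 𝔥)

theorem algebraMap_C_mul_X_mul_mem_degree (κ : ℂ) {y : Yangian D} (hy : y ∈ Yangian.degree D 0) :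
    algebraMap ℂ[X] (Yangian D) (Polynomial.C κ) * (hb (Yangian D) * y) ∈ Yangian.degree D 1 := by
  have h1 : hb (Yangian D) * y ∈ Yangian.degree D (1 + 0) :=
    SetLike.GradedMul.mul_mem (by simpa using Yangian.hb_pow_mem_degree D 1) hy
  rw [add_zero] at h1
  have := Submodule.smul_mem _ κ h1
  rwa [Algebra.smul_def] at this

theorem LHat.algHom_ext_tauZ {Ψ Ψ' : DYangian D →ₐ[ℂ⟦X⟧] LHat D}
    (h : ∀ y, Ψ (iotaMap D y) = HCompletion.of (LForm D) (polyToLForm D (tauZ D y)))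
    (h' : ∀ y, Ψ' (iotaMap D y) = HCompletion.of (LForm D) (polyToLForm D (tauZ D y))) : Ψ = Ψ' := by
  -- The scalars `κ`, `2κ`, `ħ` and the elements `h_{i0}`, `h_{i1}`, `z` are all images under `F` of
  -- elements of `Y_ħ𝔤[z]`, so the coefficients of the operator can be combined before completion.
  let F : Polynomial (Yangian D) →+* LHat D := (HCompletion.of (LForm D)).comp (polyToLForm D)
  have hp : ∀ p : ℂ[X], algebraMap ℂ⟦X⟧ (LHat D) (p : ℂ⟦X⟧) =
      F (Polynomial.C (algebraMap ℂ[X] (Yangian D) p)) := fun p => by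
    rw [algebraMap_polynomial_HCompletion, ← polyToLForm_C_algebraMap]
    rfl
  have hC : ∀ c : ℂ, algebraMap ℂ⟦X⟧ (LHat D) (PowerSeries.C c) =
      F (Polynomial.C (algebraMap ℂ[X] (Yangian D) (Polynomial.C c))) := fun c => by
    rw [← hp, Polynomial.coe_C]
  have hX : algebraMap ℂ⟦X⟧ (LHat D) PowerSeries.X =
      F (Polynomial.C (hb (Yangian D))) := by
    rw [← hp, Polynomial.coe_X]
  refine DYangian.algHom_ext_iota HCompletion.eq_zero_of_forall_hb_pow
    (fun i => F (Polynomial.C (YForm.gen D (.h i 0))))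
    (fun i => F (Polynomial.C (YForm.gen D (.h i 1)))) (F Polynomial.X) ?_ ?_
    (fun y => (h y).trans (h' y).symm) ?_ ?_
  · intro b
    refine HCompletion.ext fun n => ?_
    obtain ⟨f, hf⟩ := b.exists_eq_mk n
    have hf := hf n le_rfl
    refine (HCompletion.eval_mul (eval_of n _) hf).trans
      (Eq.trans ?_ (HCompletion.eval_mul hf (eval_of n _)).symm)
    congr 1
    refine Subtype.ext ?_
    change polyToLaurent D Polynomial.X * (f : YLaurent D) = f * polyToLaurent D Polynomial.X
    rw [polyToLaurent_X, single_one_comm]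
  · intro i κ hκ b hb
    have g0 : YForm.gen D (.h i 0) ∈ Yangian.degree D 0 := Yangian.gen_mem_degree D (.h i 0)
    have g1 : YForm.gen D (.h i 1) ∈ Yangian.degree D 1 := Yangian.gen_mem_degree D (.h i 1)
    have hm := algebraMap_C_mul_X_mul_mem_degree D κ g0
    -- The operator takes the form of `LHat.eq_zero_of_zShift` with scalar `2κ`, `a = h_{i1} - κħ
    -- h_{i0}` and `a' = -h_{i1} - κħ h_{i0}`, both of degree `1`.
    rw [hX, hC, hC, ← map_mul, ← map_mul, ← map_mul, ← map_mul, ← map_neg, ← map_neg, ← map_sub,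
      ← map_sub, ← map_sub, ← map_sub, ← mul_assoc, ← map_mul] at hb
    refine LHat.eq_zero_of_zShift D (mul_ne_zero two_ne_zero hκ) (sub_mem g1 hm)
      (sub_mem (neg_mem g1) hm) ?_ (polyToLaurent_C D _) (polyToLaurent_C D _) hb
    change polyToLaurent D _ = _
    rw [map_mul, polyToLaurent_C, polyToLaurent_X, HahnSeries.C_apply, HahnSeries.single_mul_single,
      zero_add, mul_one]
    rfl
  · intro i
    rw [h, tauZ_gen]
    simp only [shiftGen, shiftSeq_zero]
    rfl
  · intro i
    rw [h, tauZ_gen, ← map_mul, ← map_add]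
    simp only [shiftGen]
    -- Writing `1` as `0 + 1` lets the recursion yield `τ_z(h_{i1}) = h_{i1} + z h_{i0}`.
    rw [← zero_add 1, shiftSeq_succ, shiftSeq_zero, shiftSeq_zero]
    rfl

theorem CompletedYangian.algHom_ext_tauC (c : ℂˣ) {Ψ Ψ' : DYangian D →ₐ[ℂ⟦X⟧] CompletedYangian D}
    (h : ∀ y, Ψ (iotaMap D y) = toCompleted D (tauC D (c : ℂ) y))
    (h' : ∀ y, Ψ' (iotaMap D y) = toCompleted D (tauC D (c : ℂ) y)) : Ψ = Ψ' := by
  have hc : toCompleted D (algebraMap ℂ (Yangian D) c) =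
      algebraMap ℂ⟦X⟧ (CompletedYangian D) (PowerSeries.C (c : ℂ)) := by
    rw [← Polynomial.coe_C]
    exact (toCompleted D).commutes (Polynomial.C (c : ℂ))
  refine DYangian.algHom_ext_iota (CompletedYangian.eq_zero_of_forall_hb_pow D)
    (fun i => toCompleted D (YForm.gen D (.h i 0)))
    (fun i => toCompleted D (YForm.gen D (.h i 1)))
    (algebraMap ℂ⟦X⟧ (CompletedYangian D) (PowerSeries.C (c : ℂ))) (Algebra.commutes _) ?_
    (fun y => (h y).trans (h' y).symm) ?_ ?_
  · intro i κ hκ b hb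
    have g1 : CompletedYangian.coeff D 0 (toCompleted D (YForm.gen D (.h i 1))) = 0 := by
      rw [coeff_toCompleted D (Yangian.gen_mem_degree D (.h i 1)), if_neg (by simp [YGen.map, YGen.deg])]
    have g0 : CompletedYangian.coeff D 0 (algebraMap ℂ⟦X⟧ (CompletedYangian D) (PowerSeries.C κ) *
        (algebraMap ℂ⟦X⟧ (CompletedYangian D) PowerSeries.X *
          toCompleted D (YForm.gen D (.h i 0)))) = 0 := by
      rw [CompletedYangian.coeff_C_mul, CompletedYangian.coeff_mul]
      simp [CompletedYangian.coeff_algebraMap]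
    have hs : ∀ x y : CompletedYangian D, CompletedYangian.coeff D 0 (x - y) =
        CompletedYangian.coeff D 0 x - CompletedYangian.coeff D 0 y := fun x y =>
      map_sub (PowerSeries.coeff 0) x.1 y.1
    have hn : ∀ x : CompletedYangian D, CompletedYangian.coeff D 0 (-x) =
        -CompletedYangian.coeff D 0 x := fun x => map_neg (PowerSeries.coeff 0) x.1
    -- Here `ζ = c` is a scalar, so the leading term is multiplication by `2κ c`, nonzero because
    -- `c` is; the other two coefficients have no component of degree `0`.
    rw [← mul_assoc, ← map_mul, ← map_mul] at hb
    refine CompletedYangian.eq_zero_of_scalar_add D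
      (mul_ne_zero (mul_ne_zero two_ne_zero hκ) c.ne_zero) ?_ ?_ hb
    · rw [hs, g0, g1, sub_zero]
    · rw [hs, hn, g0, g1, neg_zero, sub_zero]
  · intro i
    rw [h, tauC_gen]
    simp only [shiftGen, shiftSeq_zero]
  · intro i
    rw [h, tauC_gen, ← hc, ← map_mul, ← map_add]
    simp only [shiftGen]
    rw [← zero_add 1, shiftSeq_succ, shiftSeq_zero, shiftSeq_zero]

end Uniqueness

/-! ### The theorem. -/

theorem theorem4p3 {I 𝔥 : Type*} [Fintype I] [AddCommGroup 𝔥] [Module ℂ 𝔥]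
    (D : KacMoodyDatum I 𝔥) :
    ∃ Φ : DYangian D →ₐ[PowerSeries ℂ] LHat D,
      -- `Φ_z ∘ ι = τ_z`, and `Φ_z` is the only homomorphism with this property
      (∀ y : Yangian D, Φ (iotaMap D y) = HCompletion.of (LForm D) (polyToLForm D (tauZ D y))) ∧
      (∀ Ψ : DYangian D →ₐ[PowerSeries ℂ] LHat D,
        (∀ y : Yangian D,
          Ψ (iotaMap D y) = HCompletion.of (LForm D) (polyToLForm D (tauZ D y))) → Ψ = Φ) ∧
      -- `Φ_z(h) = h`
      (∀ h : 𝔥, Φ (DYangian.gen D (YGen.cartan h)) =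
        HCompletion.of (LForm D)
          (polyToLForm D (Polynomial.C (YForm.gen D (YGen.cartan h))))) ∧
      -- `u Φ_z(𝓗_i(u)) = ∑_n h_{in} ∂_z^{(n)} δ(z/u)`, compared at each `z^a u^{-r}`
      (∀ (i : I) (r : ℤ), ∃ F : LForm D,
        Φ (DYangian.gen D (YGen.h i r)) = HCompletion.of (LForm D) F ∧
        ∀ a : ℤ, (F : YLaurent D).coeff (-a) =
          deltaSum (fun n : ℕ => YForm.gen D (YGen.h i n)) a (-r)) ∧
      -- `u Φ_z(𝓧_i^±(u)) = ∑_n x_{in}^± ∂_z^{(n)} δ(z/u)`, compared at each `z^a u^{-r}`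
      (∀ (ε : ℤˣ) (i : I) (r : ℤ), ∃ F : LForm D,
        Φ (DYangian.gen D (YGen.x ε i r)) = HCompletion.of (LForm D) F ∧
        ∀ a : ℤ, (F : YLaurent D).coeff (-a) =
          deltaSum (fun n : ℕ => YForm.gen D (YGen.x ε i n)) a (-r)) ∧
      -- `Φ_z ∘ ȷ` is a `ℤ`-graded homomorphism of `ℂ[ħ]`-algebras into `⨁_n z^n ∏_k Y_k z^{-k}`
      (∃ φ : DYangianForm D →ₐ[Polynomial ℂ] LForm D,
        (∀ x : DYangianForm D, Φ (jMap D x) = HCompletion.of (LForm D) (φ x)) ∧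
        ∀ (n : ℤ), ∀ x ∈ DYangianForm.degree D n, (φ x : YLaurent D) ∈ LPiece D n) ∧
      -- `Φ_c = Ev_c ∘ Φ_z` is the only homomorphism with `Φ_c ∘ ι = τ_c`
      (∀ c : ℂˣ,
        (∀ y : Yangian D, evHat D c (Φ (iotaMap D y)) = toCompleted D (tauC D (c : ℂ) y)) ∧
        ∀ Ψ : DYangian D →ₐ[PowerSeries ℂ] CompletedYangian D,
          (∀ y : Yangian D, Ψ (iotaMap D y) = toCompleted D (tauC D (c : ℂ) y)) →
            Ψ = (evHat D c).comp Φ) := by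
  refine ⟨PhiZ D, PhiZ_iotaMap D, fun Ψ hΨ => LHat.algHom_ext_tauZ D hΨ (PhiZ_iotaMap D),
    fun h => ?_, fun i r => ⟨LForm.gen D (.h i r), PhiZ_gen D _, fun a => ?_⟩,
    fun ε i r => ⟨LForm.gen D (.x ε i r), PhiZ_gen D _, fun a => ?_⟩,
    ⟨phiForm D, PhiZ_jMap D, fun n x hx => phiForm_mem_LPiece D n hx⟩,
    fun c => ⟨evHat_PhiZ_iotaMap D c, fun Ψ hΨ =>
      CompletedYangian.algHom_ext_tauC D c hΨ (evHat_PhiZ_iotaMap D c)⟩⟩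
  · rw [PhiZ_gen]
    exact congrArg _ (Subtype.ext (polyToLaurent_C D _).symm)
  · exact coeff_laurentShift_eq_deltaSum r _ a
  · exact coeff_laurentShift_eq_deltaSum r _ a
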